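/- **Theorem (Guerra's broken replica symmetry bound).** For $N\ge 1$, $\beta,h\in\mathbb R$ and independent unit Gaussian variables $J=(J_{ij})_{1\le i<j\le N}$, let $$Z_N(\beta,h,J)=\sum_{\sigma\in\{-1,1\}^N}\exp\Bigl(\frac{\beta}{\sqrt N}\sum_{i<j}J_{ij}\sigma_i\sigma_j+\beta h\sum_i\sigma_i\Bigr)$$ be the partition function of the Sherrington–Kirkpatrick model. Let $\mathcal X$ be the set of functional order parameters, that is, of nondecreasing functions $x:[0,1]\to[0,1]$. For $x\in\mathcal X$ let $f(q,y)=f(q,y;x,\beta)$, $(q,y)\in[0,1]\times\mathbb R$, be the solution of $$\partial_q f+\tfrac12\,\partial_y^2 f+\tfrac12\,x(q)\,(\partial_y f)^2=0,\qquad f(1,y)=\log\cosh(\beta y).$$ Here a solution is a function $f$ such that $f(q,\cdot)$ is $C^2$ for each $q\in[0,1]$, such that $f,\partial_y f,\partial_y^2 f$ are continuous on $[0,1]\times\mathbb R$ and $\partial_y f$ is bounded, which satisfies the final condition, and for which, at every $q\in(0,1)$ at which $x$ is continuous (hence at all but countably many $q$) and every $y$, the derivative $\partial_q f$ exists and the equation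 holds. For every $x\in\mathcal X$ there is exactly one such solution, so that the trial function $$\mathcal P(x)=\log 2+f(0,h;x,\beta)-\frac{\beta^2}{2}\int_0^1 q\,x(q)\,dq$$ is well defined. Then, for all $\beta,h\in\mathbb R$, the trial function $\mathcal P$ is bounded below on $\mathcal X$, and for every $N\ge1$ the variable $\log Z_N(\beta,h,J)$ is integrable and $$N^{-1}E\log Z_N(\beta,h,J)\le \log 2+f(0,h;x,\beta)-\frac{\beta^2}{2}\int_0^1 q\,x(q)\,dq\qquad\text{for every }x\in\mathcal X .$$ Consequently, for every $N\ge1$, $$N^{-1}E\log Z_N(\beta,h,J)\le\inf_{x\in\mathcal X}\Bigl(\log 2+f(0,h;x,\beta)-\frac{\beta^2}{2}\int_0^1 q\,x(q)\,dq\Bigr).$$ The same assertions (integrability and both bounds) hold when $Z_N(\beta,h,J)$ is replaced by its equivalent form $$\sum_{\sigma\in\{-1,1\}^N}\exp\Bigl(\beta\sqrt{\tfrac N2}\,\mathcal K(\sigma)\Bigr)\exp\Bigl(\beta h\sum_i\sigma_i\Bigr),$$ where $(\mathcal K(\sigma))_\sigma$ is a centered jointly Gaussian family with $E\,\mathcal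 K(\sigma)\mathcal K(\sigma')=\bigl(N^{-1}\sum_i\sigma_i\sigma'_i\bigr)^2$. -/

import Mathlib

open MeasureTheory ProbabilityTheory Set

noncomputable section

namespace SpinGlass

/-- Ising configurations `σ₁, …, σ_N` with `σᵢ = ± 1`. -/
abbrev Config (N : ℕ) : Type := Fin N → ℤˣ

/-- The real value `± 1` of the spin at the site `i`. -/
def spin {N : ℕ} (σ : Config N) (i : Fin N) : ℝ := ((σ i : ℤ) : ℝ)

/-- The `N (N - 1) / 2` couples of sites. -/
abbrev Couple (N : ℕ) : Type := {p : Fin N × Fin N // p.1 < p.2}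

/-- The Hamiltonian of the mean field spin glass in the external field `h`, for the couplings `J`. -/
def hamiltonian {N : ℕ} (h : ℝ) (J : Couple N → ℝ) (σ : Config N) : ℝ :=
  -(1 / √(N : ℝ)) * ∑ p : Couple N, J p * spin σ p.1.1 * spin σ p.1.2 - h * ∑ i, spin σ i

/-- The disorder dependent partition function `Z_N(β, h, J)`. -/
def partitionFunction {N : ℕ} (β h : ℝ) (J : Couple N → ℝ) : ℝ :=
  ∑ σ : Config N, Real.exp (-β * hamiltonian h J σ)

/-- The quenched disorder: independent unit Gaussian variables, one for each couple of sites. -/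
structure IsQuenchedDisorder {Ω : Type*} [MeasurableSpace Ω] {N : ℕ}
    (J : Couple N → Ω → ℝ) (P : Measure Ω) : Prop where
  indep : iIndepFun J P
  law : ∀ p, HasLaw (J p) (gaussianReal 0 1) P

/-- The overlap of two configurations. -/
def overlap {N : ℕ} (σ τ : Config N) : ℝ := (N : ℝ)⁻¹ * ∑ i, spin σ i * spin τ i

/-- A centered Gaussian family indexed by the configurations, with covariance the squared overlap. -/
structure IsOverlapField {Ω : Type*} [MeasurableSpace Ω] {N : ℕ}
    (K : Config N → Ω → ℝ) (P : Measure Ω) : Prop where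
  gaussian : IsGaussianProcess K P
  centered : ∀ σ, ∫ ω, K σ ω ∂P = 0
  covariance : ∀ σ τ, ∫ ω, K σ ω * K τ ω ∂P = overlap σ τ ^ 2

/-- The partition function written through the values `k σ` of the overlap field. -/
def fieldPartitionFunction {N : ℕ} (β h : ℝ) (k : Config N → ℝ) : ℝ :=
  ∑ σ : Config N, Real.exp (β * √((N : ℝ) / 2) * k σ) * Real.exp (β * h * ∑ i, spin σ i)

/-- The functional order parameters: nondecreasing functions from `[0,1]` to `[0,1]`
(the values outside `[0,1]` play no role). -/
def OrderParameter : Set (ℝ → ℝ) :=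
  {x | MonotoneOn x (Icc 0 1) ∧ MapsTo x (Icc 0 1) (Icc 0 1)}

/-- `f` solves on `[0,1] × ℝ` the antiparabolic equation
`∂_q f + (1/2) ∂_y² f + (1/2) x(q) (∂_y f)² = 0` with `f(1,y) = log cosh (β y)`.
The functions `f`, `∂_y f`, `∂_y² f` are continuous up to the boundary and `∂_y f` is bounded (without
a growth condition even the linear equation has many solutions). The equation holds at each interior
`q` at which `x` is continuous, that is, for all but countably many `q`; at a jump of `x` the
derivative in `q` cannot be expected to exist. -/
structure IsParisiSolution (β : ℝ) (x : ℝ → ℝ) (f : ℝ → ℝ → ℝ) : Prop where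
  contDiff : ∀ q ∈ Icc (0 : ℝ) 1, ContDiff ℝ 2 (f q)
  continuousOn : ContinuousOn (fun p : ℝ × ℝ => f p.1 p.2) (Icc 0 1 ×ˢ univ)
  continuousOn_dy : ContinuousOn (fun p : ℝ × ℝ => deriv (f p.1) p.2) (Icc 0 1 ×ˢ univ)
  continuousOn_dyy : ContinuousOn (fun p : ℝ × ℝ => deriv (deriv (f p.1)) p.2) (Icc 0 1 ×ˢ univ)
  bounded_dy : ∃ C : ℝ, ∀ q ∈ Icc (0 : ℝ) 1, ∀ y, |deriv (f q) y| ≤ C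
  equation : ∀ q ∈ Ioo (0 : ℝ) 1, ContinuousAt x q → ∀ y,
    DifferentiableAt ℝ (fun s => f s y) q ∧
      deriv (fun s => f s y) q + 1 / 2 * deriv (deriv (f q)) y
        + 1 / 2 * x q * (deriv (f q) y) ^ 2 = 0
  final : ∀ y, f 1 y = Real.log (Real.cosh (β * y))

/-- The solution `f(q, y; x, β)` (determined on `[0,1] × ℝ`). -/
def parisiFunction (β : ℝ) (x : ℝ → ℝ) : ℝ → ℝ → ℝ :=
  Classical.epsilon (IsParisiSolution β x)

/-- The trial function `log 2 + f(0, h; x, β) - (β² / 2) ∫₀¹ q x(q) dq`. -/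
def trial (β h : ℝ) (x : ℝ → ℝ) : ℝ :=
  Real.log 2 + parisiFunction β x 0 h - β ^ 2 / 2 * ∫ q in (0 : ℝ)..1, q * x q

end SpinGlass

end

/-! The bound is Guerra's interpolation, carried out on functions F(θ, z) of an angle and of a
vector z of energies. The starting point is the free energy `logSum z`, transformed again and again
by G ↦ m⁻¹ log E exp(m G), with E over a Gaussian displacement of z whose amplitude depends on θ.
Fields on the single spins enter with amplitude √(q - q') cos θ, one layer for each value m of a
piecewise constant order parameter, from q = 1 down to q = 0; the couplings enter last, with
amplitude sin θ. At θ = 0 only independent spins remain, and F is a sum over the sites of the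
function produced by the same recursion on the line, which solves the Parisi equation for the step
order parameter. At θ = π/2 only the couplings remain, and by Jensen's inequality F dominates the
quenched average.

The derivative in θ is controlled through `flowDeriv`, which adds to ∂_θ F the terms ∂²F + m (∂F)²
in the directions of couplings and fields, with weights ρ. This expression is linear in exp(m F), so
by Gaussian integration by parts a layer only moves the weights, and an upper bound survives it
(`flowDeriv_coleHopf_le`). The bound has to be changed only when m is lowered. The change is then a
quadratic form in the derivatives of F with respect to the single energies, which are nonnegative
with sum 1; completing the square leaves the average of (overlap - q)² ≥ 0 (`sum_sq_directions_ge`).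
Once all weights are 0, integration over θ gives the bound for step order parameters
(`Cascade.integral_logSum_le`).

For a general x one needs the Parisi equation. Where x is constant it is solved by the Cole-Hopf
transformation of the heat flow, so step order parameters have explicit solutions, with bounds on
three derivatives in y that do not depend on the number of steps (`SliceBound`). A maximum principle
(`RightSolution.sub_le`) shows that the solution depends on x in a Lipschitz way in the uniform
norm. Step approximations are therefore Cauchy, the derivative bounds extend this to two derivatives
in y, and the limit solves the equation (`exists_isParisiSolution`); the same principle gives
uniqueness. The steps lie above x, so their integrals dominate that of 2 q x(q), and this one-sided
comparison is enough for the trial function. All steps are positive, so m = 0 never occurs. -/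

open MeasureTheory ProbabilityTheory Set

noncomputable section

namespace SpinGlass

open scoped ContDiff Topology

set_option linter.unusedSectionVars false

/-! ### Calculus of functions whose derivatives grow at most exponentially -/

section ExpGrowth

variable {X Y F G H : Type} [NormedAddCommGroup X] [NormedSpace ℝ X]
  [NormedAddCommGroup Y] [NormedSpace ℝ Y] [NormedAddCommGroup F] [NormedSpace ℝ F]
  [NormedAddCommGroup G] [NormedSpace ℝ G] [NormedAddCommGroup H] [NormedSpace ℝ H]

/-- At most exponential growth. -/
def ExpGrowth {X F : Type} [Norm X] [Norm F] (f : X → F) : Prop :=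
  ∃ C : ℝ, 0 ≤ C ∧ ∀ x, ‖f x‖ ≤ Real.exp (C * (1 + ‖x‖))

/-- At most linear growth. -/
def LinGrowth {X F : Type} [Norm X] [Norm F] (f : X → F) : Prop :=
  ∃ C : ℝ, 0 ≤ C ∧ ∀ x, ‖f x‖ ≤ C * (1 + ‖x‖)

lemma ExpGrowth.of_le {f : X → F} {g : X → G} (hg : ExpGrowth g) (h : ∀ x, ‖f x‖ ≤ ‖g x‖) :
    ExpGrowth f := by
  obtain ⟨C, hC, h'⟩ := hg
  exact ⟨C, hC, fun x => (h x).trans (h' x)⟩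

lemma expGrowth_of_bounded {f : X → F} (C : ℝ) (h : ∀ x, ‖f x‖ ≤ C) : ExpGrowth f := by
  refine ⟨|C|, abs_nonneg _, fun x => ?_⟩
  have h1 := Real.add_one_le_exp (|C| * (1 + ‖x‖))
  have h2 : 0 ≤ |C| * ‖x‖ := by positivity
  linarith [h x, le_abs_self C]

lemma ExpGrowth.mul {f g : X → ℝ} (hf : ExpGrowth f) (hg : ExpGrowth g) :
    ExpGrowth (fun x => f x * g x) := by
  obtain ⟨C, hC, hf⟩ := hf
  obtain ⟨D, hD, hg⟩ := hg
  refine ⟨C + D, by positivity, fun x => ?_⟩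
  rw [norm_mul, add_mul, Real.exp_add]
  exact mul_le_mul (hf x) (hg x) (norm_nonneg _) (Real.exp_nonneg _)

lemma ExpGrowth.add {f g : X → F} (hf : ExpGrowth f) (hg : ExpGrowth g) :
    ExpGrowth (fun x => f x + g x) := by
  obtain ⟨C, hC, hf⟩ := hf
  obtain ⟨D, hD, hg⟩ := hg
  refine ⟨C + D + 1, by positivity, fun x => ?_⟩
  have h2 : (2 : ℝ) ≤ Real.exp 1 := by have := Real.add_one_le_exp (1 : ℝ); linarith
  have hx := norm_nonneg x
  calc ‖f x + g x‖ ≤ ‖f x‖ + ‖g x‖ := norm_add_le _ _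
    _ ≤ Real.exp ((C + D) * (1 + ‖x‖)) + Real.exp ((C + D) * (1 + ‖x‖)) := by
        refine add_le_add ((hf x).trans ?_) ((hg x).trans ?_) <;>
          exact Real.exp_le_exp.2 (by nlinarith)
    _ ≤ Real.exp ((C + D) * (1 + ‖x‖)) * Real.exp 1 := by
        nlinarith [Real.exp_pos ((C + D) * (1 + ‖x‖))]
    _ ≤ _ := by
        rw [← Real.exp_add]
        exact Real.exp_le_exp.2 (by nlinarith)

lemma LinGrowth.add {f g : X → F} (hf : LinGrowth f) (hg : LinGrowth g) :
    LinGrowth (fun x => f x + g x) := by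
  obtain ⟨C, hC, hf⟩ := hf
  obtain ⟨D, hD, hg⟩ := hg
  exact ⟨C + D, by positivity, fun x => (norm_add_le _ _).trans (by linarith [hf x, hg x])⟩

lemma ExpGrowth.comp {f : Y → F} {A : X → Y} (hf : ExpGrowth f) (hA : LinGrowth A) :
    ExpGrowth (fun x => f (A x)) := by
  obtain ⟨C, hC, hf⟩ := hf
  obtain ⟨D, hD, hA⟩ := hA
  refine ⟨C * (1 + D), by positivity, fun x => (hf _).trans (Real.exp_le_exp.2 ?_)⟩
  have hx := norm_nonneg x
  have := hA x
  rw [mul_assoc]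
  gcongr
  nlinarith

/-- `C^n` functions whose derivatives up to order `n` have at most exponential growth. -/
structure ExpDiff (n : ℕ) (f : X → F) : Prop where
  contDiff : ContDiff ℝ n f
  growth : ∀ i ≤ n, ExpGrowth (iteratedFDeriv ℝ i f)

/-- Smooth functions all of whose derivatives have at most exponential growth. -/
def ExpSmooth (f : X → F) : Prop := ∀ n, ExpDiff n f

lemma ExpDiff.growth_zero {n : ℕ} {f : X → F} (h : ExpDiff n f) : ExpGrowth f :=
  (h.growth 0 (Nat.zero_le _)).of_le fun x => by rw [norm_iteratedFDeriv_zero]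

lemma ExpDiff.of_le {n m : ℕ} {f : X → F} (h : ExpDiff n f) (hm : m ≤ n) : ExpDiff m f :=
  ⟨h.contDiff.of_le (by exact_mod_cast hm), fun i hi => h.growth i (hi.trans hm)⟩

/-- Summing the exponents of all orders up to n gives a single exponent, as the estimates for
derivatives of products and compositions require. -/
lemma ExpDiff.exists_bound {n : ℕ} {f : X → F} (h : ExpDiff n f) :
    ∃ C : ℝ, 0 ≤ C ∧ ∀ i ≤ n, ∀ x, ‖iteratedFDeriv ℝ i f x‖ ≤ Real.exp (C * (1 + ‖x‖)) := by
  have h2 : ∀ i, ∃ C : ℝ, 0 ≤ C ∧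
      (i ≤ n → ∀ x, ‖iteratedFDeriv ℝ i f x‖ ≤ Real.exp (C * (1 + ‖x‖))) := by
    intro i
    by_cases hi : i ≤ n
    · obtain ⟨C, hC, h3⟩ := h.growth i hi
      exact ⟨C, hC, fun _ => h3⟩
    · exact ⟨0, le_rfl, fun h => absurd h hi⟩
  choose C hC h3 using h2
  refine ⟨∑ i ∈ Finset.range (n + 1), C i, Finset.sum_nonneg fun i _ => hC i, fun i hi x => ?_⟩
  refine (h3 i hi x).trans (Real.exp_le_exp.2 ?_)
  have hx := norm_nonneg x
  gcongr
  exact Finset.single_le_sum (f := C) (fun i _ => hC i) (Finset.mem_range.2 (by omega))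

lemma expDiff_zero {f : X → F} : ExpDiff 0 f ↔ Continuous f ∧ ExpGrowth f := by
  refine ⟨fun h => ⟨h.contDiff.continuous, h.growth_zero⟩, fun h => ⟨?_, fun i hi => ?_⟩⟩
  · exact_mod_cast contDiff_zero.2 h.1
  · obtain rfl : i = 0 := by omega
    exact h.2.of_le fun x => by rw [norm_iteratedFDeriv_zero]

lemma expDiff_succ {n : ℕ} {f : X → F} :
    ExpDiff (n + 1) f ↔ Differentiable ℝ f ∧ ExpGrowth f ∧ ExpDiff n (fderiv ℝ f) := by
  constructor
  · intro h
    have h1 := h.contDiff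
    push_cast at h1
    rw [contDiff_succ_iff_fderiv] at h1
    refine ⟨h1.1, h.growth_zero, h1.2.2, fun i hi => ?_⟩
    exact (h.growth (i + 1) (by omega)).of_le fun x => by rw [norm_iteratedFDeriv_fderiv]
  · rintro ⟨h1, h2, h3⟩
    refine ⟨?_, fun i hi => ?_⟩
    · push_cast
      rw [contDiff_succ_iff_fderiv]
      exact ⟨h1, by simp, h3.contDiff⟩
    · rcases i with _ | i
      · exact h2.of_le fun x => by rw [norm_iteratedFDeriv_zero]
      · exact (h3.growth i (by omega)).of_le fun x => by rw [norm_iteratedFDeriv_fderiv]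

lemma ExpSmooth.growth {f : X → F} (h : ExpSmooth f) : ExpGrowth f := (h 0).growth_zero

lemma ExpSmooth.differentiable {f : X → F} (h : ExpSmooth f) : Differentiable ℝ f :=
  (expDiff_succ.1 (h 1)).1

lemma ExpSmooth.continuous {f : X → F} (h : ExpSmooth f) : Continuous f :=
  h.differentiable.continuous

lemma ExpSmooth.fderiv {f : X → F} (h : ExpSmooth f) : ExpSmooth (fderiv ℝ f) :=
  fun n => (expDiff_succ.1 (h (n + 1))).2.2

/-- When the derivative is a formula in functions already treated, only a bound of order zero
remains to be proved; linear maps and logarithms are handled in this way. -/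
lemma ExpSmooth.of_fderiv {f : X → F} (h1 : Differentiable ℝ f) (h2 : ExpGrowth f)
    (h3 : ExpSmooth (_root_.fderiv ℝ f)) : ExpSmooth f := fun n =>
  (expDiff_succ.2 ⟨h1, h2, h3 n⟩).of_le (Nat.le_succ n)

lemma expSmooth_const (c : F) : ExpSmooth (fun _ : X => c) := by
  intro n
  refine ⟨contDiff_const, fun i _ => expGrowth_of_bounded ‖c‖ fun x => ?_⟩
  rcases i with _ | i
  · rw [norm_iteratedFDeriv_zero]
  · rw [iteratedFDeriv_const_of_ne (by omega)]
    simp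

lemma expGrowth_clm (L : X →L[ℝ] F) : ExpGrowth L := by
  refine ⟨‖L‖, norm_nonneg _, fun x => (L.le_opNorm x).trans ?_⟩
  have h1 := Real.add_one_le_exp (‖L‖ * (1 + ‖x‖))
  have := norm_nonneg L
  linarith

lemma linGrowth_clm (L : X →L[ℝ] F) : LinGrowth L := by
  refine ⟨‖L‖, norm_nonneg _, fun x => (L.le_opNorm x).trans ?_⟩
  have := norm_nonneg L
  linarith

lemma LinGrowth.expGrowth {f : X → F} (hf : LinGrowth f) : ExpGrowth f := by
  obtain ⟨C, hC, h⟩ := hf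
  refine ⟨C, hC, fun x => (h x).trans ?_⟩
  linarith [Real.add_one_le_exp (C * (1 + ‖x‖))]

lemma expSmooth_clm (L : X →L[ℝ] F) : ExpSmooth (fun x => L x) := by
  refine .of_fderiv L.differentiable (expGrowth_clm L) ?_
  have : _root_.fderiv ℝ (fun x => L x) = fun _ => L := by ext1 x; exact L.fderiv
  rw [this]
  exact expSmooth_const L

lemma ExpDiff.bilin {n : ℕ} (B : F →L[ℝ] G →L[ℝ] H) {f : X → F} {g : X → G}
    (hf : ExpDiff n f) (hg : ExpDiff n g) : ExpDiff n (fun x => B (f x) (g x)) := by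
  obtain ⟨C, hC, h1⟩ := hf.exists_bound
  obtain ⟨D, hD, h2⟩ := hg.exists_bound
  refine ⟨(B.isBoundedBilinearMap.contDiff).comp (hf.contDiff.prodMk hg.contDiff), fun i hi => ?_⟩
  have h3 : ExpGrowth (fun x : X => ‖B‖ * ∑ j ∈ Finset.range (i + 1), (i.choose j : ℝ) *
      Real.exp ((C + D) * (1 + ‖x‖))) := by
    simp_rw [← Finset.sum_mul]
    refine (expGrowth_of_bounded (‖B‖) (fun x : X => (abs_of_nonneg (by positivity)).le)).mul
      ((expGrowth_of_bounded _ (fun x : X => le_rfl)).mul ⟨C + D, by positivity, fun x => ?_⟩)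
    simp
  refine h3.of_le fun x => ?_
  have hi' : (i : ℕ∞ω) ≤ n := by exact_mod_cast hi
  refine (B.norm_iteratedFDeriv_le_of_bilinear hf.contDiff hg.contDiff x hi').trans
    (le_trans ?_ (le_abs_self _))
  refine mul_le_mul_of_nonneg_left (Finset.sum_le_sum fun j hj => ?_) (by positivity)
  have hj' : j ≤ i := by rw [Finset.mem_range] at hj; omega
  rw [mul_assoc, add_mul, Real.exp_add]
  refine mul_le_mul_of_nonneg_left ?_ (by positivity)
  exact mul_le_mul (h1 j (by omega) x) (h2 (i - j) (by omega) x) (norm_nonneg _) (Real.exp_nonneg _)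

lemma ExpSmooth.bilin (B : F →L[ℝ] G →L[ℝ] H) {f : X → F} {g : X → G}
    (hf : ExpSmooth f) (hg : ExpSmooth g) : ExpSmooth (fun x => B (f x) (g x)) :=
  fun n => (hf n).bilin B (hg n)

lemma ExpDiff.clm {n : ℕ} (L : F →L[ℝ] G) {f : X → F} (hf : ExpDiff n f) :
    ExpDiff n (fun x => L (f x)) :=
  ExpDiff.bilin (ContinuousLinearMap.apply ℝ G).flip (expSmooth_const L n) hf

lemma ExpSmooth.clm (L : F →L[ℝ] G) {f : X → F} (hf : ExpSmooth f) :
    ExpSmooth (fun x => L (f x)) := fun n => (hf n).clm L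

lemma ExpSmooth.add {f g : X → F} (hf : ExpSmooth f) (hg : ExpSmooth g) :
    ExpSmooth (fun x => f x + g x) := by
  intro n
  refine ⟨(hf n).contDiff.add (hg n).contDiff, fun i hi => ?_⟩
  refine (((hf n).growth i hi).add ((hg n).growth i hi)).of_le fun x => ?_
  have hi' : (i : ℕ∞ω) ≤ n := by exact_mod_cast hi
  rw [← Pi.add_def, iteratedFDeriv_add_apply (((hf n).contDiff.of_le hi').contDiffAt)
    (((hg n).contDiff.of_le hi').contDiffAt)]

lemma ExpSmooth.mul {f g : X → ℝ} (hf : ExpSmooth f) (hg : ExpSmooth g) :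
    ExpSmooth (fun x => f x * g x) := hf.bilin (ContinuousLinearMap.mul ℝ ℝ) hg

lemma ExpSmooth.const_mul (c : ℝ) {f : X → ℝ} (hf : ExpSmooth f) :
    ExpSmooth (fun x => c * f x) := (expSmooth_const c).mul hf

lemma ExpSmooth.sum {ι : Type*} (s : Finset ι) {f : ι → X → ℝ} (hf : ∀ i ∈ s, ExpSmooth (f i)) :
    ExpSmooth (fun x => ∑ i ∈ s, f i x) := by
  classical
  induction s using Finset.induction_on with
  | empty => simpa using expSmooth_const (0 : ℝ)
  | insert a s ha ih =>
    simp_rw [Finset.sum_insert ha]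
    exact (hf a (by simp)).add (ih fun i hi => hf i (by simp [hi]))

lemma ExpSmooth.comp {f : Y → F} {A : X → Y} (hf : ExpSmooth f) (hA : ExpSmooth A)
    (hA' : LinGrowth A) : ExpSmooth (fun x => f (A x)) := by
  intro n
  obtain ⟨C, hC, h1⟩ := (hf n).exists_bound
  obtain ⟨D, hD, h2⟩ := (hA n).exists_bound
  refine ⟨(hf n).contDiff.comp (hA n).contDiff, fun i hi => ?_⟩
  have e1 : ExpGrowth (fun y : Y => Real.exp (C * (1 + ‖y‖))) := ⟨C, hC, fun y => by simp⟩
  have h3 : ExpGrowth (fun x : X => (Nat.factorial i : ℝ) * (Real.exp (C * (1 + ‖A x‖)) *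
      Real.exp (D * i * (1 + ‖x‖)))) := by
    refine (expGrowth_of_bounded _ (fun x : X => le_rfl)).mul ((e1.comp hA').mul
      ⟨D * i, by positivity, fun x => ?_⟩)
    simp
  refine h3.of_le fun x => ?_
  have hi' : (i : ℕ∞ω) ≤ n := by exact_mod_cast hi
  refine (norm_iteratedFDeriv_comp_le (hf n).contDiff (hA n).contDiff hi' x
    (C := Real.exp (C * (1 + ‖A x‖))) (D := Real.exp (D * (1 + ‖x‖)))
    (fun j hj => h1 j (by omega) _) (fun j hj hj' => ?_)).trans (le_trans (le_of_eq ?_)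
      (le_abs_self _))
  · refine (h2 j (by omega) x).trans (le_self_pow₀ (Real.one_le_exp ?_) (by omega))
    positivity
  · rw [← Real.exp_nat_mul]
    ring_nf

lemma expSmooth_exp : ExpSmooth Real.exp := by
  intro n
  refine ⟨Real.contDiff_exp.of_le le_top, fun i _ => ⟨1, zero_le_one, fun x => ?_⟩⟩
  rw [norm_iteratedFDeriv_eq_norm_iteratedDeriv, iteratedDeriv_eq_iterate, Real.iter_deriv_exp]
  rw [Real.norm_eq_abs, Real.abs_exp, Real.exp_le_exp, one_mul]
  linarith [le_abs_self x, Real.norm_eq_abs x]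

lemma ExpSmooth.exp {f : X → ℝ} (hf : ExpSmooth f) (hf' : LinGrowth f) :
    ExpSmooth (fun x => Real.exp (f x)) := expSmooth_exp.comp hf hf'

/-- The derivative of 1/f is -f⁻¹ f⁻¹ f', which involves 1/f only to the previous order, so an
induction on the order closes. -/
lemma ExpSmooth.inv {f : X → ℝ} (hf : ExpSmooth f) (hf' : ExpGrowth (fun x => (f x)⁻¹))
    (h0 : ∀ x, f x ≠ 0) : ExpSmooth (fun x => (f x)⁻¹) := by
  intro n
  induction n with
  | zero => exact expDiff_zero.2 ⟨hf.continuous.inv₀ h0, hf'⟩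
  | succ n ih =>
    refine expDiff_succ.2 ⟨fun x => (hf.differentiable x).inv (h0 x), hf', ?_⟩
    have : _root_.fderiv ℝ (fun x => (f x)⁻¹)
        = fun x => (ContinuousLinearMap.lsmul ℝ ℝ) ((ContinuousLinearMap.mul ℝ ℝ) ((f x)⁻¹)
          ((-ContinuousLinearMap.id ℝ ℝ) ((f x)⁻¹))) (_root_.fderiv ℝ f x) := by
      ext1 x
      have key : HasFDerivAt (fun x => (f x)⁻¹) _ x :=
        (hasDerivAt_inv (h0 x)).hasFDerivAt.comp x (hf.differentiable x).hasFDerivAt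
      rw [key.fderiv]
      ext u
      simp
      ring
    rw [this]
    exact ExpDiff.bilin _ (ExpDiff.bilin _ ih (ih.clm _)) (hf.fderiv n)

/-- Exponential bounds on f and on 1/f bound log f linearly from both sides. Linear growth is what
allows the logarithm to be exponentiated again in the next layer. -/
lemma ExpSmooth.log {f : X → ℝ} (hf : ExpSmooth f) (hf' : ExpGrowth (fun x => (f x)⁻¹))
    (h0 : ∀ x, 0 < f x) :
    ExpSmooth (fun x => Real.log (f x)) ∧ LinGrowth (fun x => Real.log (f x)) := by
  have hl : LinGrowth (fun x => Real.log (f x)) := by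
    obtain ⟨C, hC, h1⟩ := hf'
    obtain ⟨D, hD, h2⟩ := hf.growth
    refine ⟨C + D, by positivity, fun x => abs_le.2 ⟨?_, ?_⟩⟩
    · have := h1 x
      rw [Real.norm_of_nonneg (inv_nonneg.2 (h0 x).le), ← Real.log_le_iff_le_exp
        (inv_pos.2 (h0 x)), Real.log_inv] at this
      nlinarith [norm_nonneg x]
    · have := h2 x
      rw [Real.norm_of_nonneg (h0 x).le, ← Real.log_le_iff_le_exp (h0 x)] at this
      nlinarith [norm_nonneg x]
  refine ⟨.of_fderiv (fun x => (hf.differentiable x).log (h0 x).ne') hl.expGrowth ?_, hl⟩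
  have : _root_.fderiv ℝ (fun x => Real.log (f x))
        = fun x => (ContinuousLinearMap.lsmul ℝ ℝ) ((f x)⁻¹) (_root_.fderiv ℝ f x) := by
    ext1 x
    rw [((hf.differentiable x).hasFDerivAt.log (h0 x).ne').fderiv]
    rfl
  rw [this]
  exact (hf.inv hf' fun x => (h0 x).ne').bilin _ hf.fderiv

end ExpGrowth

/-! ### Gaussian averages whose amplitude depends on the point -/

section GaussAvg

variable {X F : Type} [NormedAddCommGroup X] [NormedSpace ℝ X]
  [NormedAddCommGroup F] [NormedSpace ℝ F]

lemma integrable_exp_mul_abs_gaussian (C : ℝ) :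
    Integrable (fun ξ : ℝ => Real.exp (C * |ξ|)) (gaussianReal 0 1) :=
  integrable_exp_mul_abs (X := id) (integrable_exp_mul_gaussianReal C)
    (integrable_exp_mul_gaussianReal (-C))

lemma ExpGrowth.integrable_gaussian {f : ℝ → F} (hf : Continuous f) (h : ExpGrowth f) :
    Integrable f (gaussianReal 0 1) := by
  obtain ⟨C, hC, h⟩ := h
  refine ((integrable_exp_mul_abs_gaussian C).const_mul (Real.exp C)).mono'
    hf.aestronglyMeasurable (ae_of_all _ fun ξ => (h ξ).trans (le_of_eq ?_))
  rw [← Real.exp_add, Real.norm_eq_abs]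
  ring_nf

lemma linGrowth_prodMk (x : X) : LinGrowth (fun ξ : ℝ => (x, ξ)) := by
  refine ⟨1 + ‖x‖, by positivity, fun ξ => ?_⟩
  rw [Prod.norm_def]
  refine max_le ?_ ?_ <;> nlinarith [norm_nonneg x, norm_nonneg ξ]

lemma exp_prod_le {C : ℝ} (hC : 0 ≤ C) (x : X) (ξ : ℝ) :
    Real.exp (C * (1 + ‖(x, ξ)‖)) ≤ Real.exp (C * (1 + ‖x‖)) * Real.exp (C * |ξ|) := by
  rw [← Real.exp_add, ← mul_add]
  refine Real.exp_le_exp.2 (mul_le_mul_of_nonneg_left ?_ hC)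
  rw [Prod.norm_def, add_assoc]
  refine add_le_add_right (max_le ?_ ?_) 1
  · exact le_add_of_nonneg_right (abs_nonneg _)
  · exact le_add_of_nonneg_left (norm_nonneg _)

lemma ExpGrowth.gaussIntegral {Φ : X × ℝ → F} (h : ExpGrowth Φ) :
    ExpGrowth (fun x => ∫ ξ, Φ (x, ξ) ∂gaussianReal 0 1) := by
  obtain ⟨C, hC, h⟩ := h
  have h1 : ExpGrowth (fun x : X => Real.exp (C * (1 + ‖x‖)) *
      ∫ ξ, Real.exp (C * |ξ|) ∂gaussianReal 0 1) :=
    ExpGrowth.mul ⟨C, hC, fun x => by simp⟩ (expGrowth_of_bounded _ fun x : X => le_rfl)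
  refine h1.of_le fun x => le_trans ?_ (le_abs_self _)
  rw [← integral_const_mul]
  exact norm_integral_le_of_norm_le ((integrable_exp_mul_abs_gaussian C).const_mul _)
    (ae_of_all _ fun ξ => (h _).trans (exp_prod_le hC x ξ))

lemma ExpSmooth.hasFDerivAt_gaussIntegral {Φ : X × ℝ → F} (h : ExpSmooth Φ) (x : X) :
    HasFDerivAt (fun x => ∫ ξ, Φ (x, ξ) ∂gaussianReal 0 1)
      (∫ ξ, (_root_.fderiv ℝ Φ (x, ξ)).comp (ContinuousLinearMap.inl ℝ X ℝ) ∂gaussianReal 0 1)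
      x := by
  obtain ⟨C, hC, h1⟩ := h.fderiv.growth
  refine hasFDerivAt_integral_of_dominated_of_fderiv_le
    (F' := fun x ξ => (_root_.fderiv ℝ Φ (x, ξ)).comp (ContinuousLinearMap.inl ℝ X ℝ))
    (bound := fun ξ => Real.exp (C * (1 + (‖x‖ + 1))) * Real.exp (C * |ξ|))
    (Metric.ball_mem_nhds x one_pos) (Filter.Eventually.of_forall fun y =>
      (h.continuous.comp (by fun_prop)).aestronglyMeasurable)
    ((h.growth.comp (linGrowth_prodMk x)).integrable_gaussian (h.continuous.comp (by fun_prop)))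
    ?_ (ae_of_all _ fun ξ y hy => ?_) ((integrable_exp_mul_abs_gaussian C).const_mul _)
    (ae_of_all _ fun ξ y hy => ?_)
  · have := h.fderiv.continuous
    exact Continuous.aestronglyMeasurable (by fun_prop)
  · have hy' : ‖y‖ ≤ ‖x‖ + 1 := by
      have h2 : ‖y - x‖ < 1 := by rwa [Metric.mem_ball, dist_eq_norm] at hy
      have h3 := norm_add_le x (y - x)
      rw [add_sub_cancel] at h3
      linarith
    refine (ContinuousLinearMap.opNorm_comp_le _ _).trans ?_
    refine (mul_le_of_le_one_right (norm_nonneg _) (ContinuousLinearMap.norm_inl_le_one ℝ X ℝ)).trans ?_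
    refine (h1 _).trans ((exp_prod_le hC y ξ).trans ?_)
    gcongr
  · have h2 : HasFDerivAt (fun y : X => (y, ξ)) (ContinuousLinearMap.inl ℝ X ℝ) y :=
      hasFDerivAt_prodMk_left y ξ
    exact (h.differentiable (y, ξ)).hasFDerivAt.comp y h2

lemma ExpSmooth.comp_inl {Φ : X × ℝ → F} (h : ExpSmooth Φ) :
    ExpSmooth (fun p => (_root_.fderiv ℝ Φ p).comp (ContinuousLinearMap.inl ℝ X ℝ)) :=
  h.fderiv.clm ((ContinuousLinearMap.compL ℝ X (X × ℝ) F).flip (ContinuousLinearMap.inl ℝ X ℝ))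

/-- The target space is quantified inside the induction, because differentiation under the integral
replaces F by a space of linear maps into F. -/
lemma expDiff_gaussIntegral (n : ℕ) : ∀ {F : Type} [NormedAddCommGroup F] [NormedSpace ℝ F]
    {Φ : X × ℝ → F}, ExpSmooth Φ → ExpDiff n (fun x => ∫ ξ, Φ (x, ξ) ∂gaussianReal 0 1) := by
  induction n with
  | zero =>
    intro F _ _ Φ h
    exact expDiff_zero.2 ⟨continuous_iff_continuousAt.2 fun x =>
      (h.hasFDerivAt_gaussIntegral x).continuousAt, h.growth.gaussIntegral⟩
  | succ n ih =>
    intro F _ _ Φ h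
    refine expDiff_succ.2 ⟨fun x => (h.hasFDerivAt_gaussIntegral x).differentiableAt,
      h.growth.gaussIntegral, ?_⟩
    have : _root_.fderiv ℝ (fun x => ∫ ξ, Φ (x, ξ) ∂gaussianReal 0 1) = fun x =>
        ∫ ξ, (_root_.fderiv ℝ Φ (x, ξ)).comp (ContinuousLinearMap.inl ℝ X ℝ) ∂gaussianReal 0 1 :=
      funext fun x => (h.hasFDerivAt_gaussIntegral x).fderiv
    rw [this]
    exact ih h.comp_inl

/-- Gaussian integration by parts. -/
lemma ExpSmooth.integral_id_mul {h : ℝ → ℝ} (hh : ExpSmooth h) :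
    ∫ ξ, ξ * h ξ ∂gaussianReal 0 1 = ∫ ξ, deriv h ξ ∂gaussianReal 0 1 := by
  have hint : ∀ {k : ℝ → ℝ}, Continuous k → ExpGrowth k →
      Integrable (fun ξ => gaussianPDFReal 0 1 ξ * k ξ) := by
    intro k hk hk'
    have h1 := hk'.integrable_gaussian hk
    rw [gaussianReal_of_var_ne_zero _ one_ne_zero, integrable_withDensity_iff_integrable_smul'
      (measurable_gaussianPDF 0 1) (ae_of_all _ fun x => gaussianPDF_lt_top)] at h1
    refine h1.congr (ae_of_all _ fun ξ => ?_)
    simp [toReal_gaussianPDF]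
  have hd : ExpSmooth (deriv h) := by
    have : deriv h = fun x => (ContinuousLinearMap.apply ℝ ℝ (1 : ℝ)) (_root_.fderiv ℝ h x) := by
      ext x; simp
    rw [this]
    exact hh.fderiv.clm _
  have hid : ExpSmooth (fun ξ : ℝ => ξ) := expSmooth_clm (ContinuousLinearMap.id ℝ ℝ)
  have hp : ∀ x, HasDerivAt (gaussianPDFReal 0 1) (-x * gaussianPDFReal 0 1 x) x := by
    intro x
    rw [gaussianPDFReal_def]
    have h1 : HasDerivAt (fun x : ℝ => -(x - 0) ^ 2 / (2 * ((1 : NNReal) : ℝ))) (-x) x := by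
      have := (((hasDerivAt_id x).sub_const 0).pow 2).neg.div_const (2 * ((1 : NNReal) : ℝ))
      refine this.congr_deriv ?_
      simp
      ring
    exact (h1.exp.const_mul _).congr_deriv (by simp; ring)
  rw [integral_gaussianReal_eq_integral_smul one_ne_zero,
    integral_gaussianReal_eq_integral_smul one_ne_zero]
  have := integral_mul_deriv_eq_deriv_mul_of_integrable (u := gaussianPDFReal 0 1) (v := h)
    (u' := fun x => -x * gaussianPDFReal 0 1 x) (v' := deriv h)
    (fun x _ => hp x) (fun x _ => (hh.differentiable x).hasDerivAt)
    (hint hd.continuous hd.growth) ?_ (hint hh.continuous hh.growth)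
  · simp only [smul_eq_mul]
    rw [this, ← integral_neg]
    congr 1
    ext ξ
    ring
  · have h2 := (hint (hid.mul hh).continuous (hid.mul hh).growth).neg
    refine h2.congr (ae_of_all _ fun ξ => ?_)
    simp
    ring

/-- The average of `g` over a centred Gaussian displacement of standard deviation `s x` along `v`. -/
def gaussAvg (s : X → ℝ) (v : X) (g : X → ℝ) (x : X) : ℝ :=
  ∫ ξ, g (x + (ξ * s x) • v) ∂gaussianReal 0 1

/-- Admissible standard deviations. -/
structure Amplitude (s : X → ℝ) : Prop where
  smooth : ExpSmooth s
  bounded : ∃ C, ∀ x, |s x| ≤ C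

lemma amplitude_const (c : ℝ) : Amplitude (fun _ : X => c) :=
  ⟨expSmooth_const c, |c|, fun _ => le_rfl⟩

/-- The derivative of `g` in the direction `v`. -/
def dirDeriv (v : X) (g : X → ℝ) (x : X) : ℝ := fderiv ℝ g x v

lemma ExpSmooth.dirDeriv {g : X → ℝ} (hg : ExpSmooth g) (v : X) : ExpSmooth (dirDeriv v g) :=
  hg.fderiv.clm (ContinuousLinearMap.apply ℝ ℝ v)

variable {s : X → ℝ}

lemma Amplitude.displacement (hs : Amplitude s) (v : X) :
    ExpSmooth (fun p : X × ℝ => p.1 + (p.2 * s p.1) • v) ∧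
      LinGrowth (fun p : X × ℝ => p.1 + (p.2 * s p.1) • v) := by
  have h1 : LinGrowth (fun p : X × ℝ => p.1) := linGrowth_clm (ContinuousLinearMap.fst ℝ X ℝ)
  have h2 : ExpSmooth (fun p : X × ℝ => p.1) := expSmooth_clm (ContinuousLinearMap.fst ℝ X ℝ)
  have h3 : ExpSmooth (fun p : X × ℝ => p.2) := expSmooth_clm (ContinuousLinearMap.snd ℝ X ℝ)
  refine ⟨h2.add (((h3.mul (hs.smooth.comp h2 h1)).clm
    (ContinuousLinearMap.toSpanSingleton ℝ v))), h1.add ?_⟩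
  obtain ⟨C, hC⟩ := hs.bounded
  have hC0 : 0 ≤ C := (abs_nonneg _).trans (hC 0)
  refine ⟨C * ‖v‖, by positivity, fun p => ?_⟩
  have h4 : ‖p.2‖ ≤ ‖p‖ := norm_snd_le p
  rw [norm_smul, norm_mul]
  have h5 : ‖p.2‖ * ‖s p.1‖ ≤ (1 + ‖p‖) * C :=
    mul_le_mul (by linarith) (hC _) (norm_nonneg _) (by positivity)
  calc _ ≤ (1 + ‖p‖) * C * ‖v‖ := mul_le_mul_of_nonneg_right h5 (norm_nonneg _)
    _ = _ := by ring

lemma ExpSmooth.displaced {g : X → ℝ} (hg : ExpSmooth g) (hs : Amplitude s) (v : X) :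
    ExpSmooth (fun p : X × ℝ => g (p.1 + (p.2 * s p.1) • v)) :=
  hg.comp (hs.displacement v).1 (hs.displacement v).2

lemma ExpSmooth.gaussAvg {g : X → ℝ} (hg : ExpSmooth g) (hs : Amplitude s) (v : X) :
    ExpSmooth (gaussAvg s v g) := fun n => expDiff_gaussIntegral n (hg.displaced hs v)

lemma displacement_line (s : X → ℝ) (v x : X) : ExpSmooth (fun ξ : ℝ => x + (ξ * s x) • v) ∧
      LinGrowth (fun ξ : ℝ => x + (ξ * s x) • v) := by
  have e : (fun ξ : ℝ => x + (ξ * s x) • v)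
      = fun ξ => x + (ContinuousLinearMap.toSpanSingleton ℝ (s x • v)) ξ := by
    ext1 ξ; simp [mul_smul]
  rw [e]
  refine ⟨(expSmooth_const x).add (expSmooth_clm _), LinGrowth.add ⟨‖x‖, norm_nonneg _, fun ξ => ?_⟩
    (linGrowth_clm _)⟩
  exact le_mul_of_one_le_right (norm_nonneg _) (by linarith [norm_nonneg ξ])

lemma ExpSmooth.displaced_line {g : X → ℝ} (hg : ExpSmooth g) (s : X → ℝ) (v x : X) :
    ExpSmooth (fun ξ : ℝ => g (x + (ξ * s x) • v)) :=
  hg.comp (displacement_line s v x).1 (displacement_line s v x).2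

lemma ExpSmooth.integrable {f : ℝ → F} (h : ExpSmooth f) : Integrable f (gaussianReal 0 1) :=
  h.growth.integrable_gaussian h.continuous

/-- Differentiating the amplitude produces ξ ∂_u s ∂_v g, and integration by parts in ξ turns the
factor ξ into s ∂_v. Thus the amplitude enters only through s ∂_u s, half the derivative of the
variance. Both the heat equation in q and the derivative of the interpolation in θ come from this
identity. -/
lemma dirDeriv_gaussAvg {g : X → ℝ} (hg : ExpSmooth g) (hs : Amplitude s) (u v x : X) :
    dirDeriv u (gaussAvg s v g) x = gaussAvg s v (dirDeriv u g) x
      + dirDeriv u s x * s x * gaussAvg s v (dirDeriv v (dirDeriv v g)) x := by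
  have h1 := (hg.displaced hs v).hasFDerivAt_gaussIntegral x
  have h2 : ∀ ξ : ℝ, ((_root_.fderiv ℝ (fun p : X × ℝ => g (p.1 + (p.2 * s p.1) • v)) (x, ξ)).comp
      (ContinuousLinearMap.inl ℝ X ℝ)) u = dirDeriv u g (x + (ξ * s x) • v)
        + dirDeriv u s x * (ξ * dirDeriv v g (x + (ξ * s x) • v)) := by
    intro ξ
    have h3 : HasFDerivAt (fun y : X => y + (ξ * s y) • v) _ x :=
      (hasFDerivAt_id x).add (((hs.smooth.differentiable x).hasFDerivAt.const_mul ξ).smul_const v)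
    have h4 := (hg.differentiable (x + (ξ * s x) • v)).hasFDerivAt.comp x h3
    have h5 := ((hg.displaced hs v).differentiable (x, ξ)).hasFDerivAt.comp x
      (hasFDerivAt_prodMk_left (𝕜 := ℝ) x ξ)
    rw [h5.unique h4]
    simp [SpinGlass.dirDeriv]
    ring
  have h6 : ∫ ξ, ξ * dirDeriv v g (x + (ξ * s x) • v) ∂gaussianReal 0 1
      = s x * gaussAvg s v (dirDeriv v (dirDeriv v g)) x := by
    rw [((hg.dirDeriv v).displaced_line s v x).integral_id_mul, SpinGlass.gaussAvg,
      ← integral_const_mul]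
    congr 1
    ext ξ
    have h3 : HasDerivAt (fun ξ : ℝ => x + (ξ * s x) • v) ((1 * s x) • v) ξ :=
      (((hasDerivAt_id ξ).mul_const (s x)).smul_const v).const_add x
    have h4 := ((hg.dirDeriv v).differentiable (x + (ξ * s x) • v)).hasFDerivAt.comp_hasDerivAt ξ h3
    have h5 := h4.deriv
    rw [Function.comp_def] at h5
    rw [h5]
    simp [SpinGlass.dirDeriv]
  have hi : Integrable (fun ξ : ℝ => (_root_.fderiv ℝ (fun p : X × ℝ =>
      g (p.1 + (p.2 * s p.1) • v)) (x, ξ)).comp (ContinuousLinearMap.inl ℝ X ℝ))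
      (gaussianReal 0 1) :=
    ((hg.displaced hs v).comp_inl.growth.comp (linGrowth_prodMk x)).integrable_gaussian
      ((hg.displaced hs v).comp_inl.continuous.comp (by fun_prop))
  have hid : ExpSmooth (fun ξ : ℝ => ξ) := expSmooth_clm (ContinuousLinearMap.id ℝ ℝ)
  have h7 : dirDeriv u (gaussAvg s v g) x = (_root_.fderiv ℝ (gaussAvg s v g) x) u := rfl
  have h8 : _root_.fderiv ℝ (gaussAvg s v g) x = _ := h1.fderiv
  rw [h7, h8, ContinuousLinearMap.integral_apply hi]
  simp_rw [h2]
  rw [integral_add ((hg.dirDeriv u).displaced_line s v x).integrable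
    ((hid.mul ((hg.dirDeriv v).displaced_line s v x)).const_mul _).integrable,
    integral_const_mul, h6, mul_assoc]
  rfl

end GaussAvg

/-! ### The Cole-Hopf transformation -/

section ColeHopf

variable {X : Type} [NormedAddCommGroup X] [NormedSpace ℝ X] {s : X → ℝ} {v : X}

lemma gaussAvg_mono {f g : X → ℝ} (hf : ExpSmooth f) (hg : ExpSmooth g) (s : X → ℝ) (v : X)
    (h : ∀ x, f x ≤ g x) (x : X) : gaussAvg s v f x ≤ gaussAvg s v g x :=
  integral_mono (hf.displaced_line s v x).integrable (hg.displaced_line s v x).integrable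
    fun _ => h _

lemma gaussAvg_mono_line {f g : X → ℝ} (hf : ExpSmooth f) (hg : ExpSmooth g) (s : X → ℝ) (v x : X)
    (h : ∀ r : ℝ, f (x + r • v) ≤ g (x + r • v)) : gaussAvg s v f x ≤ gaussAvg s v g x :=
  integral_mono (hf.displaced_line s v x).integrable (hg.displaced_line s v x).integrable
    fun _ => h _

lemma gaussAvg_add {f g : X → ℝ} (hf : ExpSmooth f) (hg : ExpSmooth g) (s : X → ℝ) (v x : X) :
    gaussAvg s v (fun y => f y + g y) x = gaussAvg s v f x + gaussAvg s v g x :=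
  integral_add (hf.displaced_line s v x).integrable (hg.displaced_line s v x).integrable

lemma gaussAvg_const_mul (c : ℝ) (f : X → ℝ) (s : X → ℝ) (v x : X) :
    gaussAvg s v (fun y => c * f y) x = c * gaussAvg s v f x := integral_const_mul _ _

lemma gaussAvg_const (c : ℝ) (s : X → ℝ) (v x : X) : gaussAvg s v (fun _ => c) x = c := by
  simp [gaussAvg]

lemma gaussAvg_sum {ι : Type*} (t : Finset ι) {f : ι → X → ℝ} (hf : ∀ i ∈ t, ExpSmooth (f i))
    (s : X → ℝ) (v x : X) :
    gaussAvg s v (fun y => ∑ i ∈ t, f i y) x = ∑ i ∈ t, gaussAvg s v (f i) x :=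
  integral_finsetSum _ fun i hi => ((hf i hi).displaced_line s v x).integrable

/-- Smooth functions of linear growth whose derivatives have at most exponential growth. -/
structure Potential (G : X → ℝ) : Prop where
  smooth : ExpSmooth G
  growth : LinGrowth G

lemma Potential.const_mul {G : X → ℝ} (hG : Potential G) (m : ℝ) :
    Potential (fun x => m * G x) := by
  refine ⟨hG.smooth.const_mul m, ?_⟩
  obtain ⟨C, hC, h⟩ := hG.growth
  refine ⟨|m| * C, by positivity, fun x => ?_⟩
  rw [norm_mul, mul_assoc, Real.norm_eq_abs]
  exact mul_le_mul_of_nonneg_left (h x) (abs_nonneg m)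

lemma Potential.exp {G : X → ℝ} (hG : Potential G) (m : ℝ) :
    ExpSmooth (fun x => Real.exp (m * G x)) :=
  (hG.const_mul m).smooth.exp (hG.const_mul m).growth

lemma LinGrowth.gaussAvg {f : X → ℝ} (hf : LinGrowth f) (hs : Amplitude s) (v : X) :
    LinGrowth (gaussAvg s v f) := by
  obtain ⟨C, hC, h⟩ := hf
  obtain ⟨S, hS⟩ := hs.bounded
  have hS0 : 0 ≤ S := (abs_nonneg _).trans (hS 0)
  set M : ℝ := ∫ ξ, Real.exp (1 * |ξ|) ∂gaussianReal 0 1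
  have hM : 0 ≤ M := integral_nonneg fun ξ => Real.exp_nonneg _
  refine ⟨C + C * S * ‖v‖ * M, by positivity, fun x => ?_⟩
  have hint : Integrable (fun ξ : ℝ => C * (1 + ‖x‖) + C * S * ‖v‖ * Real.exp (1 * |ξ|))
      (gaussianReal 0 1) :=
    (integrable_const _).add ((integrable_exp_mul_abs_gaussian 1).const_mul _)
  refine (norm_integral_le_of_norm_le hint (ae_of_all _ fun ξ => (h _).trans ?_)).trans ?_
  · have h1 : ‖x + (ξ * s x) • v‖ ≤ ‖x‖ + |ξ| * S * ‖v‖ := by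
      refine (norm_add_le _ _).trans ?_
      rw [norm_smul, norm_mul, Real.norm_eq_abs, Real.norm_eq_abs]
      gcongr
      exact hS x
    have h2 : |ξ| ≤ Real.exp (1 * |ξ|) := by linarith [Real.add_one_le_exp (1 * |ξ|)]
    calc C * (1 + ‖x + (ξ * s x) • v‖) ≤ C * (1 + (‖x‖ + Real.exp (1 * |ξ|) * S * ‖v‖)) := by
          gcongr
          exact h1.trans (by gcongr)
      _ = _ := by ring
  · have h4 : ∫ ξ : ℝ, C * S * ‖v‖ * Real.exp (1 * |ξ|) ∂gaussianReal 0 1 = C * S * ‖v‖ * M :=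
      integral_const_mul _ _
    rw [integral_add (integrable_const _) ((integrable_exp_mul_abs_gaussian 1).const_mul _), h4]
    simp only [integral_const, probReal_univ, one_smul]
    have h3 : 0 ≤ C * S * ‖v‖ * M := by positivity
    nlinarith [norm_nonneg x]

/-- The Cole-Hopf transformation of a Gaussian average. -/
def coleHopf (m : ℝ) (s : X → ℝ) (v : X) (G : X → ℝ) (x : X) : ℝ :=
  m⁻¹ * Real.log (gaussAvg s v (fun y => Real.exp (m * G y)) x)

/-- Jensen's inequality, by averaging the tangent line of the exponential at the mean a of m G. -/
lemma Potential.exp_gaussAvg_le {G : X → ℝ} (hG : Potential G) (m : ℝ) (s : X → ℝ) (v x : X) :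
    Real.exp (m * gaussAvg s v G x) ≤ gaussAvg s v (fun y => Real.exp (m * G y)) x := by
  set a := m * gaussAvg s v G x with ha
  have h1 : gaussAvg s v (fun y => Real.exp a * (1 - a) + Real.exp a * m * G y) x = Real.exp a := by
    rw [gaussAvg_add (expSmooth_const _) (hG.smooth.const_mul _), gaussAvg_const,
      gaussAvg_const_mul, mul_assoc, ← ha]
    ring
  rw [← h1]
  refine gaussAvg_mono ((expSmooth_const _).add (hG.smooth.const_mul _)) (hG.exp m) s v
    (fun y => ?_) x
  have h2 := Real.add_one_le_exp (m * G y - a)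
  have h3 : Real.exp (m * G y) = Real.exp a * Real.exp (m * G y - a) := by
    rw [← Real.exp_add]; ring_nf
  rw [h3]
  nlinarith [Real.exp_pos a]

lemma Potential.gaussAvg_exp_pos {G : X → ℝ} (hG : Potential G) (m : ℝ) (s : X → ℝ) (v x : X) :
    0 < gaussAvg s v (fun y => Real.exp (m * G y)) x :=
  (Real.exp_pos _).trans_le (hG.exp_gaussAvg_le m s v x)

lemma Potential.exp_coleHopf {G : X → ℝ} (hG : Potential G) {m : ℝ} (hm : 0 < m) (s : X → ℝ)
    (v x : X) : Real.exp (m * coleHopf m s v G x)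
      = gaussAvg s v (fun y => Real.exp (m * G y)) x := by
  rw [coleHopf, mul_inv_cancel_left₀ hm.ne', Real.exp_log (hG.gaussAvg_exp_pos m s v x)]

lemma Potential.gaussAvg_le_coleHopf {G : X → ℝ} (hG : Potential G) {m : ℝ} (hm : 0 < m)
    (s : X → ℝ) (v x : X) : gaussAvg s v G x ≤ coleHopf m s v G x := by
  have h := hG.exp_gaussAvg_le m s v x
  rw [← hG.exp_coleHopf hm, Real.exp_le_exp] at h
  exact le_of_mul_le_mul_left h hm

/-- By Jensen the average of exp(m G) is at least the exponential of a function of linear growth, so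
its inverse grows at most exponentially and its logarithm is admissible. The transformation can
therefore be iterated. -/
lemma Potential.coleHopf {G : X → ℝ} (hG : Potential G) (hs : Amplitude s) (m : ℝ) (v : X) :
    Potential (coleHopf m s v G) := by
  have h1 : ExpGrowth (fun x => (SpinGlass.gaussAvg s v (fun y => Real.exp (m * G y)) x)⁻¹) := by
    obtain ⟨C, hC, h⟩ := ((hG.const_mul m).growth.gaussAvg hs v)
    refine ⟨C, hC, fun x => ?_⟩
    rw [norm_inv, Real.norm_of_nonneg (hG.gaussAvg_exp_pos m s v x).le]
    refine (inv_anti₀ (Real.exp_pos _) (hG.exp_gaussAvg_le m s v x)).trans ?_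
    rw [← Real.exp_neg, ← gaussAvg_const_mul]
    exact Real.exp_le_exp.2 ((neg_le_abs _).trans (h x))
  have h2 := ((hG.exp m).gaussAvg hs v).log h1 fun x => hG.gaussAvg_exp_pos m s v x
  exact Potential.const_mul ⟨h2.1, h2.2⟩ m⁻¹

lemma coleHopf_mono {G H : X → ℝ} (hG : Potential G) (hH : Potential H) {m : ℝ} (hm : 0 < m)
    {s : X → ℝ} {v x y : X} (h : ∀ r : ℝ, G (x + (r * s x) • v) ≤ H (y + (r * s y) • v)) :
    coleHopf m s v G x ≤ coleHopf m s v H y := by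
  refine mul_le_mul_of_nonneg_left (Real.log_le_log (hG.gaussAvg_exp_pos m s v x) ?_)
    (inv_nonneg.2 hm.le)
  refine integral_mono ((hG.exp m).displaced_line s v x).integrable
    ((hH.exp m).displaced_line s v y).integrable fun ξ => Real.exp_le_exp.2 ?_
  exact mul_le_mul_of_nonneg_left (h ξ) hm.le

lemma coleHopf_add_const {G : X → ℝ} (hG : Potential G) {m : ℝ} (hm : 0 < m) (s : X → ℝ)
    (v x : X) (c : ℝ) :
    coleHopf m s v (fun y => G y + c) x = coleHopf m s v G x + c := by
  have : (fun y => Real.exp (m * (G y + c))) = fun y => Real.exp (m * c) * Real.exp (m * G y) := by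
    ext y; rw [← Real.exp_add]; ring_nf
  rw [coleHopf, this, gaussAvg_const_mul, Real.log_mul (Real.exp_pos _).ne'
    (hG.gaussAvg_exp_pos m s v x).ne', Real.log_exp, coleHopf]
  field_simp
  ring

lemma coleHopf_of_zero {m : ℝ} (hm : 0 < m) {x : X} (h : s x = 0) (G : X → ℝ) :
    coleHopf m s v G x = G x := by
  simp [coleHopf, gaussAvg, h, hm.ne']

lemma Potential.dirDeriv_exp {G : X → ℝ} (hG : Potential G) (m : ℝ) (u : X) :
    dirDeriv u (fun x => Real.exp (m * G x))
      = fun x => m * dirDeriv u G x * Real.exp (m * G x) := by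
  ext x
  have h := (((hG.smooth.differentiable x).hasFDerivAt.const_mul m).exp).fderiv
  simp only [dirDeriv]
  rw [h]
  simp
  ring

lemma Potential.dirDeriv_dirDeriv_exp {G : X → ℝ} (hG : Potential G) (m : ℝ) (u : X) :
    dirDeriv u (dirDeriv u (fun x => Real.exp (m * G x)))
      = fun x => m * (dirDeriv u (dirDeriv u G) x + m * dirDeriv u G x ^ 2)
        * Real.exp (m * G x) := by
  rw [hG.dirDeriv_exp]
  ext x
  have h1 := ((hG.smooth.dirDeriv u).differentiable x).hasFDerivAt.const_mul m
  have h2 := (((hG.smooth.differentiable x).hasFDerivAt.const_mul m).exp)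
  have h : HasFDerivAt (fun x => m * dirDeriv u G x * Real.exp (m * G x)) _ x := h1.mul h2
  rw [dirDeriv, h.fderiv]
  simp only [dirDeriv]
  simp
  ring

end ColeHopf

/-! ### A priori bounds in y, independent of the number of steps -/

section Slices

lemma ExpSmooth.deriv {f : ℝ → ℝ} (hf : ExpSmooth f) : ExpSmooth (deriv f) := hf.dirDeriv 1

lemma deriv_gaussAvg {g : ℝ → ℝ} (hg : ExpSmooth g) (σ : ℝ) :
    deriv (gaussAvg (fun _ : ℝ => σ) 1 g) = gaussAvg (fun _ : ℝ => σ) 1 (deriv g) := by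
  ext y
  have h := dirDeriv_gaussAvg hg (amplitude_const σ) 1 1 y
  have h0 : dirDeriv (1 : ℝ) (fun _ : ℝ => σ) y = 0 := by simp [dirDeriv]
  rw [h0, zero_mul, zero_mul, add_zero] at h
  exact h

lemma Potential.deriv_exp {G : ℝ → ℝ} (hG : Potential G) (m : ℝ) :
    deriv (fun y => Real.exp (m * G y)) = fun y => m * deriv G y * Real.exp (m * G y) :=
  hG.dirDeriv_exp m 1

lemma Potential.deriv_deriv_exp {G : ℝ → ℝ} (hG : Potential G) (m : ℝ) :
    deriv (deriv (fun y => Real.exp (m * G y)))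
      = fun y => m * (deriv (deriv G) y + m * deriv G y ^ 2) * Real.exp (m * G y) :=
  hG.dirDeriv_dirDeriv_exp m 1

lemma Potential.deriv_deriv_deriv_exp {G : ℝ → ℝ} (hG : Potential G) (m : ℝ) :
    deriv (deriv (deriv (fun y => Real.exp (m * G y))))
      = fun y => m * (deriv (deriv (deriv G)) y + 3 * m * (deriv G y * deriv (deriv G) y)
        + m ^ 2 * deriv G y ^ 3) * Real.exp (m * G y) := by
  rw [hG.deriv_deriv_exp]
  ext y
  have h1 := (hG.smooth.differentiable y).hasDerivAt
  have h2 := (hG.smooth.deriv.differentiable y).hasDerivAt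
  have h3 := (hG.smooth.deriv.deriv.differentiable y).hasDerivAt
  have h : HasDerivAt (fun y => m * (deriv (deriv G) y + m * deriv G y ^ 2) * Real.exp (m * G y))
      _ y := ((h3.add ((h2.pow 2).const_mul m)).const_mul m).mul ((h1.const_mul m).exp)
  rw [h.deriv]
  simp
  ring

/-- The function, with the a priori bounds on its derivatives, carried along the Parisi equation:
`b` bounds the first derivative, and `m` is the current value of the order parameter. -/
structure SliceBound (b m : ℝ) (φ : ℝ → ℝ) : Prop where
  potential : Potential φ
  deriv_le : ∀ y, |deriv φ y| ≤ b
  deriv2_nonneg : ∀ y, 0 ≤ deriv (deriv φ) y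
  deriv2_le : ∀ y, deriv (deriv φ) y + deriv φ y ^ 2 ≤ b ^ 2
  deriv3_le : ∀ ε : ℝ, |ε| = 1 → ∀ y, ε * (deriv (deriv (deriv φ)) y
    + 3 * m * (deriv φ y * deriv (deriv φ) y)) + 3 * b * deriv φ y ^ 2 ≤ 4 * b ^ 3 + 3 * (1 - m) * b ^ 3

lemma SliceBound.nonneg {b m : ℝ} {φ : ℝ → ℝ} (h : SliceBound b m φ) : 0 ≤ b :=
  (abs_nonneg _).trans (h.deriv_le 0)

/-- Only the bound of third order involves m. Lowering m to m' costs at most 3 (m - m') |φ' φ''| ≤ 3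
(m - m') b³, exactly what the term 3 (1 - m) b³ gains. -/
lemma SliceBound.drop {b m m' : ℝ} {φ : ℝ → ℝ} (h : SliceBound b m φ) (hm : m' ≤ m) :
    SliceBound b m' φ := by
  refine ⟨h.potential, h.deriv_le, h.deriv2_nonneg, h.deriv2_le, fun ε hε y => ?_⟩
  have h1 := h.deriv3_le ε hε y
  have h2 := h.deriv_le y
  have h3 := h.deriv2_nonneg y
  have h4 := h.deriv2_le y
  have h5 : -(ε * (deriv φ y * deriv (deriv φ) y)) ≤ b * b ^ 2 := by
    refine (neg_le_abs _).trans ?_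
    rw [abs_mul, hε, one_mul, abs_mul, abs_of_nonneg h3]
    exact mul_le_mul h2 (by nlinarith) h3 h.nonneg
  nlinarith

lemma SliceBound.abs_deriv3_le {b m : ℝ} {φ : ℝ → ℝ} (h : SliceBound b m φ) (hm : 0 ≤ m)
    (_ : m ≤ 1) (y : ℝ) : |deriv (deriv (deriv φ)) y| ≤ 10 * b ^ 3 := by
  have hb := h.nonneg
  have h5 : |3 * m * (deriv φ y * deriv (deriv φ) y)| ≤ 3 * m * b ^ 3 := by
    rw [abs_mul, abs_of_nonneg (by positivity : 0 ≤ 3 * m), abs_mul,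
      abs_of_nonneg (h.deriv2_nonneg y)]
    refine mul_le_mul_of_nonneg_left ?_ (by positivity)
    calc |deriv φ y| * deriv (deriv φ) y ≤ b * b ^ 2 :=
          mul_le_mul (h.deriv_le y) (by nlinarith [h.deriv2_le y]) (h.deriv2_nonneg y) hb
      _ = b ^ 3 := by ring
  have h1 := h.deriv3_le 1 (by simp) y
  have h2 := h.deriv3_le (-1) (by simp) y
  have h6 : 0 ≤ 3 * b * deriv φ y ^ 2 := by positivity
  have h7 : 0 ≤ b ^ 3 := by positivity
  rw [abs_le] at h5 ⊢
  constructor <;> nlinarith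

lemma SliceBound.abs_deriv2_le {b m : ℝ} {φ : ℝ → ℝ} (h : SliceBound b m φ) (y : ℝ) :
    |deriv (deriv φ) y| ≤ b ^ 2 := by
  rw [abs_of_nonneg (h.deriv2_nonneg y)]
  nlinarith [h.deriv2_le y]

/-- Derivatives of exp(m F) are averages of derivatives of exp(m G). Under the average tilted by
exp(m G), F' is the mean of G', and the higher derivatives of F are means of those of G up to m
times a variance or m² times the third-order excess ⟨G'³⟩ - ⟨G'⟩³. The variance has the right sign
in the bounds of second order because 0 < m ≤ 1. On |s| ≤ b the function 3 b s² - ε s³ is convex, so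
the third-order excess is at most 3b times the variance; the summand 3 b φ'² in the bound pays for
it. -/
lemma SliceBound.coleHopf {b m : ℝ} {G : ℝ → ℝ} (h : SliceBound b m G) (hm : 0 < m)
    (hm' : m ≤ 1) (σ : ℝ) : SliceBound b m (coleHopf m (fun _ => σ) 1 G) := by
  set F := SpinGlass.coleHopf m (fun _ => σ) 1 G with hF
  have hb := h.nonneg
  have hG := h.potential
  have hFp : Potential F := hG.coleHopf (amplitude_const σ) m 1
  -- Divided by exp(m F y), `A f y` is the tilted mean of f.
  set A := fun f : ℝ → ℝ => gaussAvg (fun _ : ℝ => σ) 1 (fun y => f y * Real.exp (m * G y)) with hA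
  have e0 : (fun y => Real.exp (m * F y)) = gaussAvg (fun _ : ℝ => σ) 1
      (fun y => Real.exp (m * G y)) := funext fun y => hG.exp_coleHopf hm _ _ y
  have pull : ∀ f : ℝ → ℝ, gaussAvg (fun _ : ℝ => σ) 1 (fun y => m * f y * Real.exp (m * G y))
      = fun y => m * A f y := by
    intro f
    ext y
    rw [← gaussAvg_const_mul]
    refine congrArg (fun f => gaussAvg (fun _ : ℝ => σ) 1 f y) (funext fun y => ?_)
    ring
  have e1 : ∀ y, deriv F y * Real.exp (m * F y) = A (deriv G) y := by
    intro y
    have h1 := congrArg deriv e0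
    rw [hFp.deriv_exp, deriv_gaussAvg (hG.exp m), hG.deriv_exp, pull] at h1
    have := congrFun h1 y
    rw [mul_assoc m] at this
    exact mul_left_cancel₀ hm.ne' this
  have e2 : ∀ y, (deriv (deriv F) y + m * deriv F y ^ 2) * Real.exp (m * F y)
      = A (fun y => deriv (deriv G) y + m * deriv G y ^ 2) y := by
    intro y
    have h1 := congrArg (fun f => deriv (deriv f)) e0
    rw [hFp.deriv_deriv_exp, deriv_gaussAvg (hG.exp m), deriv_gaussAvg (hG.exp m).deriv,
      hG.deriv_deriv_exp, pull] at h1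
    have := congrFun h1 y
    rw [mul_assoc m] at this
    exact mul_left_cancel₀ hm.ne' this
  have e3 : ∀ y, (deriv (deriv (deriv F)) y + 3 * m * (deriv F y * deriv (deriv F) y)
        + m ^ 2 * deriv F y ^ 3) * Real.exp (m * F y)
      = A (fun y => deriv (deriv (deriv G)) y + 3 * m * (deriv G y * deriv (deriv G) y)
        + m ^ 2 * deriv G y ^ 3) y := by
    intro y
    have h1 := congrArg (fun f => deriv (deriv (deriv f))) e0
    rw [hFp.deriv_deriv_deriv_exp, deriv_gaussAvg (hG.exp m), deriv_gaussAvg (hG.exp m).deriv,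
      deriv_gaussAvg (hG.exp m).deriv.deriv, hG.deriv_deriv_deriv_exp, pull] at h1
    have := congrFun h1 y
    rw [mul_assoc m] at this
    exact mul_left_cancel₀ hm.ne' this
  have d1 := hG.smooth.deriv
  have d2 := d1.deriv
  have d3 := d2.deriv
  have d1s : ExpSmooth (fun y => deriv G y ^ 2) := by simpa only [pow_two] using d1.mul d1
  have Amono : ∀ {f g : ℝ → ℝ}, ExpSmooth f → ExpSmooth g → (∀ y, f y ≤ g y) → ∀ y,
      A f y ≤ A g y := fun hf hg hfg y => gaussAvg_mono (hf.mul (hG.exp m)) (hg.mul (hG.exp m)) _ _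
        (fun y => mul_le_mul_of_nonneg_right (hfg y) (Real.exp_nonneg _)) y
  have Aadd : ∀ {f g : ℝ → ℝ}, ExpSmooth f → ExpSmooth g → ∀ y,
      A (fun y => f y + g y) y = A f y + A g y := by
    intro f g hf hg y
    simp only [hA, add_mul]
    exact gaussAvg_add (hf.mul (hG.exp m)) (hg.mul (hG.exp m)) _ _ y
  have Amul : ∀ (c : ℝ) (f : ℝ → ℝ) y, A (fun y => c * f y) y = c * A f y := by
    intro c f y
    simp only [hA, mul_assoc]
    exact gaussAvg_const_mul _ _ _ _ _
  have Aconst : ∀ (c : ℝ) y, A (fun _ => c) y = c * Real.exp (m * F y) := by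
    intro c y
    rw [congrFun e0 y]
    exact gaussAvg_const_mul _ _ _ _ _
  have b1 : ∀ y, |deriv F y| ≤ b := by
    intro y
    have hp := Real.exp_pos (m * F y)
    have h1 := Amono (expSmooth_const (-b)) d1 (fun y => (abs_le.1 (h.deriv_le y)).1) y
    have h2 := Amono d1 (expSmooth_const b) (fun y => (abs_le.1 (h.deriv_le y)).2) y
    rw [Aconst, ← e1] at h1 h2
    exact abs_le.2 ⟨le_of_mul_le_mul_right h1 hp, le_of_mul_le_mul_right h2 hp⟩
  have jensen : ∀ y, deriv F y ^ 2 * Real.exp (m * F y) ≤ A (fun y => deriv G y ^ 2) y := by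
    intro y
    have h1 := Amono ((d1.const_mul (2 * deriv F y)).add (expSmooth_const (-(deriv F y ^ 2)))) d1s
      (fun z => by nlinarith [sq_nonneg (deriv G z - deriv F y)]) y
    rw [Aadd (d1.const_mul _) (expSmooth_const _), Amul, Aconst, ← e1] at h1
    linarith
  refine ⟨hFp, b1, fun y => ?_, fun y => ?_, fun ε hε y => ?_⟩
  · have hp := Real.exp_pos (m * F y)
    have h1 := e2 y
    rw [Aadd d2 (d1s.const_mul m), Amul] at h1
    have h2 := Amono (expSmooth_const 0) d2 h.deriv2_nonneg y
    rw [Aconst, zero_mul] at h2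
    have h3 := mul_le_mul_of_nonneg_left (jensen y) hm.le
    refine nonneg_of_mul_nonneg_left (b := Real.exp (m * F y)) ?_ hp
    nlinarith
  · have hp := Real.exp_pos (m * F y)
    have h1 := e2 y
    rw [Aadd d2 (d1s.const_mul m), Amul] at h1
    have h2 := Amono (d2.add d1s) (expSmooth_const (b ^ 2)) h.deriv2_le y
    rw [Aadd d2 d1s, Aconst] at h2
    have h3 := mul_le_mul_of_nonneg_left (jensen y) (sub_nonneg.2 hm')
    refine le_of_mul_le_mul_right (a := Real.exp (m * F y)) ?_ hp
    nlinarith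
  · have hp := Real.exp_pos (m * F y)
    have d12 : ExpSmooth (fun y => 3 * m * (deriv G y * deriv (deriv G) y)) := (d1.mul d2).const_mul _
    have dc : ExpSmooth (fun y => deriv G y ^ 3) := by
      have : (fun y => deriv G y ^ 3) = fun y => deriv G y * deriv G y ^ 2 := by ext; ring
      rw [this]
      exact d1.mul d1s
    have h1 := e3 y
    rw [Aadd (d3.add d12) (dc.const_mul _), Amul] at h1
    have h2 := Amono (((d3.add d12).const_mul ε).add (d1s.const_mul (3 * b)))
      (expSmooth_const _) (h.deriv3_le ε hε) y
    rw [Aadd ((d3.add d12).const_mul ε) (d1s.const_mul _), Amul, Amul, Aconst] at h2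
    set t := deriv F y with ht
    have hε2 : ε ^ 2 = 1 := by rw [← sq_abs, hε, one_pow]
    have hε1 : |ε * t| ≤ b := by rw [abs_mul, hε, one_mul]; exact b1 y
    -- The left side is the tangent at t of the convex function s ↦ 3 b s² - ε s³; this is Jensen's
    -- inequality for the third-order excess.
    have h4 := Amono ((d1.const_mul (6 * b * t - 3 * ε * t ^ 2)).add
        (expSmooth_const (2 * ε * t ^ 3 - 3 * b * t ^ 2)))
      ((d1s.const_mul (3 * b)).add (dc.const_mul (-ε))) (fun z => ?_) y
    · rw [Aadd (d1.const_mul _) (expSmooth_const _), Amul, Aconst, ← e1, ← ht,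
        Aadd (d1s.const_mul _) (dc.const_mul _), Amul, Amul] at h4
      have hj := jensen y
      rw [← ht] at hj
      have hm2 : m ^ 2 ≤ 1 := by nlinarith
      set S2 := A (fun y => deriv G y ^ 2) y
      set S3 := A (fun y => deriv G y ^ 3) y
      set E := Real.exp (m * F y)
      set T3 := A (fun y => deriv (deriv (deriv G)) y + 3 * m * (deriv G y * deriv (deriv G) y)) y
      refine le_of_mul_le_mul_right (a := E) ?_ hp
      have h5 : ε * (S3 - t ^ 3 * E) ≤ 3 * b * (S2 - t ^ 2 * E) := by nlinarith
      have h6 : m ^ 2 * (ε * (S3 - t ^ 3 * E)) ≤ 3 * b * (S2 - t ^ 2 * E) := by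
        refine (mul_le_mul_of_nonneg_left h5 (sq_nonneg m)).trans ?_
        exact mul_le_of_le_one_left (mul_nonneg (by positivity) (by linarith)) hm2
      have h7 : (deriv (deriv (deriv F)) y + 3 * m * (t * deriv (deriv F) y)) * E
          = T3 + m ^ 2 * (S3 - t ^ 3 * E) := by linarith
      calc (ε * (deriv (deriv (deriv F)) y + 3 * m * (t * deriv (deriv F) y)) + 3 * b * t ^ 2) * E
          = ε * ((deriv (deriv (deriv F)) y + 3 * m * (t * deriv (deriv F) y)) * E)
            + 3 * b * (t ^ 2 * E) := by ring
        _ = ε * T3 + m ^ 2 * (ε * (S3 - t ^ 3 * E)) + 3 * b * (t ^ 2 * E) := by rw [h7]; ring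
        _ ≤ _ := by linarith
    · have hz := h.deriv_le z
      have hεz : |ε * deriv G z| ≤ b := by rw [abs_mul, hε, one_mul]; exact hz
      have h8 : 0 ≤ (deriv G z - t) ^ 2 * (3 * b - ε * deriv G z - 2 * (ε * t)) :=
        mul_nonneg (sq_nonneg _) (by linarith [le_abs_self (ε * deriv G z), le_abs_self (ε * t)])
      nlinarith

/-- With u = φ' one has u' = β² - u² and u'' = -2 u u'. At m = 1 the third-order combination is u
u', at most |β|³ in absolute value; adding 3 |β| u² ≤ 3 |β|³ explains the constant 4. -/
lemma sliceBound_log_cosh (β : ℝ) : SliceBound |β| 1 (fun y => Real.log (Real.cosh (β * y))) := by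
  have hcosh : ExpSmooth (fun y : ℝ => Real.cosh (β * y)) := by
    have hp : ∀ c : ℝ, ExpSmooth (fun y : ℝ => Real.exp (c * y)) := fun c =>
      expSmooth_exp.comp (expSmooth_clm (c • ContinuousLinearMap.id ℝ ℝ))
        (linGrowth_clm (c • ContinuousLinearMap.id ℝ ℝ))
    have h1 := ((hp β).add (hp (-β))).const_mul (1 / 2)
    have : (fun y : ℝ => Real.cosh (β * y))
        = fun y => 1 / 2 * (Real.exp (β * y) + Real.exp (-β * y)) := by
      ext y
      rw [Real.cosh_eq]
      ring_nf
    rw [this]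
    exact h1
  have hl := hcosh.log (expGrowth_of_bounded 1 fun y => by
    rw [norm_inv, Real.norm_of_nonneg (Real.cosh_pos _).le]
    exact inv_le_one_of_one_le₀ (Real.one_le_cosh _)) fun y => Real.cosh_pos _
  have hc : ∀ y : ℝ, HasDerivAt (fun y : ℝ => Real.cosh (β * y)) (Real.sinh (β * y) * β) y :=
    fun y => ((hasDerivAt_id y).const_mul β).cosh.congr_deriv (by simp)
  have hs : ∀ y : ℝ, HasDerivAt (fun y : ℝ => Real.sinh (β * y)) (Real.cosh (β * y) * β) y :=
    fun y => ((hasDerivAt_id y).const_mul β).sinh.congr_deriv (by simp)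
  have D1 : deriv (fun y => Real.log (Real.cosh (β * y)))
      = fun y => Real.sinh (β * y) * β / Real.cosh (β * y) := by
    ext y
    exact ((hc y).log (Real.cosh_pos _).ne').deriv
  have hsq : ∀ y : ℝ, Real.cosh (β * y) ^ 2 = Real.sinh (β * y) ^ 2 + 1 := fun y => Real.cosh_sq _
  have D2 : deriv (deriv (fun y => Real.log (Real.cosh (β * y))))
      = fun y => β ^ 2 - (deriv (fun y => Real.log (Real.cosh (β * y))) y) ^ 2 := by
    rw [D1]
    ext y
    have h1 : HasDerivAt (fun y => Real.sinh (β * y) * β / Real.cosh (β * y)) _ y :=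
      ((hs y).mul_const β).div (hc y) (Real.cosh_pos _).ne'
    rw [h1.deriv]
    have := (Real.cosh_pos (β * y)).ne'
    field_simp
  have b1 : ∀ y, |deriv (fun y => Real.log (Real.cosh (β * y))) y| ≤ |β| := by
    intro y
    rw [D1]
    have h0 := Real.cosh_pos (β * y)
    rw [abs_div, abs_mul, abs_of_pos h0, div_le_iff₀ h0, mul_comm]
    exact mul_le_mul_of_nonneg_left (abs_le_of_sq_le_sq (by linarith [hsq y]) h0.le) (abs_nonneg β)
  have b1' : ∀ y, (deriv (fun y => Real.log (Real.cosh (β * y))) y) ^ 2 ≤ β ^ 2 := fun y =>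
    sq_le_sq.2 (b1 y)
  have D3 : ∀ y, deriv (deriv (deriv (fun y => Real.log (Real.cosh (β * y))))) y
      = -2 * (deriv (fun y => Real.log (Real.cosh (β * y))) y
        * deriv (deriv (fun y => Real.log (Real.cosh (β * y)))) y) := by
    intro y
    conv_lhs => rw [D2]
    have h1 : HasDerivAt (fun y => β ^ 2 - (deriv (fun y => Real.log (Real.cosh (β * y))) y) ^ 2)
      _ y := ((hl.1.deriv.differentiable y).hasDerivAt.pow 2).const_sub (β ^ 2)
    rw [h1.deriv]
    simp
    ring
  refine ⟨⟨hl.1, hl.2⟩, b1, fun y => ?_, fun y => ?_, fun ε hε y => ?_⟩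
  · rw [D2]
    linarith [b1' y]
  · rw [D2, sq_abs]
    linarith
  · rw [D3]
    set u := deriv (fun y => Real.log (Real.cosh (β * y))) y with hu
    have hw : deriv (deriv (fun y => Real.log (Real.cosh (β * y)))) y = β ^ 2 - u ^ 2 := by rw [D2]
    have hu2 : u ^ 2 ≤ |β| ^ 2 := by rw [sq_abs]; exact b1' y
    rw [hw, ← sq_abs β]
    have h2 : ε * (u * (|β| ^ 2 - u ^ 2)) ≤ |β| * |β| ^ 2 := by
      refine (le_abs_self _).trans ?_
      rw [abs_mul, hε, one_mul, abs_mul, abs_of_nonneg (by linarith : 0 ≤ |β| ^ 2 - u ^ 2)]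
      exact mul_le_mul (b1 y) (by nlinarith) (by linarith) (abs_nonneg β)
    have h3 : |β| * u ^ 2 ≤ |β| * |β| ^ 2 := mul_le_mul_of_nonneg_left hu2 (abs_nonneg β)
    nlinarith

end Slices

/-! ### Heat flow on the line and piecewise constant order parameters -/

section Heat

/-- The amplitude √(b - q) is not smooth at q = b, whereas 2 sin θ is smooth and bounded. It covers
the amplitudes in [0, 2], and the substitution θ = arcsin(√(b - q) / 2) explains the condition b - q
< 4 below. -/
lemma hasDerivAt_gaussAvg_sin {g : ℝ → ℝ} (hg : ExpSmooth g) (y θ : ℝ) :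
    HasDerivAt (fun θ => gaussAvg (fun _ : ℝ => 2 * Real.sin θ) 1 g y)
      (2 * Real.cos θ * (2 * Real.sin θ) *
        gaussAvg (fun _ : ℝ => 2 * Real.sin θ) 1 (deriv (deriv g)) y) θ := by
  have hsin : ∀ p : ℝ × ℝ, HasFDerivAt (fun p : ℝ × ℝ => 2 * Real.sin p.1)
      ((2 : ℝ) • Real.cos p.1 • ContinuousLinearMap.fst ℝ ℝ ℝ) p := fun p =>
    ((hasFDerivAt_fst (𝕜 := ℝ) (p := p)).sin).const_mul 2
  have hs1 : ExpSmooth Real.sin := by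
    intro n
    refine ⟨Real.contDiff_sin.of_le le_top, fun i _ => expGrowth_of_bounded 1 fun x => ?_⟩
    rw [norm_iteratedFDeriv_eq_norm_iteratedDeriv]
    exact Real.abs_iteratedDeriv_sin_le_one i x
  have hs : Amplitude (fun p : ℝ × ℝ => 2 * Real.sin p.1) := by
    refine ⟨(hs1.comp (expSmooth_clm (ContinuousLinearMap.fst ℝ ℝ ℝ))
      (linGrowth_clm (ContinuousLinearMap.fst ℝ ℝ ℝ))).const_mul 2, 2, fun p => ?_⟩
    rw [abs_mul, abs_two]
    linarith [Real.abs_sin_le_one p.1]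
  have lift : ∀ {g : ℝ → ℝ}, ExpSmooth g → ExpSmooth (fun p : ℝ × ℝ => g p.2) := fun hg =>
    hg.comp (expSmooth_clm (ContinuousLinearMap.snd ℝ ℝ ℝ))
      (linGrowth_clm (ContinuousLinearMap.snd ℝ ℝ ℝ))
  have hd : ∀ {g : ℝ → ℝ}, ExpSmooth g → ∀ u : ℝ × ℝ,
      dirDeriv u (fun p : ℝ × ℝ => g p.2) = fun p => u.2 * deriv g p.2 := by
    intro g hg u
    ext p
    have h1 := (hg.differentiable p.2).hasDerivAt.hasFDerivAt.comp p
      (hasFDerivAt_snd (𝕜 := ℝ) (E := ℝ) (F := ℝ) (p := p))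
    rw [Function.comp_def] at h1
    rw [dirDeriv, h1.fderiv]
    simp
  have e : ∀ (g : ℝ → ℝ) (θ : ℝ), gaussAvg (fun p : ℝ × ℝ => 2 * Real.sin p.1) (0, 1)
      (fun p => g p.2) (θ, y) = gaussAvg (fun _ : ℝ => 2 * Real.sin θ) 1 g y := by
    intro g θ
    simp [gaussAvg]
  have h1 := ((lift hg).gaussAvg hs (0, 1)).differentiable (θ, y)
  have h2 : HasDerivAt (fun θ : ℝ => (θ, y)) ((1 : ℝ), (0 : ℝ)) θ :=
    (hasDerivAt_id θ).prodMk (hasDerivAt_const θ y)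
  have h3 := h1.hasFDerivAt.comp_hasDerivAt θ h2
  rw [Function.comp_def] at h3
  simp only [e] at h3
  refine h3.congr_deriv ?_
  change dirDeriv (1, 0) _ (θ, y) = _
  rw [dirDeriv_gaussAvg (lift hg) hs, hd hg, hd hg]
  have h4 : dirDeriv ((1 : ℝ), (0 : ℝ)) (fun p : ℝ × ℝ => 2 * Real.sin p.1) (θ, y)
      = 2 * Real.cos θ := by
    rw [dirDeriv, (hsin _).fderiv]
    simp
  have h5 : (fun p : ℝ × ℝ => (0, (1 : ℝ)).2 * deriv g p.2) = fun p : ℝ × ℝ => deriv g p.2 := by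
    ext; simp
  have h6 : (fun p : ℝ × ℝ => ((1 : ℝ), (0 : ℝ)).2 * deriv g p.2) = fun _ => 0 := by
    ext; simp
  rw [h4, h5, h6, hd hg.deriv, gaussAvg_const]
  have h7 : (fun p : ℝ × ℝ => ((0 : ℝ), (1 : ℝ)).2 * deriv (deriv g) p.2)
      = fun p : ℝ × ℝ => deriv (deriv g) p.2 := by
    ext; simp
  rw [h7, e]
  ring

lemma two_mul_sin_arcsin_half {r : ℝ} (h0 : 0 ≤ r) (h2 : r ≤ 2) :
    2 * Real.sin (Real.arcsin (r / 2)) = r := by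
  rw [Real.sin_arcsin (by linarith) (by linarith)]
  ring

lemma hasDerivAt_gaussAvg_sqrt {g : ℝ → ℝ} (hg : ExpSmooth g) {q b : ℝ} (hqb : q < b)
    (h4 : b - q < 4) (y : ℝ) :
    HasDerivAt (fun q => gaussAvg (fun _ : ℝ => √(b - q)) 1 g y)
      (-(1 / 2) * gaussAvg (fun _ : ℝ => √(b - q)) 1 (deriv (deriv g)) y) q := by
  have hr : 0 < √(b - q) := Real.sqrt_pos.2 (by linarith)
  have hr2 : √(b - q) < 2 := by
    rw [Real.sqrt_lt' (by norm_num)]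
    linarith
  have h1 : HasDerivAt (fun q => √(b - q)) (-1 / (2 * √(b - q))) q :=
    ((hasDerivAt_id q).const_sub b).sqrt (by simp; linarith)
  have h2 := (Real.hasDerivAt_arcsin (x := √(b - q) / 2) (by linarith) (by linarith)).comp q
    (h1.div_const 2)
  have h3 := (hasDerivAt_gaussAvg_sin hg y (Real.arcsin (√(b - q) / 2))).comp q h2
  have hev : ∀ᶠ p in 𝓝 q, b - p < 4 :=
    ((continuous_const.sub continuous_id).tendsto q).eventually (gt_mem_nhds h4)
  refine (h3.congr_of_eventuallyEq ?_).congr_deriv ?_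
  · filter_upwards [hev] with p hp
    have : √(b - p) ≤ 2 := by
      rw [Real.sqrt_le_left (by norm_num)]
      linarith
    simp only [Function.comp_apply]
    rw [two_mul_sin_arcsin_half (Real.sqrt_nonneg _) this]
  · rw [two_mul_sin_arcsin_half hr.le hr2.le, Real.cos_arcsin]
    have hc : 0 < √(1 - (√(b - q) / 2) ^ 2) := Real.sqrt_pos.2 (by nlinarith)
    generalize √(1 - (√(b - q) / 2) ^ 2) = c at hc
    generalize gaussAvg (fun _ : ℝ => √(b - q)) 1 (deriv (deriv g)) y = A
    generalize √(b - q) = r at hr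
    field_simp

/-- This includes the endpoint q = b, where the chain rule through the square root fails; continuity
there is what gluing two steps needs. -/
lemma continuousAt_gaussAvg_sqrt {g : ℝ → ℝ} (hg : ExpSmooth g) {q b : ℝ} (h4 : b - q < 4) (y : ℝ) :
    ContinuousAt (fun q => gaussAvg (fun _ : ℝ => √(b - q)) 1 g y) q := by
  have h1 : Continuous (fun θ => gaussAvg (fun _ : ℝ => 2 * Real.sin θ) 1 g y) :=
    continuous_iff_continuousAt.2 fun θ => (hasDerivAt_gaussAvg_sin hg y θ).continuousAt
  have h2 : Continuous (fun q : ℝ => Real.arcsin (√(b - q) / 2)) :=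
    Real.continuous_arcsin.comp (by fun_prop)
  have hev : ∀ᶠ p in 𝓝 q, b - p < 4 :=
    ((continuous_const.sub continuous_id).tendsto q).eventually (gt_mem_nhds h4)
  refine (h1.comp h2).continuousAt.congr ?_
  filter_upwards [hev] with p hp
  have : √(b - p) ≤ 2 := by
    rw [Real.sqrt_le_left (by norm_num)]
    linarith
  simp only [Function.comp_apply]
  rw [two_mul_sin_arcsin_half (Real.sqrt_nonneg _) this]

/-- exp(m F) solves the backward heat equation; dividing by m exp(m F) turns its second derivative
into F'' + m F'². -/
lemma Potential.hasDerivAt_coleHopf_sqrt {G : ℝ → ℝ} (hG : Potential G) {m : ℝ} (hm : 0 < m)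
    {q b : ℝ} (hqb : q < b) (h4 : b - q < 4) (y : ℝ) :
    HasDerivAt (fun q => SpinGlass.coleHopf m (fun _ : ℝ => √(b - q)) 1 G y)
      (-(1 / 2) * deriv (deriv (SpinGlass.coleHopf m (fun _ : ℝ => √(b - q)) 1 G)) y
        - 1 / 2 * m * deriv (SpinGlass.coleHopf m (fun _ : ℝ => √(b - q)) 1 G) y ^ 2) q := by
  have h1 := ((hasDerivAt_gaussAvg_sqrt (hG.exp m) hqb h4 y).log
    (hG.gaussAvg_exp_pos m _ _ _).ne').const_mul m⁻¹
  refine h1.congr_deriv ?_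
  set F := SpinGlass.coleHopf m (fun _ : ℝ => √(b - q)) 1 G with hF
  have hFp : Potential F := hG.coleHopf (amplitude_const _) m 1
  have e0 : (fun y => Real.exp (m * F y)) = gaussAvg (fun _ : ℝ => √(b - q)) 1
      (fun y => Real.exp (m * G y)) := funext fun y => hG.exp_coleHopf hm _ _ y
  rw [← deriv_gaussAvg (hG.exp m).deriv, ← deriv_gaussAvg (hG.exp m), ← e0, hFp.deriv_deriv_exp]
  beta_reduce
  have := (Real.exp_pos (m * F y)).ne'
  field_simp
  ring

lemma Potential.continuousAt_coleHopf_sqrt {G : ℝ → ℝ} (hG : Potential G) {m : ℝ}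
    {q b : ℝ} (h4 : b - q < 4) (y : ℝ) :
    ContinuousAt (fun q => SpinGlass.coleHopf m (fun _ : ℝ => √(b - q)) 1 G y) q :=
  ((continuousAt_gaussAvg_sqrt (hG.exp m) h4 y).log (hG.gaussAvg_exp_pos m _ _ _).ne').const_mul m⁻¹

/-- The slices `φ` at `q` of the solutions of the Parisi equation with a piecewise constant order
parameter, with current value `m` at `q` and with `I` the integral of `2 q x(q)` from `q` to `1`. -/
inductive Cascade (β : ℝ) : ℝ → ℝ → ℝ → (ℝ → ℝ) → Prop
  | base : Cascade β 1 1 0 (fun y => Real.log (Real.cosh (β * y)))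
  | flow {q m I : ℝ} {φ : ℝ → ℝ} (q' : ℝ) : Cascade β q m I φ → 0 ≤ q' → q' ≤ q →
      Cascade β q' m (I + m * (q ^ 2 - q' ^ 2)) (coleHopf m (fun _ => √(q - q')) 1 φ)
  | drop {q m I : ℝ} {φ : ℝ → ℝ} (m' : ℝ) : Cascade β q m I φ → 0 < m' → m' ≤ m →
      Cascade β q m' I φ

lemma Cascade.facts {β q m I : ℝ} {φ : ℝ → ℝ} (h : Cascade β q m I φ) :
    0 < m ∧ m ≤ 1 ∧ 0 ≤ q ∧ q ≤ 1 ∧ SliceBound |β| m φ := by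
  induction h with
  | base => exact ⟨one_pos, le_rfl, zero_le_one, le_rfl, sliceBound_log_cosh β⟩
  | flow q' _ h0 h1 ih =>
    exact ⟨ih.1, ih.2.1, h0, h1.trans ih.2.2.2.1, ih.2.2.2.2.coleHopf ih.1 ih.2.1 _⟩
  | drop m' _ h0 h1 ih =>
    exact ⟨h0, h1.trans ih.2.1, ih.2.2.1, ih.2.2.2.1, ih.2.2.2.2.drop h1⟩

/-- A solution on `[a, 1]` of the Parisi equation with the piecewise constant order parameter `X`. -/
structure StepFlow (β a : ℝ) (X : ℝ → ℝ) (f : ℝ → ℝ → ℝ) : Prop where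
  slice : ∀ q ∈ Icc a 1, ∃ m I, Cascade β q m I (f q)
  cont : ∀ y, ContinuousOn (fun q => f q y) (Icc a 1)
  rderiv : ∀ q ∈ Ico a 1, ∀ y, HasDerivWithinAt (fun p => f p y)
    (-(1 / 2) * deriv (deriv (f q)) y - 1 / 2 * X q * deriv (f q) y ^ 2) (Ici q) q
  final : f 1 = fun y => Real.log (Real.cosh (β * y))

lemma stepFlow_one (β : ℝ) (X : ℝ → ℝ) :
    StepFlow β 1 X (fun _ y => Real.log (Real.cosh (β * y))) := by
  refine ⟨fun q hq => ?_, fun y => continuousOn_const, fun q hq => ?_, rfl⟩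
  · obtain rfl : q = 1 := le_antisymm hq.2 hq.1
    exact ⟨1, 0, .base⟩
  · simp at hq

/-- The two pieces agree at b because the transformation with amplitude 0 is the identity. The
derivative in q may jump there with the order parameter, so only right derivatives are recorded. -/
lemma StepFlow.extend {β a b m I : ℝ} {X : ℝ → ℝ} {f : ℝ → ℝ → ℝ} (h : StepFlow β b X f)
    (ha : 0 ≤ a) (hab : a ≤ b) (hc : Cascade β b m I (f b)) :
    ∃ f', StepFlow β a (fun q => if q < b then m else X q) f' ∧
      Cascade β a m (I + m * (b ^ 2 - a ^ 2)) (f' a) := by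
  obtain ⟨hm, hm1, -, hb1, hsl⟩ := hc.facts
  have hG := hsl.potential
  set T : ℝ → ℝ → ℝ := fun q => coleHopf m (fun _ : ℝ => √(b - q)) 1 (f b) with hT
  have hTb : T b = f b := by
    ext y
    exact coleHopf_of_zero hm (by simp) _
  set g : ℝ → ℝ → ℝ := fun q => if q < b then T q else f q with hg
  have hlt : ∀ {q}, q < b → g q = T q := fun hq => if_pos hq
  have hge : ∀ {q}, b ≤ q → g q = f q := fun hq =>
    if_neg (not_lt.2 hq)
  have hle : ∀ {q}, q ≤ b → g q = T q := by
    intro q hq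
    rcases hq.lt_or_eq with h1 | rfl
    · exact hlt h1
    · rw [hge le_rfl, hTb]
  refine ⟨g, ⟨fun q hq => ?_, fun y => ?_, fun q hq y => ?_, ?_⟩,
    ?_⟩
  · rcases lt_or_ge q b with h1 | h1
    · rw [hlt h1]
      exact ⟨m, _, hc.flow q (ha.trans hq.1) h1.le⟩
    · rw [hge h1]
      exact h.slice q ⟨h1, hq.2⟩
  · have h1 : ContinuousOn (fun q => T q y) (Icc a b) := fun q hq =>
      (hG.continuousAt_coleHopf_sqrt (by linarith [hq.1]) y).continuousWithinAt
    have h2 : ContinuousOn (fun q => g q y) (Icc a b ∪ Icc b 1) := by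
      refine ContinuousOn.union_of_isClosed (h1.congr fun q hq => congrFun (hle hq.2) y)
        ((h.cont y).congr fun q hq => congrFun (hge hq.1) y) isClosed_Icc isClosed_Icc
    rwa [Icc_union_Icc_eq_Icc hab hb1] at h2
  · rcases lt_or_ge q b with h1 | h1
    · rw [hlt h1]
      simp only [if_pos h1]
      refine ((hG.hasDerivAt_coleHopf_sqrt hm h1 (by linarith [hq.1]) y).hasDerivWithinAt).congr_of_eventuallyEq
        ?_ (congrFun (hlt h1) y)
      have : ∀ᶠ p in 𝓝[≥] q, p < b := mem_nhdsWithin_of_mem_nhds (gt_mem_nhds h1)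
      filter_upwards [this] with p hp
      exact congrFun (hlt hp) y
    · rw [hge h1]
      simp only [if_neg (not_lt.2 h1)]
      refine (h.rderiv q ⟨h1, hq.2⟩ y).congr (fun p hp => ?_) (congrFun (hge h1) y)
      exact congrFun (hge (h1.trans hp)) y
  · rw [hge hb1, h.final]
  · rw [hle hab]
    exact hc.flow a ha hab

end Heat

/-! ### A maximum principle for the Parisi equation -/

section Comparison

/-- Solutions of the Parisi equation in the sense of right derivatives in `q`, for the order
parameter `X`, with `C` a bound for the derivative in `y`. -/
structure RightSolution (C : ℝ) (X : ℝ → ℝ) (f : ℝ → ℝ → ℝ) : Prop where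
  contDiff : ∀ q ∈ Icc (0 : ℝ) 1, ContDiff ℝ 2 (f q)
  continuousOn : ContinuousOn (fun p : ℝ × ℝ => f p.1 p.2) (Icc 0 1 ×ˢ univ)
  bound : ∀ q ∈ Icc (0 : ℝ) 1, ∀ y, |deriv (f q) y| ≤ C
  rderiv : ∀ q ∈ Ico (0 : ℝ) 1, ∀ y, HasDerivWithinAt (fun p => f p y)
    (-(1 / 2) * deriv (deriv (f q)) y - 1 / 2 * X q * deriv (f q) y ^ 2) (Ici q) q

/-- A positive second derivative would make the point a local minimum as well, so g would be locally
constant. -/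
lemma deriv_deriv_nonpos_of_isLocalMax {g : ℝ → ℝ} {y : ℝ} (hg : ContDiff ℝ 2 g)
    (h : IsLocalMax g y) : deriv (deriv g) y ≤ 0 := by
  by_contra! hpos
  have h1 := isLocalMin_of_deriv_deriv_pos hpos h.deriv_eq_zero hg.continuous.continuousAt
  have h2 : g =ᶠ[𝓝 y] fun _ => g y := by
    filter_upwards [h, h1] with z hz hz'
    exact le_antisymm hz hz'
  have h3 : deriv (deriv g) y = 0 := by
    have h4 : deriv g =ᶠ[𝓝 y] deriv (fun _ => g y) := h2.deriv
    rw [h4.deriv_eq]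
    simp
  linarith

lemma hasDerivWithinAt_Ici_nonpos {g : ℝ → ℝ} {g' q : ℝ} (h : HasDerivWithinAt g g' (Ici q) q)
    (hmax : ∀ᶠ p in 𝓝[>] q, g p ≤ g q) : g' ≤ 0 := by
  have h1 : HasDerivWithinAt g g' (Ioi q) q := h.mono Ioi_subset_Ici_self
  rw [hasDerivWithinAt_iff_tendsto_slope' (by simp)] at h1
  refine le_of_tendsto h1 ?_
  filter_upwards [hmax, self_mem_nhdsWithin] with p hp hp'
  rw [slope_def_field]
  exact div_nonpos_of_nonpos_of_nonneg (by linarith) (by linarith [mem_Ioi.1 hp'])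

lemma abs_sub_le_of_deriv_le {g : ℝ → ℝ} {C : ℝ} (hg : Differentiable ℝ g)
    (h : ∀ y, |deriv g y| ≤ C) (y z : ℝ) : |g y - g z| ≤ C * |y - z| :=
  Convex.norm_image_sub_le_of_norm_deriv_le (fun x _ => hg x) (fun x _ => h x) convex_univ
    (mem_univ z) (mem_univ y)

set_option maxHeartbeats 800000 in
-- At an interior maximum of f - g the second derivatives are ordered and the first ones agree, so
-- only (X - Y) (∂_y f)² / 2 drives the difference, at rate at most C² ε / 2. Since y ranges over
-- the line, a barrier growing like δ y² forces the maximum to exist, f - g being of linear growth;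
-- then δ tends to 0.
lemma RightSolution.sub_le {C ε : ℝ} {X Y : ℝ → ℝ} {f g : ℝ → ℝ → ℝ} (hf : RightSolution C X f)
    (hg : RightSolution C Y g) (hY : ∀ q ∈ Ico (0 : ℝ) 1, Y q ∈ Icc (0 : ℝ) 1)
    (hXY : ∀ q ∈ Ico (0 : ℝ) 1, |X q - Y q| ≤ ε) (hfin : f 1 = g 1) {q : ℝ}
    (hq : q ∈ Icc (0 : ℝ) 1) (y : ℝ) : f q y - g q y ≤ 1 / 2 * C ^ 2 * ε := by
  have h01 : (0 : ℝ) ∈ Icc (0 : ℝ) 1 := ⟨le_rfl, zero_le_one⟩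
  have hC : 0 ≤ C := (abs_nonneg _).trans (hf.bound 0 h01 0)
  have hε : 0 ≤ ε := (abs_nonneg _).trans (hXY 0 ⟨le_rfl, zero_lt_one⟩)
  -- The 1 absorbs the second derivative of the barrier, and 2 C absorbs the difference of the
  -- squared gradients, which the barrier makes nonzero at the maximum.
  set K : ℝ := 1 + 2 * C with hK
  suffices H : ∀ δ > 0, ∀ q ∈ Icc (0 : ℝ) 1, ∀ y, f q y - g q y
      - ((1 / 2 * C ^ 2 * ε + δ) * (1 - q) + δ * (1 + y ^ 2) * Real.exp (K * (1 - q))) ≤ 0 by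
    have hlim : Filter.Tendsto (fun δ : ℝ => (1 / 2 * C ^ 2 * ε + δ) * (1 - q)
        + δ * (1 + y ^ 2) * Real.exp (K * (1 - q))) (𝓝[>] 0)
        (𝓝 ((1 / 2 * C ^ 2 * ε + 0) * (1 - q) + 0 * (1 + y ^ 2) * Real.exp (K * (1 - q)))) :=
      tendsto_nhdsWithin_of_tendsto_nhds (Continuous.tendsto (by fun_prop) 0)
    have h1 := ge_of_tendsto (b := f q y - g q y) hlim (by
      filter_upwards [self_mem_nhdsWithin] with δ hδ
      linarith [H δ hδ q hq y])
    have h2 : 0 ≤ 1 / 2 * C ^ 2 * ε := by positivity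
    nlinarith [hq.1]
  intro δ hδ
  set B : ℝ → ℝ → ℝ := fun q y => (1 / 2 * C ^ 2 * ε + δ) * (1 - q)
    + δ * (1 + y ^ 2) * Real.exp (K * (1 - q)) with hB
  set M : ℝ → ℝ → ℝ := fun q y => f q y - g q y - B q y with hM
  by_contra! hcon
  obtain ⟨q₁, hq₁, y₁, hpos⟩ := hcon
  change 0 < M q₁ y₁ at hpos
  have hsub : ∀ {s : Set ℝ}, ContinuousOn (fun p : ℝ × ℝ => M p.1 p.2) (Icc 0 1 ×ˢ s) := by
    intro s
    refine ((hf.continuousOn.sub hg.continuousOn).sub (Continuous.continuousOn ?_)).mono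
      (prod_mono_right (subset_univ s))
    simp only [hB]
    fun_prop
  -- the difference grows at most linearly
  obtain ⟨A, hA⟩ : ∃ A, ∀ q ∈ Icc (0 : ℝ) 1, f q 0 - g q 0 ≤ A := by
    have h1 : ContinuousOn (fun q => f q 0 - g q 0) (Icc 0 1) :=
      (hf.continuousOn.sub hg.continuousOn).comp (f := fun q : ℝ => (q, (0 : ℝ)))
        (by fun_prop) (fun q hq => ⟨hq, mem_univ _⟩)
    obtain ⟨A, hA⟩ := isCompact_Icc.bddAbove_image h1
    exact ⟨A, fun q hq => hA (mem_image_of_mem _ hq)⟩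
  have hlin : ∀ q ∈ Icc (0 : ℝ) 1, ∀ y, f q y - g q y ≤ A + 2 * C * |y| := by
    intro q hq y
    have h1 := abs_sub_le_of_deriv_le ((hf.contDiff q hq).differentiable (by norm_num))
      (hf.bound q hq) y 0
    have h2 := abs_sub_le_of_deriv_le ((hg.contDiff q hq).differentiable (by norm_num))
      (hg.bound q hq) y 0
    rw [sub_zero] at h1 h2
    linarith [hA q hq, (abs_le.1 h1).2, (abs_le.1 h2).1]
  obtain ⟨R, hR1, hRy, hRM⟩ : ∃ R : ℝ, 1 ≤ R ∧ |y₁| ≤ R ∧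
      ∀ q ∈ Icc (0 : ℝ) 1, ∀ y, R ≤ |y| → M q y ≤ 0 := by
    refine ⟨max (max 1 |y₁|) ((|A| + 2 * C) / δ), (le_max_left _ _).trans (le_max_left _ _),
      (le_max_right _ _).trans (le_max_left _ _), fun q hq y hy => ?_⟩
    have hy1 : 1 ≤ |y| := ((le_max_left _ _).trans (le_max_left _ _)).trans hy
    have hy2 : (|A| + 2 * C) / δ ≤ |y| := (le_max_right _ _).trans hy
    rw [div_le_iff₀ hδ] at hy2
    have h1 := hlin q hq y
    have h2 : 1 ≤ Real.exp (K * (1 - q)) :=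
      Real.one_le_exp (mul_nonneg (by positivity) (by linarith [hq.2]))
    have h3 : δ * (1 + y ^ 2) ≤ δ * (1 + y ^ 2) * Real.exp (K * (1 - q)) :=
      le_mul_of_one_le_right (by positivity) h2
    have h4 : (|A| + 2 * C) * |y| ≤ |y| * δ * |y| := mul_le_mul_of_nonneg_right hy2 (abs_nonneg y)
    have h5 : |y| * δ * |y| = δ * y ^ 2 := by rw [← sq_abs]; ring
    have h6 : A ≤ |A| * |y| := (le_abs_self A).trans (le_mul_of_one_le_right (abs_nonneg A) hy1)
    have h7 : 0 ≤ (1 / 2 * C ^ 2 * ε + δ) * (1 - q) :=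
      mul_nonneg (by positivity) (by linarith [hq.2])
    simp only [hM, hB]
    nlinarith
  obtain ⟨⟨q₀, y₀⟩, ⟨hq₀, hy₀⟩, hmax⟩ := (isCompact_Icc.prod isCompact_Icc).exists_isMaxOn
    (s := Icc (0 : ℝ) 1 ×ˢ Icc (-R) R) ⟨(q₁, y₁), hq₁, abs_le.1 hRy⟩ hsub
  have hmax' : ∀ q ∈ Icc (0 : ℝ) 1, ∀ y ∈ Icc (-R) R, M q y ≤ M q₀ y₀ := fun q hq y hy =>
    hmax (show (q, y) ∈ Icc (0 : ℝ) 1 ×ˢ Icc (-R) R from ⟨hq, hy⟩)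
  have hpos0 : 0 < M q₀ y₀ := hpos.trans_le (hmax' q₁ hq₁ y₁ (abs_le.1 hRy))
  have hglob : ∀ q ∈ Icc (0 : ℝ) 1, ∀ y, M q y ≤ M q₀ y₀ := by
    intro q hq y
    rcases le_total |y| R with h | h
    · exact hmax' q hq y (abs_le.1 h)
    · exact (hRM q hq y h).trans hpos0.le
  have hq1 : q₀ ≠ 1 := by
    rintro rfl
    have : M 1 y₀ = -(δ * (1 + y₀ ^ 2)) := by simp [hM, hB, hfin]
    have h2 : 0 < δ * (1 + y₀ ^ 2) := by positivity
    linarith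
  have hq₀' : q₀ ∈ Ico (0 : ℝ) 1 := ⟨hq₀.1, lt_of_le_of_ne hq₀.2 hq1⟩
  set e := Real.exp (K * (1 - q₀)) with he
  have hepos : 0 < e := Real.exp_pos _
  have hBd : ∀ y, HasDerivAt (B q₀) (2 * δ * e * y) y := by
    intro y
    have h1 := ((((hasDerivAt_id y).pow 2).const_add 1).const_mul δ).mul_const e
    refine (h1.const_add ((1 / 2 * C ^ 2 * ε + δ) * (1 - q₀))).congr_deriv ?_
    simp
    ring
  have hBd1 : deriv (B q₀) = fun y => 2 * δ * e * y := funext fun y => (hBd y).deriv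
  have hBc : ContDiff ℝ 2 (B q₀) := by
    simp only [hB]
    fun_prop
  have cf := hf.contDiff q₀ hq₀
  have cg := hg.contDiff q₀ hq₀
  have df := cf.differentiable (by norm_num)
  have dg := cg.differentiable (by norm_num)
  have df' : Differentiable ℝ (deriv (f q₀)) := (cf.deriv' (n := 1)).differentiable (by norm_num)
  have dg' : Differentiable ℝ (deriv (g q₀)) := (cg.deriv' (n := 1)).differentiable (by norm_num)
  have hM1 : deriv (M q₀) = fun y => deriv (f q₀) y - deriv (g q₀) y - 2 * δ * e * y :=
    funext fun y => (((df y).hasDerivAt.sub (dg y).hasDerivAt).sub (hBd y)).deriv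
  have hloc : IsLocalMax (M q₀) y₀ := Filter.Eventually.of_forall fun y => hglob q₀ hq₀ y
  have e1 := hloc.deriv_eq_zero
  have e2 := deriv_deriv_nonpos_of_isLocalMax ((cf.sub cg).sub hBc) hloc
  have e2' : deriv (deriv (M q₀)) y₀ = deriv (deriv (f q₀)) y₀ - deriv (deriv (g q₀)) y₀
      - 2 * δ * e := by
    rw [hM1]
    exact ((((df' y₀).hasDerivAt.sub (dg' y₀).hasDerivAt).sub
      ((hasDerivAt_id y₀).const_mul (2 * δ * e))).congr_deriv (by simp)).deriv
  have e2'' : deriv (deriv (f q₀)) y₀ - deriv (deriv (g q₀)) y₀ - 2 * δ * e ≤ 0 := e2' ▸ e2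
  rw [hM1] at e1
  have hBq : HasDerivAt (fun p => B p y₀) (-(1 / 2 * C ^ 2 * ε + δ) - K * (δ * (1 + y₀ ^ 2) * e))
      q₀ := by
    have h1 := ((hasDerivAt_id q₀).const_sub 1).const_mul (1 / 2 * C ^ 2 * ε + δ)
    have h2 := ((((hasDerivAt_id q₀).const_sub 1).const_mul K).exp).const_mul (δ * (1 + y₀ ^ 2))
    refine (h1.add h2).congr_deriv ?_
    simp [he]
    ring
  -- As q₀ < 1, points to the right of q₀ are available; q₀ = 0 needs no separate treatment, and
  -- right derivatives suffice.
  have e3 := hasDerivWithinAt_Ici_nonpos (((hf.rderiv q₀ hq₀' y₀).sub (hg.rderiv q₀ hq₀' y₀)).sub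
    hBq.hasDerivWithinAt) (by
      have : ∀ᶠ p in 𝓝[>] q₀, p < 1 := mem_nhdsWithin_of_mem_nhds (gt_mem_nhds hq₀'.2)
      filter_upwards [this, self_mem_nhdsWithin] with p hp hp'
      exact hglob p ⟨hq₀.1.trans (mem_Ioi.1 hp').le, hp.le⟩ y₀)
  -- the final estimate at the maximum
  set u := deriv (f q₀) y₀ with hu
  set w := deriv (g q₀) y₀ with hw
  have hub := abs_le.1 (hf.bound q₀ hq₀ y₀)
  have hwb := abs_le.1 (hg.bound q₀ hq₀ y₀)
  have hXYb := abs_le.1 (hXY q₀ hq₀')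
  have hYb := hY q₀ hq₀'
  have hu2 : u ^ 2 ≤ C ^ 2 := sq_le_sq' hub.1 hub.2
  have t1 : (X q₀ - Y q₀) * u ^ 2 ≤ ε * C ^ 2 :=
    (mul_le_mul_of_nonneg_right hXYb.2 (sq_nonneg u)).trans (mul_le_mul_of_nonneg_left hu2 hε)
  have t2 : u - w = 2 * δ * e * y₀ := by linarith
  have t3 : Y q₀ * (u ^ 2 - w ^ 2) ≤ 2 * C * (δ * e * (1 + y₀ ^ 2)) := by
    have h1 : u ^ 2 - w ^ 2 = 2 * (δ * e) * (y₀ * (u + w)) := by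
      rw [sq_sub_sq, t2]; ring
    have h2 : |y₀ * (u + w)| ≤ |y₀| * (2 * C) := by
      rw [abs_mul]
      refine mul_le_mul_of_nonneg_left ?_ (abs_nonneg _)
      rw [abs_le]
      constructor <;> linarith
    have h3 : 2 * |y₀| ≤ 1 + y₀ ^ 2 := by
      rw [← sq_abs]
      nlinarith [sq_nonneg (|y₀| - 1)]
    have h4 : |y₀ * (u + w)| ≤ C * (1 + y₀ ^ 2) := h2.trans (by nlinarith)
    have h5 : 0 ≤ δ * e := by positivity
    rw [h1]
    calc Y q₀ * (2 * (δ * e) * (y₀ * (u + w)))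
        ≤ |Y q₀ * (2 * (δ * e) * (y₀ * (u + w)))| := le_abs_self _
      _ = Y q₀ * (2 * (δ * e) * |y₀ * (u + w)|) := by
          rw [abs_mul, abs_mul, abs_of_nonneg hYb.1, abs_of_nonneg (by positivity : 0 ≤ 2 * (δ * e))]
      _ ≤ 1 * (2 * (δ * e) * (C * (1 + y₀ ^ 2))) := by
          refine mul_le_mul hYb.2 ?_ (by positivity) zero_le_one
          exact mul_le_mul_of_nonneg_left h4 (by positivity)
      _ = _ := by ring
  have t4 : 0 ≤ δ * e * y₀ ^ 2 := by positivity
  have t5 : 0 ≤ C * (δ * e * (1 + y₀ ^ 2)) := by positivity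
  have t6 : K * (δ * (1 + y₀ ^ 2) * e) = δ * e * (1 + y₀ ^ 2) + 2 * (C * (δ * e * (1 + y₀ ^ 2))) := by
    rw [hK]; ring
  have t7 : δ * e * (1 + y₀ ^ 2) = δ * e + δ * e * y₀ ^ 2 := by ring
  rw [t6] at e3
  linarith

lemma RightSolution.abs_sub_le {C ε : ℝ} {X Y : ℝ → ℝ} {f g : ℝ → ℝ → ℝ} (hf : RightSolution C X f)
    (hg : RightSolution C Y g) (hX : ∀ q ∈ Ico (0 : ℝ) 1, X q ∈ Icc (0 : ℝ) 1)
    (hY : ∀ q ∈ Ico (0 : ℝ) 1, Y q ∈ Icc (0 : ℝ) 1)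
    (hXY : ∀ q ∈ Ico (0 : ℝ) 1, |X q - Y q| ≤ ε) (hfin : f 1 = g 1) {q : ℝ}
    (hq : q ∈ Icc (0 : ℝ) 1) (y : ℝ) : |f q y - g q y| ≤ 1 / 2 * C ^ 2 * ε := by
  have h1 := hf.sub_le hg hY hXY hfin hq y
  have h2 := hg.sub_le hf hX (fun q hq => by rw [abs_sub_comm]; exact hXY q hq) hfin.symm hq y
  exact abs_le.2 ⟨by linarith, h1⟩

end Comparison

/-! ### Right limits and step approximations of order parameters -/

section OrderParameters

/-- The monotone extension of an order parameter to the line. -/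
def clampExtend (x : ℝ → ℝ) (q : ℝ) : ℝ := x (max 0 (min 1 q))

/-- The right limits of an order parameter. -/
def rightValue (x : ℝ → ℝ) (q : ℝ) : ℝ := Function.rightLim (clampExtend x) q

lemma clamp_mem (q : ℝ) : max 0 (min 1 q) ∈ Icc (0 : ℝ) 1 :=
  ⟨le_max_left _ _, max_le zero_le_one (min_le_left _ _)⟩

lemma clampExtend_of_mem {x : ℝ → ℝ} {q : ℝ} (hq : q ∈ Icc (0 : ℝ) 1) : clampExtend x q = x q := by
  rw [clampExtend, min_eq_right hq.2, max_eq_right hq.1]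

variable {x : ℝ → ℝ}

lemma monotone_clampExtend (hx : x ∈ OrderParameter) : Monotone (clampExtend x) := fun _ _ h =>
  hx.1 (clamp_mem _) (clamp_mem _) (max_le_max_left _ (min_le_min_left _ h))

lemma tendsto_rightValue (hx : x ∈ OrderParameter) {q : ℝ} (hq : q ∈ Ico (0 : ℝ) 1) :
    Filter.Tendsto x (𝓝[>] q) (𝓝 (rightValue x q)) := by
  refine ((monotone_clampExtend hx).tendsto_rightLim q).congr' ?_
  have : ∀ᶠ p in 𝓝[>] q, p < 1 := mem_nhdsWithin_of_mem_nhds (gt_mem_nhds hq.2)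
  filter_upwards [this, self_mem_nhdsWithin] with p hp hp'
  exact clampExtend_of_mem ⟨hq.1.trans (mem_Ioi.1 hp').le, hp.le⟩

lemma rightValue_mem (hx : x ∈ OrderParameter) (q : ℝ) : rightValue x q ∈ Icc (0 : ℝ) 1 :=
  isClosed_Icc.mem_of_tendsto ((monotone_clampExtend hx).tendsto_rightLim q)
    (Filter.Eventually.of_forall fun _ => hx.2 (clamp_mem _))

lemma rightValue_mem_of_forall (hx : x ∈ OrderParameter) {q b c d : ℝ} (hq : q ∈ Ico (0 : ℝ) 1)
    (hqb : q < b) (h : ∀ p ∈ Ioo q b, x p ∈ Icc c d) : rightValue x q ∈ Icc c d := by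
  refine isClosed_Icc.mem_of_tendsto (tendsto_rightValue hx hq) ?_
  filter_upwards [Ioo_mem_nhdsGT hqb] with p hp
  exact h p hp

lemma tendsto_rightValue_of_continuousAt (hx : x ∈ OrderParameter) {q : ℝ}
    (hq : q ∈ Ioo (0 : ℝ) 1) (hc : ContinuousAt x q) :
    Filter.Tendsto (rightValue x) (𝓝 q) (𝓝 (x q)) := by
  rw [Metric.tendsto_nhds]
  intro ε hε
  have h1 : ∀ᶠ p in 𝓝 q, x p ∈ Icc (x q - ε / 2) (x q + ε / 2) :=
    hc.eventually (Icc_mem_nhds (by linarith) (by linarith))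
  obtain ⟨a, b, hab, hsub⟩ := mem_nhds_iff_exists_Ioo_subset.1 (h1.and (Ioo_mem_nhds hq.1 hq.2))
  filter_upwards [Ioo_mem_nhds hab.1 hab.2] with p hp
  have hp01 := (hsub hp).2
  have h2 := rightValue_mem_of_forall hx ⟨hp01.1.le, hp01.2⟩ hp.2
    fun s hs => (hsub ⟨hp.1.trans hs.1, hs.2⟩).1
  rw [Real.dist_eq, abs_lt]
  constructor <;> linarith [h2.1, h2.2]

lemma countable_not_continuousAt (hx : x ∈ OrderParameter) :
    {q | q ∈ Ioo (0 : ℝ) 1 ∧ ¬ ContinuousAt x q}.Countable := by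
  refine Set.Countable.mono ?_ (monotone_clampExtend hx).countable_not_continuousAt
  rintro q hq (hc : ContinuousAt _ _)
  refine hq.2 (hc.congr ?_)
  filter_upwards [Ioo_mem_nhds hq.1.1 hq.1.2] with p hp
  exact clampExtend_of_mem ⟨hp.1.le, hp.2.le⟩

lemma intervalIntegrable_order (hx : x ∈ OrderParameter) {a b : ℝ} (ha : a ∈ Icc (0 : ℝ) 1)
    (hb : b ∈ Icc (0 : ℝ) 1) : IntervalIntegrable x volume a b :=
  (hx.1.mono (uIcc_subset_Icc ha hb)).intervalIntegrable

lemma intervalIntegrable_mul_order (hx : x ∈ OrderParameter) {a b : ℝ} (ha : a ∈ Icc (0 : ℝ) 1)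
    (hb : b ∈ Icc (0 : ℝ) 1) : IntervalIntegrable (fun q => 2 * q * x q) volume a b :=
  (intervalIntegrable_order hx ha hb).continuousOn_mul (by fun_prop)

/-- The level sets of an order parameter. -/
lemma exists_levels (hx : x ∈ OrderParameter) {n : ℕ} (hn : 0 < n) :
    ∃ t : ℕ → ℝ, t 0 = 0 ∧ t n = 1 ∧ Monotone t ∧ (∀ k, t k ∈ Icc (0 : ℝ) 1) ∧
      ∀ k, ∀ q ∈ Ioo (t k) (t (k + 1)), x q ∈ Icc ((k : ℝ) / n) ((k + 1 : ℕ) / n) := by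
  have hn' : (0 : ℝ) < n := by exact_mod_cast hn
  -- The point 0 is put into each level set so that the suprema are over nonempty sets.
  set S : ℕ → Set ℝ := fun k => {q | q ∈ Icc (0 : ℝ) 1 ∧ (q = 0 ∨ x q ≤ (k : ℝ) / n)} with hS
  have h0 : ∀ k, (0 : ℝ) ∈ S k := fun k => ⟨⟨le_rfl, zero_le_one⟩, Or.inl rfl⟩
  have hbdd : ∀ k, BddAbove (S k) := fun k => ⟨1, fun q hq => hq.1.2⟩
  have hmem : ∀ k, sSup (S k) ∈ Icc (0 : ℝ) 1 := fun k =>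
    ⟨le_csSup (hbdd k) (h0 k), csSup_le ⟨0, h0 k⟩ fun q hq => hq.1.2⟩
  have hmono : Monotone fun k => sSup (S k) := by
    intro k l hkl
    refine csSup_le_csSup (hbdd l) ⟨0, h0 k⟩ fun q hq => ⟨hq.1, hq.2.imp_right fun h => h.trans ?_⟩
    gcongr
  -- The first point is 0 rather than the supremum of S 0, so that the zero set of x belongs to the
  -- first interval.
  refine ⟨fun k => if k = 0 then 0 else sSup (S k), by simp, ?_, ?_, ?_, ?_⟩
  · have h1 : (1 : ℝ) ∈ S n := by
      refine ⟨⟨zero_le_one, le_rfl⟩, Or.inr ?_⟩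
      rw [div_self hn'.ne']
      exact (hx.2 ⟨zero_le_one, le_rfl⟩).2
    simp only [hn.ne', if_false]
    exact le_antisymm (hmem n).2 (le_csSup (hbdd n) h1)
  · intro k l hkl
    rcases Nat.eq_zero_or_pos k with rfl | hk
    · by_cases hl : l = 0
      · simp [hl]
      · simp only [if_true, hl, if_false]
        exact (hmem l).1
    · have hl : 0 < l := hk.trans_le hkl
      simp only [hk.ne', hl.ne', if_false]
      exact hmono hkl
  · intro k
    by_cases hk : k = 0
    · simp [hk]
    · simp only [hk, if_false]
      exact hmem k
  · intro k q hq
    simp only [Nat.succ_ne_zero, if_false] at hq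
    have hq0 : 0 ≤ q := by
      refine le_trans ?_ hq.1.le
      split_ifs
      · exact le_rfl
      · exact (hmem k).1
    have hq1 : q ≤ 1 := hq.2.le.trans (hmem _).2
    constructor
    · by_cases hk : k = 0
      · simp only [hk, Nat.cast_zero, zero_div]
        exact (hx.2 ⟨hq0, hq1⟩).1
      · simp only [hk, if_false] at hq
        by_contra! hlt
        exact absurd (le_csSup (hbdd k) ⟨⟨hq0, hq1⟩, Or.inr hlt.le⟩) (not_le.2 hq.1)
    · obtain ⟨p, hp, hqp⟩ := exists_lt_of_lt_csSup ⟨0, h0 _⟩ hq.2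
      rcases hp.2 with rfl | h
      · linarith
      · exact (hx.1 ⟨hq0, hq1⟩ hp.1 hqp.le).trans h

/-- On the k-th level interval the step takes the upper value (k + 1) / n. This is positive, as the
Cole-Hopf transformation requires, is within 1 / n of x, and lies above x, whence the inequality for
the integral. Going down in q the values only decrease, so a cascade can follow them. -/
lemma exists_stepFlow (β : ℝ) (hx : x ∈ OrderParameter) {n : ℕ} (hn : 0 < n) :
    ∃ X f m I, StepFlow β 0 X f ∧
      (∀ q ∈ Ico (0 : ℝ) 1, X q ∈ Icc (0 : ℝ) 1 ∧ |X q - rightValue x q| ≤ 1 / n) ∧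
      ∫ q in (0 : ℝ)..1, 2 * q * x q ≤ I ∧ Cascade β 0 m I (f 0) := by
  have hn' : (0 : ℝ) < n := by exact_mod_cast hn
  obtain ⟨t, ht0, htn, hmono, hmem, hlev⟩ := exists_levels hx hn
  have key : ∀ k ≤ n, ∃ X f m I, StepFlow β (t k) X f ∧
      (∀ q ∈ Ico (t k) 1, X q ∈ Icc (0 : ℝ) 1 ∧ |X q - rightValue x q| ≤ 1 / n) ∧
      (k : ℝ) / n ≤ m ∧ ∫ q in (t k)..1, 2 * q * x q ≤ I ∧ Cascade β (t k) m I (f (t k)) := by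
    intro k hk
    induction hk using Nat.decreasingInduction with
    | self =>
      rw [htn]
      refine ⟨0, _, 1, 0, stepFlow_one β 0, fun q hq => ?_, (div_self hn'.ne').le, ?_, .base⟩
      · simp at hq
      · simp
    | of_succ k hk ih =>
      obtain ⟨X, f, m, I, hf, hX, hm, hI, hc⟩ := ih
      have hm'pos : 0 < ((k + 1 : ℕ) : ℝ) / n := by positivity
      have hm'1 : ((k + 1 : ℕ) : ℝ) / n ≤ 1 := by
        rw [div_le_one hn']
        exact_mod_cast hk
      have hab := hmono (Nat.le_succ k)
      obtain ⟨f', hf', hc'⟩ := hf.extend (hmem k).1 hab (hc.drop _ hm'pos hm)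
      refine ⟨_, f', _, _, hf', fun q hq => ?_, ?_, ?_, hc'⟩
      · rcases lt_or_ge q (t (k + 1)) with h | h
        · simp only [if_pos h]
          refine ⟨⟨hm'pos.le, hm'1⟩, ?_⟩
          have h1 := rightValue_mem_of_forall hx ⟨(hmem k).1.trans hq.1, hq.2⟩ h
            fun p hp => hlev k p ⟨hq.1.trans_lt hp.1, hp.2⟩
          have h2 : ((k + 1 : ℕ) : ℝ) / n = k / n + 1 / n := by push_cast; ring
          rw [abs_le]
          constructor <;> linarith [h1.1, h1.2]
        · simp only [if_neg (not_lt.2 h)]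
          exact hX q ⟨h, hq.2⟩
      · gcongr
        omega
      · have h1 : (1 : ℝ) ∈ Icc (0 : ℝ) 1 := ⟨zero_le_one, le_rfl⟩
        rw [← intervalIntegral.integral_add_adjacent_intervals
          (intervalIntegrable_mul_order hx (hmem k) (hmem (k + 1)))
          (intervalIntegrable_mul_order hx (hmem (k + 1)) h1), add_comm]
        refine add_le_add hI ?_
        have h2 : ∫ q in (t k)..(t (k + 1)), 2 * q * (((k + 1 : ℕ) : ℝ) / n)
            = ((k + 1 : ℕ) : ℝ) / n * (t (k + 1) ^ 2 - t k ^ 2) := by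
          rw [intervalIntegral.integral_mul_const, intervalIntegral.integral_const_mul, integral_id]
          ring
        rw [← h2]
        refine intervalIntegral.integral_mono_on_of_le_Ioo hab
          (intervalIntegrable_mul_order hx (hmem k) (hmem (k + 1)))
          (Continuous.intervalIntegrable (by fun_prop) _ _) fun q hq => ?_
        exact mul_le_mul_of_nonneg_left (hlev k q hq).2 (by linarith [(hmem k).1, hq.1])
  obtain ⟨X, f, m, I, hf, hX, -, hI, hc⟩ := key 0 (Nat.zero_le n)
  rw [ht0] at hf hX hI hc
  exact ⟨X, f, m, I, hf, hX, hI, hc⟩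

end OrderParameters

/-! ### Existence of the Parisi function -/

section Existence

/-- The mean value theorem gives a point within r of y where the derivative is at most 2 ε / r; the
second derivative controls the change from there to y. -/
lemma abs_deriv_le_of_small {g : ℝ → ℝ} {ε A r : ℝ} (hg : Differentiable ℝ g)
    (hg' : Differentiable ℝ (deriv g)) (h0 : ∀ y, |g y| ≤ ε) (h2 : ∀ y, |deriv (deriv g) y| ≤ A)
    (hr : 0 < r) (y : ℝ) : |deriv g y| ≤ 2 * ε / r + A * r := by
  obtain ⟨c, hc, hc'⟩ := exists_deriv_eq_slope g (lt_add_of_pos_right y hr)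
    hg.continuous.continuousOn hg.differentiableOn
  have h3 := abs_sub_le_of_deriv_le hg' h2 y c
  have h4 : |y - c| ≤ r := by
    rw [abs_le]
    constructor <;> linarith [hc.1, hc.2]
  have hA : 0 ≤ A := (abs_nonneg _).trans (h2 0)
  have h5 : |deriv g c| ≤ 2 * ε / r := by
    rw [hc', add_sub_cancel_left, abs_div, abs_of_pos hr]
    gcongr
    refine (abs_sub _ _).trans ?_
    linarith [h0 (y + r), h0 y]
  calc |deriv g y| = |deriv g c + (deriv g y - deriv g c)| := by ring_nf
    _ ≤ |deriv g c| + |deriv g y - deriv g c| := abs_add_le _ _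
    _ ≤ 2 * ε / r + A * r := add_le_add h5 (h3.trans (mul_le_mul_of_nonneg_left h4 hA))

lemma exists_small_deriv (A : ℝ) (hA : 0 ≤ A) {η : ℝ} (hη : 0 < η) :
    ∃ ε > 0, ∀ g : ℝ → ℝ, Differentiable ℝ g → Differentiable ℝ (deriv g) → (∀ y, |g y| ≤ ε) →
      (∀ y, |deriv (deriv g) y| ≤ A) → ∀ y, |deriv g y| ≤ η := by
  have hr : 0 < η / (2 * (A + 1)) := by positivity
  -- With r = η / (2 (A + 1)) and ε = r η / 4, each of the two terms of the estimate is at most η /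
  -- 2.
  refine ⟨η / (2 * (A + 1)) * η / 4, by positivity, fun g hg hg' h0 h2 y => ?_⟩
  refine (abs_deriv_le_of_small hg hg' h0 h2 hr y).trans ?_
  have h3 : A * (η / (2 * (A + 1))) ≤ η / 2 := by
    rw [mul_div_assoc', div_le_div_iff₀ (by positivity) (by positivity)]
    nlinarith
  have h4 : 2 * (η / (2 * (A + 1)) * η / 4) / (η / (2 * (A + 1))) = η / 2 := by
    field_simp
    ring
  linarith

/-- Smooth slices with the bounds satisfied along the Parisi equation. -/
structure RegularSlice (b : ℝ) (φ : ℝ → ℝ) : Prop where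
  diff : Differentiable ℝ φ
  diff1 : Differentiable ℝ (deriv φ)
  diff2 : Differentiable ℝ (deriv (deriv φ))
  bound1 : ∀ y, |deriv φ y| ≤ b
  bound2 : ∀ y, |deriv (deriv φ) y| ≤ b ^ 2
  bound3 : ∀ y, |deriv (deriv (deriv φ)) y| ≤ 10 * b ^ 3

lemma Cascade.regularSlice {β q m I : ℝ} {φ : ℝ → ℝ} (h : Cascade β q m I φ) :
    RegularSlice |β| φ := by
  obtain ⟨hm, hm1, -, -, hs⟩ := h.facts
  have hp := hs.potential.smooth
  exact ⟨hp.differentiable, hp.deriv.differentiable, hp.deriv.deriv.differentiable, hs.deriv_le,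
    hs.abs_deriv2_le, hs.abs_deriv3_le hm.le hm1⟩

lemma RegularSlice.contDiff {b : ℝ} {φ : ℝ → ℝ} (h : RegularSlice b φ) : ContDiff ℝ 2 φ := by
  rw [show (2 : ℕ∞ω) = 1 + 1 by norm_num, contDiff_succ_iff_deriv]
  refine ⟨h.diff, by simp, ?_⟩
  rw [contDiff_one_iff_deriv]
  exact ⟨h.diff1, h.diff2.continuous⟩

/-- Interpolation is applied twice, to φ - ψ and to its derivative. The first application must reach
the tolerance ε₂ that the second one starts from, whence the minimum. -/
lemma exists_close_derivs (b : ℝ) (hb : 0 ≤ b) {η : ℝ} (hη : 0 < η) :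
    ∃ ε > 0, ∀ φ ψ : ℝ → ℝ, RegularSlice b φ → RegularSlice b ψ → (∀ y, |φ y - ψ y| ≤ ε) →
      ∀ y, |deriv φ y - deriv ψ y| ≤ η ∧ |deriv (deriv φ) y - deriv (deriv ψ) y| ≤ η := by
  obtain ⟨ε₂, hε₂, H2⟩ := exists_small_deriv (20 * b ^ 3) (by positivity) hη
  obtain ⟨ε₁, hε₁, H1⟩ := exists_small_deriv (2 * b ^ 2) (by positivity) (lt_min hη hε₂)
  refine ⟨ε₁, hε₁, fun φ ψ hφ hψ h => ?_⟩
  have d1 : deriv (fun y => φ y - ψ y) = fun y => deriv φ y - deriv ψ y :=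
    funext fun y => ((hφ.diff y).hasDerivAt.sub (hψ.diff y).hasDerivAt).deriv
  have d2 : deriv (fun y => deriv φ y - deriv ψ y)
      = fun y => deriv (deriv φ) y - deriv (deriv ψ) y :=
    funext fun y => ((hφ.diff1 y).hasDerivAt.sub (hψ.diff1 y).hasDerivAt).deriv
  have d3 : deriv (fun y => deriv (deriv φ) y - deriv (deriv ψ) y)
      = fun y => deriv (deriv (deriv φ)) y - deriv (deriv (deriv ψ)) y :=
    funext fun y => ((hφ.diff2 y).hasDerivAt.sub (hψ.diff2 y).hasDerivAt).deriv
  have h1 := H1 (fun y => φ y - ψ y) (hφ.diff.sub hψ.diff) (by rw [d1]; exact hφ.diff1.sub hψ.diff1)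
    h fun y => by
      rw [d1, d2]
      refine (abs_sub _ _).trans ?_
      linarith [hφ.bound2 y, hψ.bound2 y]
  rw [d1] at h1
  have h2 := H2 (fun y => deriv φ y - deriv ψ y) (hφ.diff1.sub hψ.diff1)
    (by rw [d2]; exact hφ.diff2.sub hψ.diff2) (fun y => (h1 y).trans (min_le_right _ _)) fun y => by
      rw [d2, d3]
      refine (abs_sub _ _).trans ?_
      linarith [hφ.bound3 y, hψ.bound3 y]
  rw [d2] at h2
  exact fun y => ⟨(h1 y).trans (min_le_left _ _), h2 y⟩

lemma continuousOn_prod_of_uniform {S : Set ℝ} {h : ℝ → ℝ → ℝ} (hc : ∀ q ∈ S, Continuous (h q))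
    (hu : ∀ q₀ ∈ S, ∀ η > 0, ∀ᶠ q in 𝓝[S] q₀, ∀ y, |h q y - h q₀ y| ≤ η) :
    ContinuousOn (fun p : ℝ × ℝ => h p.1 p.2) (S ×ˢ univ) := by
  rintro ⟨q₀, y₀⟩ ⟨hq₀, -⟩
  rw [ContinuousWithinAt, Metric.tendsto_nhds]
  intro ε hε
  rw [nhdsWithin_prod_eq, nhdsWithin_univ]
  have h1 : ∀ᶠ y in 𝓝 y₀, dist (h q₀ y) (h q₀ y₀) < ε / 2 :=
    Metric.tendsto_nhds.1 ((hc q₀ hq₀).tendsto y₀) _ (half_pos hε)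
  filter_upwards [(hu q₀ hq₀ (ε / 2) (half_pos hε)).prod_mk h1] with p hp
  have h2 : dist (h p.1 p.2) (h q₀ p.2) ≤ ε / 2 := hp.1 p.2
  linarith [dist_triangle (h p.1 p.2) (h q₀ p.2) (h q₀ y₀), hp.2]

variable {β : ℝ} {X : ℝ → ℝ} {f : ℝ → ℝ → ℝ}

lemma StepFlow.regularSlice (h : StepFlow β 0 X f) {q : ℝ} (hq : q ∈ Icc (0 : ℝ) 1) :
    RegularSlice |β| (f q) := by
  obtain ⟨m, I, hc⟩ := h.slice q hq
  exact hc.regularSlice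

/-- The equation bounds the right derivative in q: φ'' and X φ'² are each at most β² in absolute
value, and each enters with the factor 1/2. -/
lemma StepFlow.lipschitz (h : StepFlow β 0 X f) (hX : ∀ q ∈ Ico (0 : ℝ) 1, X q ∈ Icc (0 : ℝ) 1)
    {q p : ℝ} (hq : q ∈ Icc (0 : ℝ) 1) (hp : p ∈ Icc (0 : ℝ) 1) (y : ℝ) :
    |f q y - f p y| ≤ β ^ 2 * |q - p| := by
  wlog hqp : p ≤ q generalizing q p
  · rw [abs_sub_comm, abs_sub_comm q]
    exact this hp hq (le_of_not_ge hqp)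
  rw [abs_of_nonneg (sub_nonneg.2 hqp)]
  refine norm_image_sub_le_of_norm_deriv_right_le_segment
    (f' := fun q => -(1 / 2) * deriv (deriv (f q)) y - 1 / 2 * X q * deriv (f q) y ^ 2)
    ((h.cont y).mono (Icc_subset_Icc hp.1 hq.2))
    (fun s hs => h.rderiv s ⟨hp.1.trans hs.1, hs.2.trans_le hq.2⟩ y) (fun s hs => ?_) q
    ⟨hqp, le_rfl⟩
  have hr := h.regularSlice (q := s) ⟨hp.1.trans hs.1, hs.2.le.trans hq.2⟩
  have hXs := hX s ⟨hp.1.trans hs.1, hs.2.trans_le hq.2⟩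
  have h1 := abs_le.1 (hr.bound2 y)
  have h2 : deriv (f s) y ^ 2 ≤ β ^ 2 := sq_le_sq.2 (hr.bound1 y)
  have h3 : X s * deriv (f s) y ^ 2 ≤ 1 * β ^ 2 :=
    mul_le_mul hXs.2 h2 (sq_nonneg _) zero_le_one
  have h4 : 0 ≤ X s * deriv (f s) y ^ 2 := mul_nonneg hXs.1 (sq_nonneg _)
  rw [sq_abs] at h1
  rw [Real.norm_eq_abs, abs_le]
  constructor <;> linarith [h1.1, h1.2]

lemma StepFlow.continuousOn (h : StepFlow β 0 X f)
    (hX : ∀ q ∈ Ico (0 : ℝ) 1, X q ∈ Icc (0 : ℝ) 1) :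
    ContinuousOn (fun p : ℝ × ℝ => f p.1 p.2) (Icc 0 1 ×ˢ univ) ∧
    ContinuousOn (fun p : ℝ × ℝ => deriv (f p.1) p.2) (Icc 0 1 ×ˢ univ) ∧
    ContinuousOn (fun p : ℝ × ℝ => deriv (deriv (f p.1)) p.2) (Icc 0 1 ×ˢ univ) := by
  have near : ∀ q₀ ∈ Icc (0 : ℝ) 1, ∀ ε > 0, ∀ᶠ q in 𝓝[Icc 0 1] q₀, ∀ y,
      |f q y - f q₀ y| ≤ ε := by
    intro q₀ hq₀ ε hε
    have h1 : Filter.Tendsto (fun q => β ^ 2 * |q - q₀|) (𝓝[Icc 0 1] q₀)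
        (𝓝 (β ^ 2 * |q₀ - q₀|)) :=
      tendsto_nhdsWithin_of_tendsto_nhds (Continuous.tendsto (by fun_prop) q₀)
    rw [sub_self, abs_zero, mul_zero] at h1
    filter_upwards [h1.eventually (gt_mem_nhds hε), self_mem_nhdsWithin] with q hq hq' y
    exact (h.lipschitz hX hq' hq₀ y).trans hq.le
  refine ⟨continuousOn_prod_of_uniform (fun q hq => (h.regularSlice hq).diff.continuous) near,
    continuousOn_prod_of_uniform (h := fun q => deriv (f q))
      (fun q hq => (h.regularSlice hq).diff1.continuous) fun q₀ hq₀ η hη => ?_,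
    continuousOn_prod_of_uniform (h := fun q => deriv (deriv (f q)))
      (fun q hq => (h.regularSlice hq).diff2.continuous) fun q₀ hq₀ η hη => ?_⟩ <;>
  · obtain ⟨ε, hε, H⟩ := exists_close_derivs |β| (abs_nonneg β) hη
    filter_upwards [near q₀ hq₀ ε hε, self_mem_nhdsWithin] with q hq hq' y
    have := H _ _ (h.regularSlice hq') (h.regularSlice hq₀) hq y
    first | exact this.1 | exact this.2

lemma StepFlow.rightSolution (h : StepFlow β 0 X f)
    (hX : ∀ q ∈ Ico (0 : ℝ) 1, X q ∈ Icc (0 : ℝ) 1) : RightSolution |β| X f :=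
  ⟨fun _ hq => (h.regularSlice hq).contDiff, (h.continuousOn hX).1,
    fun _ hq => (h.regularSlice hq).bound1, h.rderiv⟩

lemma exists_tendstoUniformlyOn {α : Type*} {S : Set α} {F : ℕ → α → ℝ}
    (h : ∀ η > 0, ∃ N, ∀ m ≥ N, ∀ n ≥ N, ∀ a ∈ S, |F m a - F n a| ≤ η) :
    ∃ G : α → ℝ, TendstoUniformlyOn F G Filter.atTop S := by
  have h1 : UniformCauchySeqOn F Filter.atTop S := by
    rw [Metric.uniformCauchySeqOn_iff]
    intro ε hε
    obtain ⟨N, hN⟩ := h (ε / 2) (half_pos hε)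
    exact ⟨N, fun m hm n hn a ha => (hN m hm n hn a ha).trans_lt (half_lt_self hε)⟩
  have h2 : ∀ a, ∃ l, a ∈ S → Filter.Tendsto (fun n => F n a) Filter.atTop (𝓝 l) := by
    intro a
    by_cases ha : a ∈ S
    · obtain ⟨l, hl⟩ := cauchySeq_tendsto_of_complete (h1.cauchySeq ha)
      exact ⟨l, fun _ => hl⟩
    · exact ⟨0, fun h => absurd h ha⟩
  choose G hG using h2
  exact ⟨G, h1.tendstoUniformlyOn_of_tendsto fun a ha => hG a ha⟩

/-- Increments over segments are what a mean value inequality estimates, and such estimates pass to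
pointwise limits, unlike derivatives. -/
lemma hasDerivAt_of_segment {F : ℝ → ℝ} {c q : ℝ} (h : ∀ η > 0, ∃ a b, q ∈ Ioo a b ∧
    ∀ s ∈ Ioo a b, ∀ t ∈ Ioo a b, s ≤ t → |F t - F s - c * (t - s)| ≤ η * (t - s)) :
    HasDerivAt F c q := by
  rw [hasDerivAt_iff_isLittleO, Asymptotics.isLittleO_iff]
  intro η hη
  obtain ⟨a, b, hq, H⟩ := h η hη
  filter_upwards [Ioo_mem_nhds hq.1 hq.2] with s hs
  rw [Real.norm_eq_abs, Real.norm_eq_abs, smul_eq_mul]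
  rcases le_total q s with hqs | hqs
  · rw [abs_of_nonneg (sub_nonneg.2 hqs), mul_comm (s - q)]
    exact H q hq s hs hqs
  · rw [abs_of_nonpos (sub_nonpos.2 hqs), abs_sub_comm]
    have := H s hs q hq hqs
    rw [neg_sub]
    convert this using 2
    ring

/-- The Parisi equation has a solution for each order parameter, and its value at `q = 0` is
approximated by the slices of solutions with piecewise constant order parameters. -/
theorem exists_isParisiSolution (β : ℝ) {x : ℝ → ℝ} (hx : x ∈ OrderParameter) :
    ∃ F, IsParisiSolution β x F ∧ ∃ φ : ℕ → ℝ → ℝ,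
      (∀ n, ∃ m I, Cascade β 0 m I (φ n) ∧ ∫ q in (0 : ℝ)..1, 2 * q * x q ≤ I) ∧
      ∀ y, Filter.Tendsto (fun n => φ n y) Filter.atTop (𝓝 (F 0 y)) := by
  choose X f m I hf hX hI hc using fun n : ℕ => exists_stepFlow β hx (Nat.succ_pos n)
  have hX01 : ∀ n, ∀ q ∈ Ico (0 : ℝ) 1, X n q ∈ Icc (0 : ℝ) 1 := fun n q hq => (hX n q hq).1
  have hδ : Filter.Tendsto (fun n : ℕ => 1 / ((Nat.succ n : ℕ) : ℝ)) Filter.atTop (𝓝 0) := by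
    simpa using tendsto_one_div_add_atTop_nhds_zero_nat (𝕜 := ℝ)
  have hδ' : ∀ η > 0, ∃ N : ℕ, ∀ n ≥ N, 1 / ((Nat.succ n : ℕ) : ℝ) < η := fun η hη =>
    Filter.eventually_atTop.1 (hδ.eventually (gt_mem_nhds hη))
  have cauchy0 : ∀ η > 0, ∃ N, ∀ m ≥ N, ∀ n ≥ N, ∀ q ∈ Icc (0 : ℝ) 1, ∀ y,
      |f m q y - f n q y| ≤ η := by
    intro η hη
    -- Each step function is this close to the right limits of x, so two of them differ by at most
    -- twice as much; the comparison multiplies this by |β|² / 2.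
    obtain ⟨N, hN⟩ := hδ' (η / (|β| ^ 2 + 1)) (by positivity)
    refine ⟨N, fun m hm n hn q hq y => ?_⟩
    refine (((hf m).rightSolution (hX01 m)).abs_sub_le ((hf n).rightSolution (hX01 n)) (hX01 m)
      (hX01 n) (ε := 2 * (η / (|β| ^ 2 + 1))) (fun q hq => ?_) ?_ hq y).trans ?_
    · have h1 := abs_le.1 ((hX m q hq).2.trans (hN m hm).le)
      have h2 := abs_le.1 ((hX n q hq).2.trans (hN n hn).le)
      rw [abs_le]
      constructor <;> linarith
    · rw [(hf m).final, (hf n).final]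
    · have h1 : 1 / 2 * |β| ^ 2 * (2 * (η / (|β| ^ 2 + 1))) = η * (|β| ^ 2 / (|β| ^ 2 + 1)) := by
        ring
      rw [h1]
      refine mul_le_of_le_one_right hη.le ?_
      rw [div_le_one (by positivity)]
      linarith
  have cauchy12 : ∀ η > 0, ∃ N, ∀ m ≥ N, ∀ n ≥ N, ∀ q ∈ Icc (0 : ℝ) 1, ∀ y,
      |deriv (f m q) y - deriv (f n q) y| ≤ η ∧
      |deriv (deriv (f m q)) y - deriv (deriv (f n q)) y| ≤ η := by
    intro η hη
    obtain ⟨ε, hε, H⟩ := exists_close_derivs |β| (abs_nonneg β) hη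
    obtain ⟨N, hN⟩ := cauchy0 ε hε
    exact ⟨N, fun m hm n hn q hq => H _ _ ((hf m).regularSlice hq) ((hf n).regularSlice hq)
      (hN m hm n hn q hq)⟩
  set S : Set (ℝ × ℝ) := Icc 0 1 ×ˢ univ with hS
  obtain ⟨F0, hF0⟩ := exists_tendstoUniformlyOn (S := S) (F := fun n p => f n p.1 p.2)
    fun η hη => (cauchy0 η hη).imp fun N hN m hm n hn a ha => hN m hm n hn a.1 ha.1 a.2
  obtain ⟨F1, hF1⟩ := exists_tendstoUniformlyOn (S := S) (F := fun n p => deriv (f n p.1) p.2)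
    fun η hη => (cauchy12 η hη).imp fun N hN m hm n hn a ha => (hN m hm n hn a.1 ha.1 a.2).1
  obtain ⟨F2, hF2⟩ := exists_tendstoUniformlyOn (S := S)
    (F := fun n p => deriv (deriv (f n p.1)) p.2)
    fun η hη => (cauchy12 η hη).imp fun N hN m hm n hn a ha => (hN m hm n hn a.1 ha.1 a.2).2
  have slice : ∀ {q}, q ∈ Icc (0 : ℝ) 1 → ∀ y, (q, y) ∈ S := fun hq y => ⟨hq, mem_univ _⟩
  have c0 : ContinuousOn F0 S := hF0.continuousOn
    (Filter.Frequently.of_forall fun n => ((hf n).continuousOn (hX01 n)).1)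
  have c1 : ContinuousOn F1 S := hF1.continuousOn
    (Filter.Frequently.of_forall fun n => ((hf n).continuousOn (hX01 n)).2.1)
  have c2 : ContinuousOn F2 S := hF2.continuousOn
    (Filter.Frequently.of_forall fun n => ((hf n).continuousOn (hX01 n)).2.2)
  have D1 : ∀ {q}, q ∈ Icc (0 : ℝ) 1 → ∀ y, HasDerivAt (fun y => F0 (q, y)) (F1 (q, y)) y := by
    intro q hq y
    refine hasDerivAt_of_tendstoUniformlyOn (s := univ) (f := fun n y => f n q y)
      (g := fun y => F0 (q, y)) (g' := fun y => F1 (q, y))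
      (f' := fun n y => deriv (f n q) y) (l := Filter.atTop) isOpen_univ ?_
      (Filter.Eventually.of_forall fun n y _ => (((hf n).regularSlice hq).diff y).hasDerivAt)
      (fun y _ => hF0.tendsto_at (slice hq y)) (mem_univ y)
    exact (hF1.comp (fun y => (q, y))).mono fun y _ => slice hq y
  have D2 : ∀ {q}, q ∈ Icc (0 : ℝ) 1 → ∀ y, HasDerivAt (fun y => F1 (q, y)) (F2 (q, y)) y := by
    intro q hq y
    refine hasDerivAt_of_tendstoUniformlyOn (s := univ) (f := fun n y => deriv (f n q) y)
      (g := fun y => F1 (q, y)) (g' := fun y => F2 (q, y))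
      (f' := fun n y => deriv (deriv (f n q)) y) (l := Filter.atTop) isOpen_univ ?_
      (Filter.Eventually.of_forall fun n y _ => (((hf n).regularSlice hq).diff1 y).hasDerivAt)
      (fun y _ => hF1.tendsto_at (slice hq y)) (mem_univ y)
    exact (hF2.comp (fun y => (q, y))).mono fun y _ => slice hq y
  have E1 : ∀ {q}, q ∈ Icc (0 : ℝ) 1 → deriv (fun y => F0 (q, y)) = fun y => F1 (q, y) :=
    fun hq => funext fun y => (D1 hq y).deriv
  have E2 : ∀ {q}, q ∈ Icc (0 : ℝ) 1 → deriv (fun y => F1 (q, y)) = fun y => F2 (q, y) :=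
    fun hq => funext fun y => (D2 hq y).deriv
  refine ⟨fun q y => F0 (q, y), ⟨fun q hq => ?_, c0, ?_, ?_, ⟨|β|, fun q hq y => ?_⟩,
    fun q hq hcont y => ?_, fun y => ?_⟩, fun n => f n 0, fun n => ⟨m n, I n, hc n, hI n⟩,
    fun y => hF0.tendsto_at (slice ⟨le_rfl, zero_le_one⟩ y)⟩
  · rw [show (2 : ℕ∞ω) = 1 + 1 by norm_num, contDiff_succ_iff_deriv]
    refine ⟨fun y => (D1 hq y).differentiableAt, by simp, ?_⟩
    rw [E1 hq, contDiff_one_iff_deriv, E2 hq]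
    exact ⟨fun y => (D2 hq y).differentiableAt,
      continuousOn_univ.1 (c2.comp (by fun_prop) fun y _ => slice hq y)⟩
  · exact c1.congr fun p hp => congrFun (E1 hp.1) p.2
  · refine c2.congr fun p hp => ?_
    simp only [E1 hp.1, E2 hp.1]
  · rw [E1 hq]
    exact le_of_tendsto (hF1.tendsto_at (slice hq y)).abs
      (Filter.Eventually.of_forall fun n => ((hf n).regularSlice hq).bound1 y)
  · have hqI : q ∈ Icc (0 : ℝ) 1 := Ioo_subset_Icc_self hq
    have key : HasDerivAt (fun s => F0 (s, y))
        (-(1 / 2) * F2 (q, y) - 1 / 2 * x q * F1 (q, y) ^ 2) q := by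
      -- Where x is continuous, ∂_y² f, ∂_y f and the step value stay near their limits P at q, on a
      -- fixed interval around q and for all large n. The right derivatives of the approximations
      -- are then within η of `L P`, and the resulting estimate of increments passes to the limit.
      refine hasDerivAt_of_segment fun η hη => ?_
      set P : ℝ × ℝ × ℝ := (F2 (q, y), F1 (q, y), x q) with hP
      set L : ℝ × ℝ × ℝ → ℝ := fun p => -(1 / 2) * p.1 - 1 / 2 * p.2.2 * p.2.1 ^ 2 with hL
      have hLc : Continuous L := by fun_prop
      obtain ⟨ρ, hρ, hLρ⟩ := Metric.continuous_iff.1 hLc P η hη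
      have cq : ∀ {G : ℝ × ℝ → ℝ}, ContinuousOn G S → ∀ᶠ s in 𝓝 q,
          dist (G (s, y)) (G (q, y)) < ρ / 2 := by
        intro G hG
        have h1 : ContinuousOn (fun s => G (s, y)) (Ioo 0 1) :=
          hG.comp (by fun_prop) fun s hs => slice (Ioo_subset_Icc_self hs) y
        exact Metric.tendsto_nhds.1 (h1.continuousAt (Ioo_mem_nhds hq.1 hq.2)) _ (half_pos hρ)
      have hx' := Metric.tendsto_nhds.1 (tendsto_rightValue_of_continuousAt hx hq hcont) _
        (half_pos hρ)
      obtain ⟨a, b, hab, hsub⟩ := mem_nhds_iff_exists_Ioo_subset.1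
        (((cq c1).and (cq c2)).and (hx'.and (Ioo_mem_nhds hq.1 hq.2)))
      refine ⟨a, b, hab, fun s hs t ht hst => ?_⟩
      have hn1 := Metric.tendstoUniformlyOn_iff.1 hF1 (ρ / 2) (half_pos hρ)
      have hn2 := Metric.tendstoUniformlyOn_iff.1 hF2 (ρ / 2) (half_pos hρ)
      have hn3 := hδ.eventually (gt_mem_nhds (half_pos hρ))
      have hev : ∀ᶠ n in Filter.atTop, |f n t y - f n s y - L P * (t - s)| ≤ η * (t - s) := by
        filter_upwards [hn1, hn2, hn3] with n h1 h2 h3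
        have hst01 : ∀ r ∈ Icc s t, r ∈ Ioo a b := fun r hr =>
          ⟨hs.1.trans_le hr.1, hr.2.trans_lt ht.2⟩
        have h4 := norm_image_sub_le_of_norm_deriv_right_le_segment (a := s) (b := t)
          (f := fun r => f n r y - L P * r)
          (f' := fun r => L (deriv (deriv (f n r)) y, deriv (f n r) y, X n r) - L P * 1) (C := η)
          ?_ (fun r hr => ?_) (fun r hr => ?_) t ⟨hst, le_rfl⟩
        · rw [Real.norm_eq_abs] at h4
          refine le_of_eq_of_le (congrArg _ ?_) h4
          ring
        · refine (((hf n).cont y).mono fun r hr => ?_).sub (by fun_prop)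
          exact Ioo_subset_Icc_self (hsub (hst01 r hr)).2.2
        · have hr' := (hsub (hst01 r ⟨hr.1, hr.2.le⟩)).2.2
          exact ((hf n).rderiv r ⟨hr'.1.le, hr'.2⟩ y).sub
            (((hasDerivAt_id r).const_mul (L P)).hasDerivWithinAt)
        · have hrs := hsub (hst01 r ⟨hr.1, hr.2.le⟩)
          have hr' := hrs.2.2
          have hrI : r ∈ Icc (0 : ℝ) 1 := Ioo_subset_Icc_self hr'
          have g1 := h1 (r, y) (slice hrI y)
          have g2 := h2 (r, y) (slice hrI y)
          have g3 := (hX n r ⟨hr'.1.le, hr'.2⟩).2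
          have k1 := hrs.1.1
          have k2 := hrs.1.2
          have k3 := hrs.2.1
          have : dist (deriv (deriv (f n r)) y, deriv (f n r) y, X n r) P < ρ := by
            simp only [Prod.dist_eq, hP, max_lt_iff]
            simp only [Real.dist_eq, abs_lt] at *
            rw [abs_le] at g3
            refine ⟨⟨?_, ?_⟩, ⟨?_, ?_⟩, ⟨?_, ?_⟩⟩ <;> linarith
          have := hLρ _ this
          rw [mul_one]
          exact this.le
      have hlim : Filter.Tendsto (fun n => |f n t y - f n s y - L P * (t - s)|) Filter.atTop
          (𝓝 |F0 (t, y) - F0 (s, y) - L P * (t - s)|) := by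
        have ht' := Ioo_subset_Icc_self (hsub ht).2.2
        have hs' := Ioo_subset_Icc_self (hsub hs).2.2
        exact (((hF0.tendsto_at (slice ht' y)).sub (hF0.tendsto_at (slice hs' y))).sub_const _).abs
      exact le_of_tendsto hlim hev
    refine ⟨key.differentiableAt, ?_⟩
    rw [key.deriv, E1 hqI, E2 hqI]
    ring
  · have h1 := hF0.tendsto_at (slice (⟨zero_le_one, le_rfl⟩ : (1 : ℝ) ∈ Icc (0 : ℝ) 1) y)
    refine tendsto_nhds_unique h1 ?_
    simp only [(hf _).final]
    exact tendsto_const_nhds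

end Existence

/-! ### Uniqueness, and reduction of the bound to cascades -/

section Uniqueness

variable {β : ℝ} {x : ℝ → ℝ} {f : ℝ → ℝ → ℝ}

/-- The equation may fail at countably many q only, so f is the integral of the remaining terms.
That integrand has right limits, which gives a right derivative at every q < 1, jumps of x and q = 0
included, and makes the maximum principle applicable. -/
lemma IsParisiSolution.hasDerivWithinAt (h : IsParisiSolution β x f) (hx : x ∈ OrderParameter)
    {q : ℝ} (hq : q ∈ Ico (0 : ℝ) 1) (y : ℝ) : HasDerivWithinAt (fun p => f p y)
      (-(1 / 2) * deriv (deriv (f q)) y - 1 / 2 * rightValue x q * deriv (f q) y ^ 2)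
      (Ici q) q := by
  set G : ℝ → ℝ := fun t => -(1 / 2) * deriv (deriv (f t)) y - 1 / 2 * x t * deriv (f t) y ^ 2
    with hG
  have h01 : ∀ {s t : ℝ}, s ∈ Icc (0 : ℝ) 1 → t ∈ Icc (0 : ℝ) 1 → uIcc s t ⊆ Icc 0 1 :=
    fun hs ht => uIcc_subset_Icc hs ht
  have c0 : ContinuousOn (fun t => f t y) (Icc 0 1) :=
    h.continuousOn.comp (f := fun t : ℝ => (t, y)) (by fun_prop) fun t ht => ⟨ht, mem_univ _⟩
  have c1 : ContinuousOn (fun t => deriv (f t) y) (Icc 0 1) :=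
    h.continuousOn_dy.comp (f := fun t : ℝ => (t, y)) (by fun_prop) fun t ht => ⟨ht, mem_univ _⟩
  have c2 : ContinuousOn (fun t => deriv (deriv (f t)) y) (Icc 0 1) :=
    h.continuousOn_dyy.comp (f := fun t : ℝ => (t, y)) (by fun_prop) fun t ht => ⟨ht, mem_univ _⟩
  have hint : ∀ {s t : ℝ}, s ∈ Icc (0 : ℝ) 1 → t ∈ Icc (0 : ℝ) 1 →
      IntervalIntegrable G volume s t := by
    intro s t hs ht
    refine (ContinuousOn.intervalIntegrable ((c2.mono (h01 hs ht)).const_mul _)).sub ?_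
    exact ((intervalIntegrable_order hx hs ht).const_mul _).mul_continuousOn
      ((c1.mono (h01 hs ht)).pow 2)
  have hq' : q ∈ Icc (0 : ℝ) 1 := ⟨hq.1, hq.2.le⟩
  have ftc : ∀ s ∈ Icc q 1, ∫ t in q..s, G t = f s y - f q y := by
    intro s hs
    have hs' : s ∈ Icc (0 : ℝ) 1 := ⟨hq.1.trans hs.1, hs.2⟩
    refine integral_eq_of_hasDerivAt_off_countable (fun t => f t y) G (countable_not_continuousAt hx)
      (c0.mono (h01 hq' hs')) (fun t ht => ?_) (hint hq' hs')
    rw [min_eq_left hs.1, max_eq_right hs.1] at ht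
    have ht01 : t ∈ Ioo (0 : ℝ) 1 := ⟨hq.1.trans_lt ht.1.1, ht.1.2.trans_le hs.2⟩
    have htc : ContinuousAt x t := by
      by_contra hc
      exact ht.2 ⟨ht01, hc⟩
    obtain ⟨hd, he⟩ := h.equation t ht01 htc y
    refine hd.hasDerivAt.congr_deriv ?_
    simp only [hG]
    linarith
  have hq1 : Ioo q 1 ∈ 𝓝[>] q := Ioo_mem_nhdsGT hq.2
  have hright : ∀ {g : ℝ → ℝ}, ContinuousOn g (Icc 0 1) → Filter.Tendsto g (𝓝[>] q) (𝓝 (g q)) := by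
    intro g hg
    refine (hg q hq').mono_left (nhdsWithin_le_of_mem ?_)
    exact Filter.mem_of_superset hq1 fun t ht => ⟨hq.1.trans ht.1.le, ht.2.le⟩
  have hlim : Filter.Tendsto G (𝓝[>] q) (𝓝 (-(1 / 2) * deriv (deriv (f q)) y
      - 1 / 2 * rightValue x q * deriv (f q) y ^ 2)) :=
    ((hright c2).const_mul _).sub ((((tendsto_rightValue hx hq).const_mul _)).mul
      ((hright c1).pow 2))
  have hmeas : StronglyMeasurableAtFilter G (𝓝[>] q) volume := by
    refine ⟨Ioc q 1, Ioc_mem_nhdsGT hq.2, ?_⟩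
    exact (hint hq' ⟨zero_le_one, le_rfl⟩).1.aestronglyMeasurable
  have hder := intervalIntegral.integral_hasDerivWithinAt_of_tendsto_ae_right
    (s := Ici q) (t := Ioi q) (hint hq' hq') hmeas (hlim.mono_left inf_le_left)
  refine (hder.add_const (f q y)).congr_of_eventuallyEq ?_ (by simp)
  have : ∀ᶠ s in 𝓝[≥] q, s < 1 := mem_nhdsWithin_of_mem_nhds (gt_mem_nhds hq.2)
  filter_upwards [this, self_mem_nhdsWithin] with s hs hs'
  rw [ftc s ⟨hs', hs.le⟩]
  ring

lemma IsParisiSolution.rightSolution (h : IsParisiSolution β x f) (hx : x ∈ OrderParameter) :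
    ∃ C, ∀ D, C ≤ D → RightSolution D (rightValue x) f := by
  obtain ⟨C, hC⟩ := h.bounded_dy
  exact ⟨C, fun D hD => ⟨h.contDiff, h.continuousOn, fun q hq y => (hC q hq y).trans hD,
    fun q hq y => h.hasDerivWithinAt hx hq y⟩⟩

theorem IsParisiSolution.unique {g : ℝ → ℝ → ℝ} (hf : IsParisiSolution β x f)
    (hg : IsParisiSolution β x g) (hx : x ∈ OrderParameter) {q : ℝ} (hq : q ∈ Icc (0 : ℝ) 1)
    (y : ℝ) : f q y = g q y := by
  obtain ⟨C, hC⟩ := hf.rightSolution hx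
  obtain ⟨D, hD⟩ := hg.rightSolution hx
  have h1 := (hC (max C D) (le_max_left _ _)).abs_sub_le (hD (max C D) (le_max_right _ _))
    (fun q _ => rightValue_mem hx q) (fun q _ => rightValue_mem hx q) (ε := 0)
    (fun q _ => by simp) (funext fun y => by rw [hf.final, hg.final]) hq y
  rw [mul_zero] at h1
  exact sub_eq_zero.1 (abs_nonpos_iff.1 h1)

lemma isParisiSolution_parisiFunction (β : ℝ) (hx : x ∈ OrderParameter) :
    IsParisiSolution β x (parisiFunction β x) :=
  Classical.epsilon_spec (let ⟨F, hF, _⟩ := exists_isParisiSolution β hx; ⟨F, hF⟩)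

/-- An upper bound by all the discrete trial functions is an upper bound by the trial function. -/
lemma le_trial_of_forall_cascade {β h c : ℝ} (hx : x ∈ OrderParameter)
    (H : ∀ m I φ, Cascade β 0 m I φ → c ≤ Real.log 2 + φ h - β ^ 2 / 4 * I) : c ≤ trial β h x := by
  obtain ⟨F, hF, φ, hφ, hlim⟩ := exists_isParisiSolution β hx
  have h0 : F 0 h = parisiFunction β x 0 h :=
    hF.unique (isParisiSolution_parisiFunction β hx) hx ⟨le_rfl, zero_le_one⟩ h
  have h1 : ∫ q in (0 : ℝ)..1, 2 * q * x q = 2 * ∫ q in (0 : ℝ)..1, q * x q := by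
    simp only [mul_assoc]
    rw [intervalIntegral.integral_const_mul]
  have h2 : Filter.Tendsto (fun n => Real.log 2 + φ n h - β ^ 2 / 2 * ∫ q in (0 : ℝ)..1, q * x q)
      Filter.atTop (𝓝 (trial β h x)) := by
    rw [trial, ← h0]
    exact ((hlim h).const_add _).sub_const _
  refine ge_of_tendsto h2 (Filter.Eventually.of_forall fun n => ?_)
  -- I carries the factor -β² / 4, so the lower bound for I suffices and its convergence is not
  -- needed.
  obtain ⟨m, I, hc, hI⟩ := hφ n
  refine (H m I _ hc).trans ?_
  rw [h1] at hI
  nlinarith [sq_nonneg β]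

end Uniqueness

/-! ### Interpolating free energies and the sign of the overlap term -/

section Interpolation

variable {N : ℕ} {ι κ : Type} [Fintype ι] [Fintype κ]

/-- The space of energies, one for each configuration. -/
abbrev Energy (N : ℕ) : Type := Config N → ℝ

/-- The free energy of the energies `z`. -/
def logSum (z : Energy N) : ℝ := Real.log (∑ σ, Real.exp (z σ))

/-- The energies `β σᵢ` of a unit field acting on the spin at the site `i`. -/
def spinField (β : ℝ) (i : Fin N) : Energy N := fun σ => β * spin σ i

/-- The properties of `logSum` shared by the interpolating functions of `(θ, z)`. -/
structure FreeEnergy (F : ℝ × Energy N → ℝ) : Prop where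
  potential : Potential F
  mono : ∀ θ z z', z ≤ z' → F (θ, z) ≤ F (θ, z')
  shift : ∀ θ z c, F (θ, z + fun _ => c) = F (θ, z) + c

lemma sum_exp_pos (z : Energy N) : 0 < ∑ σ, Real.exp (z σ) :=
  Finset.sum_pos (fun _ _ => Real.exp_pos _) Finset.univ_nonempty

lemma exp_logSum (z : Energy N) : Real.exp (logSum z) = ∑ σ, Real.exp (z σ) :=
  Real.exp_log (sum_exp_pos z)

/-- The value at `σ` of the energy. -/
def evalEnergy (σ : Config N) : ℝ × Energy N →L[ℝ] ℝ :=
  (ContinuousLinearMap.proj σ).comp (ContinuousLinearMap.snd ℝ ℝ (Energy N))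

lemma expSmooth_exp_eval (σ : Config N) :
    ExpSmooth (fun p : ℝ × Energy N => Real.exp (p.2 σ)) :=
  expSmooth_exp.comp (expSmooth_clm (evalEnergy σ)) (linGrowth_clm (evalEnergy σ))

lemma freeEnergy_logSum : FreeEnergy (fun p : ℝ × Energy N => logSum p.2) := by
  have h1 : ExpSmooth (fun p : ℝ × Energy N => ∑ σ, Real.exp (p.2 σ)) :=
    ExpSmooth.sum _ fun σ _ => expSmooth_exp_eval σ
  have h2 := h1.log (by
    refine ⟨1, zero_le_one, fun p => ?_⟩
    rw [norm_inv, Real.norm_of_nonneg (sum_exp_pos p.2).le]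
    refine (inv_anti₀ (Real.exp_pos (p.2 1)) (Finset.single_le_sum
      (f := fun σ => Real.exp (p.2 σ)) (fun σ _ => Real.exp_nonneg _) (Finset.mem_univ 1))).trans ?_
    rw [← Real.exp_neg]
    refine Real.exp_le_exp.2 ((neg_le_abs _).trans ?_)
    have h3 : ‖p.2 1‖ ≤ ‖p.2‖ := norm_le_pi_norm p.2 1
    have h4 : ‖p.2‖ ≤ ‖p‖ := norm_snd_le p
    rw [Real.norm_eq_abs] at h3
    linarith) fun p => sum_exp_pos p.2
  refine ⟨⟨h2.1, h2.2⟩, fun θ z z' h => ?_, fun θ z c => ?_⟩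
  · refine Real.log_le_log (sum_exp_pos z) (Finset.sum_le_sum fun σ _ => ?_)
    exact Real.exp_le_exp.2 (h σ)
  · simp only [logSum, Pi.add_apply, Real.exp_add, ← Finset.sum_mul]
    rw [Real.log_mul (sum_exp_pos z).ne' (Real.exp_pos c).ne', Real.log_exp]

lemma step_point (a : ℝ → ℝ) (w : Energy N) (θ : ℝ) (z : Energy N) (r : ℝ) :
    ((θ, z) : ℝ × Energy N) + (r * a (θ, z).1) • ((0 : ℝ), w) = (θ, z + (r * a θ) • w) := by
  simp

lemma FreeEnergy.coleHopf {G : ℝ × Energy N → ℝ} (hG : FreeEnergy G) {a : ℝ → ℝ}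
    (ha : Amplitude (fun p : ℝ × Energy N => a p.1)) {m : ℝ} (hm : 0 < m) (w : Energy N) :
    FreeEnergy (coleHopf m (fun p : ℝ × Energy N => a p.1) (0, w) G) := by
  refine ⟨hG.potential.coleHopf ha m _, fun θ z z' h => ?_, fun θ z c => ?_⟩
  · refine coleHopf_mono hG.potential hG.potential hm fun r => ?_
    rw [step_point, step_point]
    exact hG.mono _ _ _ (add_le_add_left h _)
  · rw [← coleHopf_add_const hG.potential hm]
    simp only [SpinGlass.coleHopf, gaussAvg, step_point]
    congr 3
    ext ξ
    rw [← hG.shift, add_right_comm]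

/-- The combination of the derivatives of an interpolating function controlled by the
interpolation. -/
def flowDeriv (u : κ → Energy N) (m : ℝ) (ρ : κ → ℝ) (F : ℝ × Energy N → ℝ)
    (p : ℝ × Energy N) : ℝ :=
  dirDeriv (1, 0) F p + Real.sin p.1 * Real.cos p.1 * ∑ k, ρ k *
    (dirDeriv (0, u k) (dirDeriv (0, u k) F) p + m * dirDeriv (0, u k) F p ^ 2)

/-- The factor m exp(m F) makes the nonlinear expression linear in exp(m F), so that it can be
compared across a Gaussian average. -/
lemma flowDeriv_mul_exp {F : ℝ × Energy N → ℝ} (hF : Potential F) (u : κ → Energy N) (m : ℝ)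
    (ρ : κ → ℝ) (p : ℝ × Energy N) :
    m * flowDeriv u m ρ F p * Real.exp (m * F p)
      = dirDeriv (1, 0) (fun p => Real.exp (m * F p)) p + ∑ k, Real.sin p.1 * Real.cos p.1 * ρ k *
        dirDeriv (0, u k) (dirDeriv (0, u k) (fun p => Real.exp (m * F p))) p := by
  simp_rw [fun k => congrFun (hF.dirDeriv_dirDeriv_exp m (0, u k)) p]
  rw [hF.dirDeriv_exp]
  simp only [flowDeriv, mul_add, add_mul, Finset.mul_sum, Finset.sum_mul]
  congr 1
  refine Finset.sum_congr rfl fun k _ => ?_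
  ring

/-- For exp(m F), the average of exp(m G), the derivative in θ yields an extra a' a times the second
derivative along u j. By the assumption on a' a this adds d to the j-th weight inside the average.
There `H` bounds the integrand by K m exp(m G), whose average is K m exp(m F). -/
lemma flowDeriv_coleHopf_le [DecidableEq κ] {G : ℝ × Energy N → ℝ} (hG : FreeEnergy G)
    {a a' : ℝ → ℝ} (ha : Amplitude (fun p : ℝ × Energy N => a p.1))
    (hd : ∀ θ, HasDerivAt a (a' θ) θ) {d : ℝ} (hda : ∀ θ, a' θ * a θ = Real.sin θ * Real.cos θ * d)
    {m : ℝ} (hm : 0 < m) (u : κ → Energy N) (ρ : κ → ℝ) (j : κ) {K θ : ℝ}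
    (H : ∀ z, flowDeriv u m (Function.update ρ j (ρ j + d)) G (θ, z) ≤ K) (z : Energy N) :
    flowDeriv u m ρ (coleHopf m (fun p : ℝ × Energy N => a p.1) (0, u j) G) (θ, z) ≤ K := by
  set s : ℝ × Energy N → ℝ := fun p => a p.1 with hs
  set v : ℝ × Energy N := (0, u j) with hv
  set F := coleHopf m s v G with hF
  have hFp : Potential F := hG.potential.coleHopf ha m v
  set g : ℝ × Energy N → ℝ := fun p => Real.exp (m * G p) with hg
  have hgs : ExpSmooth g := hG.potential.exp m
  have e0 : (fun p => Real.exp (m * F p)) = gaussAvg s v g :=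
    funext fun p => hG.potential.exp_coleHopf hm s v p
  have hsd : ∀ b : ℝ × Energy N, dirDeriv b s (θ, z) = a' θ * b.1 := by
    intro b
    have h1 : HasFDerivAt s _ (θ, z) := (hd θ).hasFDerivAt.comp (θ, z)
      (hasFDerivAt_fst (𝕜 := ℝ) (E := ℝ) (F := Energy N))
    rw [dirDeriv, h1.fderiv]
    simp [mul_comm]
  have hsd' : ∀ (w : Energy N) p, dirDeriv (0, w) s p = 0 := by
    intro w p
    have h1 : HasFDerivAt s _ p := (hd p.1).hasFDerivAt.comp p
      (hasFDerivAt_fst (𝕜 := ℝ) (E := ℝ) (F := Energy N))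
    rw [dirDeriv, h1.fderiv]
    simp
  have comm : ∀ (w : Energy N) {f : ℝ × Energy N → ℝ}, ExpSmooth f →
      dirDeriv (0, w) (gaussAvg s v f) = gaussAvg s v (dirDeriv (0, w) f) := by
    intro w f hf
    ext p
    rw [dirDeriv_gaussAvg hf ha, hsd', zero_mul, zero_mul, add_zero]
  have hE : 0 < m * Real.exp (m * F (θ, z)) := by positivity
  refine le_of_mul_le_mul_right ?_ hE
  have h1 := flowDeriv_mul_exp hFp u m ρ (θ, z)
  rw [e0, dirDeriv_gaussAvg hgs ha, hsd] at h1
  have h2 : ∀ k, dirDeriv (0, u k) (dirDeriv (0, u k) (gaussAvg s v g))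
      = gaussAvg s v (dirDeriv (0, u k) (dirDeriv (0, u k) g)) := fun k => by
    rw [comm _ hgs, comm _ (hgs.dirDeriv _)]
  simp only [h2] at h1
  set sc := Real.sin θ * Real.cos θ with hsc
  have hD : ∀ k, ExpSmooth (dirDeriv (0, u k) (dirDeriv (0, u k) g)) := fun k =>
    (hgs.dirDeriv _).dirDeriv _
  set ρ' := Function.update ρ j (ρ j + d) with hρ'
  have h3 : gaussAvg s v (fun p => dirDeriv (1, 0) g p + ∑ k, sc * ρ' k *
        dirDeriv (0, u k) (dirDeriv (0, u k) g) p) (θ, z)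
      = gaussAvg s v (dirDeriv (1, 0) g) (θ, z)
        + ∑ k, sc * ρ' k * gaussAvg s v (dirDeriv (0, u k) (dirDeriv (0, u k) g)) (θ, z) := by
    rw [gaussAvg_add (hgs.dirDeriv _) (ExpSmooth.sum _ fun k _ => (hD k).const_mul _),
      gaussAvg_sum _ fun k _ => (hD k).const_mul _]
    simp only [gaussAvg_const_mul]
  have h4 : ∑ k, sc * ρ' k * gaussAvg s v (dirDeriv (0, u k) (dirDeriv (0, u k) g)) (θ, z)
      = ∑ k, sc * ρ k * gaussAvg s v (dirDeriv (0, u k) (dirDeriv (0, u k) g)) (θ, z)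
        + sc * d * gaussAvg s v (dirDeriv (0, u j) (dirDeriv (0, u j) g)) (θ, z) := by
    rw [← Finset.add_sum_erase _ _ (Finset.mem_univ j), ← Finset.add_sum_erase (a := j)
      Finset.univ (fun k => sc * ρ k * _) (Finset.mem_univ j)]
    have h5 : ∀ k ∈ Finset.univ.erase j, sc * ρ' k *
        gaussAvg s v (dirDeriv (0, u k) (dirDeriv (0, u k) g)) (θ, z)
        = sc * ρ k * gaussAvg s v (dirDeriv (0, u k) (dirDeriv (0, u k) g)) (θ, z) := by
      intro k hk
      rw [hρ', Function.update_of_ne (Finset.ne_of_mem_erase hk)]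
    rw [Finset.sum_congr rfl h5, hρ', Function.update_self]
    ring
  have h6 : gaussAvg s v (fun p => dirDeriv (1, 0) g p + ∑ k, sc * ρ' k *
        dirDeriv (0, u k) (dirDeriv (0, u k) g) p) (θ, z)
      ≤ gaussAvg s v (fun p => K * m * g p) (θ, z) := by
    refine gaussAvg_mono_line ((hgs.dirDeriv _).add (ExpSmooth.sum _ fun k _ =>
      (hD k).const_mul _)) (hgs.const_mul _) s v _ fun r => ?_
    have h7 : (θ, z) + r • v = (θ, z + r • u j) := by simp [hv]
    rw [h7]
    have h8 := flowDeriv_mul_exp hG.potential u m ρ' (θ, z + r • u j)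
    rw [← h8]
    have h9 := mul_le_mul_of_nonneg_right (H (z + r • u j))
      (by positivity : 0 ≤ m * g (θ, z + r • u j))
    linarith
  rw [gaussAvg_const_mul, ← congrFun e0 (θ, z), h3, h4] at h6
  have h10 : s (θ, z) = a θ := rfl
  have h11 : a' θ * ((1 : ℝ), (0 : Energy N)).1 * s (θ, z) = sc * d := by
    rw [h10, mul_one, hda]
  rw [h11] at h1
  linarith

lemma amplitude_sin_cos (c₁ c₂ : ℝ) :
    Amplitude (fun p : ℝ × Energy N => c₁ * Real.sin p.1 + c₂ * Real.cos p.1) := by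
  have h1 : ExpSmooth Real.sin := by
    intro n
    refine ⟨Real.contDiff_sin.of_le le_top, fun i _ => expGrowth_of_bounded 1 fun x => ?_⟩
    rw [norm_iteratedFDeriv_eq_norm_iteratedDeriv]
    exact Real.abs_iteratedDeriv_sin_le_one i x
  have h2 : ExpSmooth Real.cos := by
    intro n
    refine ⟨Real.contDiff_cos.of_le le_top, fun i _ => expGrowth_of_bounded 1 fun x => ?_⟩
    rw [norm_iteratedFDeriv_eq_norm_iteratedDeriv]
    exact Real.abs_iteratedDeriv_cos_le_one i x
  have hfst := expSmooth_clm (ContinuousLinearMap.fst ℝ ℝ (Energy N))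
  have hfst' := linGrowth_clm (ContinuousLinearMap.fst ℝ ℝ (Energy N))
  refine ⟨((h1.comp hfst hfst').const_mul c₁).add ((h2.comp hfst hfst').const_mul c₂),
    |c₁| + |c₂|, fun p => (abs_add_le _ _).trans ?_⟩
  rw [abs_mul, abs_mul]
  exact add_le_add (mul_le_of_le_one_right (abs_nonneg _) (Real.abs_sin_le_one _))
    (mul_le_of_le_one_right (abs_nonneg _) (Real.abs_cos_le_one _))

lemma dirDeriv_eq_sum {F : ℝ × Energy N → ℝ} (w : Energy N) (p : ℝ × Energy N) :
    dirDeriv (0, w) F p = ∑ σ, w σ * dirDeriv (0, Pi.single σ 1) F p := by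
  have h1 : ((0 : ℝ), w) = ∑ σ, w σ • ((0 : ℝ), (Pi.single σ 1 : Energy N)) := by
    ext τ
    · simp [Prod.fst_sum]
    · simp [Prod.snd_sum, Finset.sum_apply, Pi.single_apply]
  rw [dirDeriv, h1, map_sum]
  simp only [map_smul, smul_eq_mul, dirDeriv]

/-- Together with `FreeEnergy.gibbs_sum`, monotonicity and equivariance under constants make the
derivatives in the single energies a probability weight on the configurations. Nothing more about
the layers enters the sign argument. -/
lemma FreeEnergy.gibbs_nonneg {F : ℝ × Energy N → ℝ} (hF : FreeEnergy F) (σ : Config N)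
    (p : ℝ × Energy N) : 0 ≤ dirDeriv (0, Pi.single σ 1) F p := by
  have h1 : HasDerivAt (fun r : ℝ => p + r • ((0 : ℝ), (Pi.single σ 1 : Energy N)))
      ((1 : ℝ) • ((0 : ℝ), (Pi.single σ 1 : Energy N))) 0 :=
    ((hasDerivAt_id (0 : ℝ)).smul_const _).const_add p
  have h2 := (hF.potential.smooth.differentiable
    (p + (0 : ℝ) • ((0 : ℝ), (Pi.single σ 1 : Energy N)))).hasFDerivAt.comp_hasDerivAt 0 h1
  have h3 : Monotone (F ∘ fun r : ℝ => p + r • ((0 : ℝ), (Pi.single σ 1 : Energy N))) := by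
    intro r t hrt
    have h4 : ∀ r : ℝ, p + r • ((0 : ℝ), (Pi.single σ 1 : Energy N))
        = (p.1, p.2 + r • Pi.single σ 1) := fun r => by ext <;> simp
    simp only [Function.comp_apply, h4]
    refine hF.mono _ _ _ (add_le_add_right ?_ _)
    refine smul_le_smul_of_nonneg_right hrt ?_
    exact Pi.single_nonneg.2 zero_le_one
  have h5 := h3.deriv_nonneg (x := 0)
  rw [h2.deriv] at h5
  simpa [dirDeriv] using h5

lemma FreeEnergy.gibbs_sum {F : ℝ × Energy N → ℝ} (hF : FreeEnergy F) (p : ℝ × Energy N) :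
    ∑ σ, dirDeriv (0, Pi.single σ 1) F p = 1 := by
  have h0 := dirDeriv_eq_sum (F := F) (fun _ => 1) p
  simp only [one_mul] at h0
  rw [← h0]
  have h1 : HasDerivAt (fun r : ℝ => p + r • ((0 : ℝ), ((fun _ => 1) : Energy N)))
      ((1 : ℝ) • ((0 : ℝ), ((fun _ => 1) : Energy N))) 0 :=
    ((hasDerivAt_id (0 : ℝ)).smul_const _).const_add p
  have h2 := (hF.potential.smooth.differentiable
    (p + (0 : ℝ) • ((0 : ℝ), ((fun _ => 1) : Energy N)))).hasFDerivAt.comp_hasDerivAt 0 h1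
  have h3 : (F ∘ fun r : ℝ => p + r • ((0 : ℝ), ((fun _ => 1) : Energy N))) = fun r => F p + r := by
    ext r
    have h4 : p + r • ((0 : ℝ), ((fun _ => 1) : Energy N)) = (p.1, p.2 + fun _ => r) := by
      ext <;> simp
    rw [Function.comp_apply, h4, hF.shift]
  rw [h3] at h2
  have h5 := h2.unique ((hasDerivAt_id (0 : ℝ)).const_add (F p))
  simpa [dirDeriv] using h5

lemma sum_sq_dirDeriv {F : ℝ × Energy N → ℝ} (u : κ → Energy N) (p : ℝ × Energy N) :
    ∑ k, dirDeriv (0, u k) F p ^ 2 = ∑ σ, ∑ τ, dirDeriv (0, Pi.single σ 1) F p *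
      dirDeriv (0, Pi.single τ 1) F p * ∑ k, u k σ * u k τ := by
  simp_rw [fun k => dirDeriv_eq_sum (F := F) (u k) p, pow_two, Finset.sum_mul_sum,
    Finset.mul_sum]
  rw [Finset.sum_comm]
  refine Finset.sum_congr rfl fun σ _ => ?_
  rw [Finset.sum_comm]
  refine Finset.sum_congr rfl fun τ _ => Finset.sum_congr rfl fun k _ => ?_
  ring

lemma sum_spinField (hN : 0 < N) (β : ℝ) (σ τ : Config N) :
    ∑ i, spinField β i σ * spinField β i τ = β ^ 2 * N * overlap σ τ := by
  have hN' : (N : ℝ) ≠ 0 := by positivity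
  rw [overlap, ← mul_assoc, mul_assoc (β ^ 2), mul_inv_cancel₀ hN', mul_one, Finset.mul_sum]
  refine Finset.sum_congr rfl fun i _ => ?_
  simp only [spinField]
  ring

lemma spin_mul_self (σ : Config N) (i : Fin N) : spin σ i * spin σ i = 1 := by
  rcases Int.units_eq_one_or (σ i) with h | h <;> simp [spin, h]

lemma overlap_self (hN : 0 < N) (σ : Config N) : overlap σ σ = 1 := by
  have hN' : (N : ℝ) ≠ 0 := by positivity
  simp [overlap, spin_mul_self, hN']

/-- The energies `w k` reproduce, up to the constant `δ`, the covariance of the mean field model. -/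
structure IsCoupling (β δ : ℝ) (w : ι → Energy N) : Prop where
  nonneg : 0 ≤ δ
  covariance : ∀ σ τ, ∑ k, w k σ * w k τ = β ^ 2 * N / 2 * overlap σ τ ^ 2 - δ

/-- The directions of the interpolation: the couplings and the fields on the spins. -/
abbrev directions (β : ℝ) (w : ι → Energy N) : ι ⊕ Fin N → Energy N := Sum.elim w (spinField β)

/-- Expanded over pairs of configurations, the right side averages β² N / 2 (R² - 2 q R) - δ for the
overlap R. Completing the square leaves the nonnegative term (R - q)². -/
lemma sum_sq_directions_ge (hN : 0 < N) {β δ : ℝ} {w : ι → Energy N} (hw : IsCoupling β δ w)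
    {F : ℝ × Energy N → ℝ} (hF : FreeEnergy F) (q : ℝ) (p : ℝ × Energy N) :
    -(β ^ 2 * N / 2 * q ^ 2 + δ) ≤ ∑ k, dirDeriv (0, w k) F p ^ 2
      - q * ∑ i, dirDeriv (0, spinField β i) F p ^ 2 := by
  rw [sum_sq_dirDeriv w, sum_sq_dirDeriv (spinField β), Finset.mul_sum, ← Finset.sum_sub_distrib]
  simp_rw [hw.covariance, sum_spinField hN, Finset.mul_sum, ← Finset.sum_sub_distrib]
  set P := fun σ : Config N => dirDeriv (0, Pi.single σ 1) F p with hP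
  have h1 : ∑ σ, ∑ τ, P σ * P τ * -(β ^ 2 * N / 2 * q ^ 2 + δ)
      = -(β ^ 2 * N / 2 * q ^ 2 + δ) := by
    simp only [← Finset.sum_mul, ← Finset.sum_mul_sum, hP, hF.gibbs_sum, one_mul]
  rw [← h1]
  refine Finset.sum_le_sum fun σ _ => Finset.sum_le_sum fun τ _ => ?_
  have h2 : 0 ≤ P σ * P τ := mul_nonneg (hF.gibbs_nonneg σ p) (hF.gibbs_nonneg τ p)
  have h3 : 0 ≤ β ^ 2 * N / 2 * (overlap σ τ - q) ^ 2 := by positivity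
  have h4 : P σ * P τ * (β ^ 2 * N / 2 * overlap σ τ ^ 2 - δ)
      - q * (P σ * P τ * (β ^ 2 * N * overlap σ τ))
      = P σ * P τ * -(β ^ 2 * N / 2 * q ^ 2 + δ)
        + P σ * P τ * (β ^ 2 * N / 2 * (overlap σ τ - q) ^ 2) := by ring
  have h5 := mul_nonneg h2 h3
  change _ ≤ P σ * P τ * _ - q * (P σ * P τ * _)
  linarith

/-- At m = 1 the expression ∂²F + (∂F)² along u is the Gibbs average of u(σ)². Summed over the
directions this is independent of σ: β² N / 2 - δ from the couplings, β² N from the fields. -/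
lemma flowDeriv_logSum (hN : 0 < N) {β δ : ℝ} {w : ι → Energy N} (hw : IsCoupling β δ w)
    (p : ℝ × Energy N) :
    flowDeriv (directions β w) 1 (Sum.elim (fun _ => 1) (fun _ => -1))
      (fun p : ℝ × Energy N => logSum p.2) p
      = Real.sin p.1 * Real.cos p.1 * (-(β ^ 2 * N / 2) - δ) := by
  have h1 := flowDeriv_mul_exp (freeEnergy_logSum (N := N)).potential (directions β w) 1
    (Sum.elim (fun _ => 1) (fun _ => -1)) p
  simp only [one_mul, exp_logSum] at h1
  have hd : ∀ (b : ℝ × Energy N) (c : Config N → ℝ),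
      dirDeriv b (fun p : ℝ × Energy N => ∑ σ, c σ * Real.exp (p.2 σ))
        = fun p => ∑ σ, c σ * b.2 σ * Real.exp (p.2 σ) := by
    intro b c
    ext p
    have h2 : ∀ σ, HasFDerivAt (fun p : ℝ × Energy N => c σ * Real.exp (p.2 σ)) _ p := fun σ =>
      (((evalEnergy σ).hasFDerivAt (x := p)).exp).const_mul (c σ)
    have h3 : HasFDerivAt (fun p : ℝ × Energy N => ∑ σ, c σ * Real.exp (p.2 σ)) _ p :=
      HasFDerivAt.fun_sum fun σ _ => h2 σ
    rw [dirDeriv, h3.fderiv]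
    simp only [sum_apply]
    refine Finset.sum_congr rfl fun σ _ => ?_
    simp [evalEnergy]
    ring
  have hd1 : ∀ b : ℝ × Energy N, dirDeriv b (fun p : ℝ × Energy N => ∑ σ, Real.exp (p.2 σ))
        = fun p => ∑ σ, b.2 σ * Real.exp (p.2 σ) := by
    intro b
    have := hd b fun _ => 1
    simpa only [one_mul] using this
  simp only [hd1, hd, Pi.zero_apply, zero_mul, Finset.sum_const_zero, zero_add] at h1
  have h2 : ∑ k : ι ⊕ Fin N, Real.sin p.1 * Real.cos p.1 *
      (Sum.elim (fun _ => 1) (fun _ => -1) : ι ⊕ Fin N → ℝ) k *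
      ∑ σ, directions β w k σ * directions β w k σ * Real.exp (p.2 σ)
      = Real.sin p.1 * Real.cos p.1 * (-(β ^ 2 * N / 2) - δ) * ∑ σ, Real.exp (p.2 σ) := by
    rw [Fintype.sum_sum_type]
    simp only [Sum.elim_inl, Sum.elim_inr, mul_one, ← Finset.mul_sum]
    rw [Finset.sum_comm, Finset.sum_comm (s := Finset.univ (α := Fin N))]
    simp_rw [← Finset.sum_mul, hw.covariance, sum_spinField hN, overlap_self hN]
    rw [← Finset.mul_sum, ← Finset.mul_sum]
    ring
  rw [h2] at h1
  exact mul_right_cancel₀ (sum_exp_pos p.2).ne' h1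

end Interpolation

/-! ### Interpolation along a cascade -/

section Cascades

variable {N : ℕ} {ι : Type} [Fintype ι]

/-- The rate of the interpolation associated with the last step of a cascade. -/
def cascadeRate (N : ℕ) (β δ m q I : ℝ) : ℝ := β ^ 2 * N / 2 * (-I - m * q ^ 2) - δ * m

lemma sum_exp_sum_spinField (β : ℝ) (y : Fin N → ℝ) :
    ∑ σ, Real.exp ((∑ i, y i • spinField β i : Energy N) σ)
      = ∏ i, (2 * Real.cosh (β * y i)) := by
  have h1 : ∀ i, 2 * Real.cosh (β * y i) = ∑ s : ℤˣ, Real.exp (β * y i * ((s : ℤ) : ℝ)) := by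
    intro i
    rw [Real.cosh_eq, show (Finset.univ : Finset ℤˣ) = {1, -1} from rfl,
      Finset.sum_pair (by decide)]
    push_cast
    ring_nf
  simp_rw [h1]
  rw [Finset.prod_univ_sum, Fintype.piFinset_univ]
  refine Finset.sum_congr rfl fun σ _ => ?_
  rw [Finset.sum_apply, Real.exp_sum]
  refine Finset.prod_congr rfl fun i _ => ?_
  simp only [Pi.smul_apply, spinField, spin, smul_eq_mul]
  congr 1
  ring

lemma logSum_sum_spinField (β : ℝ) (y : Fin N → ℝ) :
    logSum (∑ i, y i • spinField β i)
      = ∑ i, (Real.log (Real.cosh (β * y i)) + Real.log 2) := by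
  rw [logSum, sum_exp_sum_spinField, Real.log_prod fun i _ => by
    have := Real.cosh_pos (β * y i); positivity]
  refine Finset.sum_congr rfl fun i _ => ?_
  rw [Real.log_mul two_ne_zero (Real.cosh_pos _).ne', add_comm]

lemma sum_smul_spinField_add (β : ℝ) (y : Fin N → ℝ) (j : Fin N) (r : ℝ) :
    (∑ i, y i • spinField β i : Energy N) + r • spinField β j
      = ∑ i, Function.update y j (y j + r) i • spinField β i := by
  rw [← Finset.add_sum_erase _ _ (Finset.mem_univ j), ← Finset.add_sum_erase (a := j)
    Finset.univ (fun i => Function.update y j (y j + r) i • _) (Finset.mem_univ j)]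
  have h : ∀ i ∈ Finset.univ.erase j, Function.update y j (y j + r) i • spinField β i
      = y i • spinField β i := fun i hi => by
    rw [Function.update_of_ne (Finset.ne_of_mem_erase hi)]
  rw [Finset.sum_congr rfl h, Function.update_self, add_smul]
  abel

lemma sum_update_comp (ψ : Fin N → ℝ → ℝ) (y : Fin N → ℝ) (j : Fin N) (t : ℝ) :
    ∑ i, ψ i (Function.update y j t i) = ψ j t + ∑ i ∈ Finset.univ.erase j, ψ i (y i) := by
  rw [← Finset.add_sum_erase _ _ (Finset.mem_univ j), Function.update_self]
  congr 1
  refine Finset.sum_congr rfl fun i hi => ?_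
  rw [Function.update_of_ne (Finset.ne_of_mem_erase hi)]

lemma hasDerivAt_sin_cos (c₁ c₂ θ : ℝ) : HasDerivAt
    (fun θ => c₁ * Real.sin θ + c₂ * Real.cos θ) (c₁ * Real.cos θ - c₂ * Real.sin θ) θ := by
  have := ((Real.hasDerivAt_sin θ).const_mul c₁).add ((Real.hasDerivAt_cos θ).const_mul c₂)
  rwa [mul_neg, ← sub_eq_add_neg] at this

/-- The effect of the randomization of the fields acting on a set of spins. -/
lemma exists_flow_spins {β m q q' : ℝ} (hm : 0 < m) (hq : q' ≤ q) {φ : ℝ → ℝ}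
    (hφ : Potential φ) (w : ι → Energy N) {K : ℝ → ℝ} {F : ℝ × Energy N → ℝ} (hF : FreeEnergy F)
    (h0 : ∀ y : Fin N → ℝ, F (0, ∑ i, y i • spinField β i) = ∑ i, (φ (y i) + Real.log 2))
    (h1 : ∀ z, F (Real.pi / 2, z) = logSum z)
    (hd : ∀ θ ∈ Icc 0 (Real.pi / 2), ∀ z, flowDeriv (directions β w) m
      (Sum.elim (fun _ => 1) (fun _ => -q)) F (θ, z) ≤ K θ) (T : Finset (Fin N)) :
    ∃ G : ℝ × Energy N → ℝ, FreeEnergy G ∧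
      (∀ y : Fin N → ℝ, G (0, ∑ i, y i • spinField β i) = ∑ i,
        ((if i ∈ T then coleHopf m (fun _ => √(q - q')) 1 φ else φ) (y i) + Real.log 2)) ∧
      (∀ z, G (Real.pi / 2, z) = logSum z) ∧
      ∀ θ ∈ Icc 0 (Real.pi / 2), ∀ z, flowDeriv (directions β w) m
        (Sum.elim (fun _ => 1) (fun i => if i ∈ T then -q' else -q)) G (θ, z) ≤ K θ := by
  classical
  induction T using Finset.induction_on with
  | empty => exact ⟨F, hF, by simpa using h0, h1, by simpa using hd⟩
  | insert j T hj ih =>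
    obtain ⟨G, hG, g0, g1, gd⟩ := ih
    set c := √(q - q') with hc
    have hcc : c * c = q - q' := Real.mul_self_sqrt (sub_nonneg.2 hq)
    -- The field is fully present at θ = 0 and absent at θ = π/2. Since a' a = -(q - q') sin θ cos
    -- θ, the weight of the site j moves from -q to -q'.
    set a : ℝ → ℝ := fun θ => 0 * Real.sin θ + c * Real.cos θ with ha
    have hamp := amplitude_sin_cos (N := N) 0 c
    refine ⟨coleHopf m (fun p : ℝ × Energy N => a p.1) (0, spinField β j) G,
      hG.coleHopf (a := a) hamp hm _, fun y => ?_, fun z => ?_, fun θ hθ => ?_⟩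
    · set ψ : Fin N → ℝ → ℝ :=
        fun i t => (if i ∈ T then coleHopf m (fun _ => c) 1 φ else φ) t + Real.log 2 with hψ
      set B := ∑ i ∈ Finset.univ.erase j, ψ i (y i) with hB
      -- At θ = 0, moving along the field of the site j changes one summand only, so the
      -- transformation on energies reduces to the one on the line, up to an additive constant.
      have e1 : ∀ r : ℝ, G ((0, ∑ i, y i • spinField β i + r • spinField β j))
          = φ (y j + r) + (Real.log 2 + B) := by
        intro r
        rw [sum_smul_spinField_add, g0]
        change ∑ i, ψ i (Function.update y j (y j + r) i) = _
        rw [sum_update_comp, ← hB]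
        simp only [hψ, hj, if_false]
        ring
      have e2 : coleHopf m (fun p : ℝ × Energy N => a p.1) (0, spinField β j) G
          (0, ∑ i, y i • spinField β i)
          = coleHopf m (fun _ => c) 1 (fun t => φ t + (Real.log 2 + B)) (y j) := by
        simp only [coleHopf, gaussAvg, step_point, e1]
        simp [ha]
      rw [e2, coleHopf_add_const hφ hm, ← Finset.add_sum_erase _ _ (Finset.mem_univ j),
        if_pos (Finset.mem_insert_self j T), hB, add_assoc]
      congr 2
      refine Finset.sum_congr rfl fun i hi => ?_
      simp only [hψ, Finset.mem_insert, Finset.ne_of_mem_erase hi, false_or]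
    · rw [coleHopf_of_zero hm (by simp [ha]), g1]
    · refine flowDeriv_coleHopf_le (a' := fun θ => 0 * Real.cos θ - c * Real.sin θ)
        (d := -(q - q')) hG hamp (hasDerivAt_sin_cos 0 c) (fun θ => ?_) hm (directions β w) _
        (Sum.inr j) (fun z => ?_)
      · rw [← hcc]
        ring
      · convert gd θ hθ z using 2
        ext k
        rcases k with k | i
        · rw [Function.update_of_ne (by simp)]; rfl
        · by_cases hi : i = j
          · subst hi
            simp [hj]
            ring
          · rw [Function.update_of_ne (by simpa using hi)]
            simp [hi]

/-- Only the terms m (∂F)² feel the change of m. This is the step of the recursion where the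
nonnegative overlap square is discarded. -/
lemma flowDeriv_drop_le (hN : 0 < N) {β δ : ℝ} {w : ι → Energy N} (hw : IsCoupling β δ w)
    {F : ℝ × Energy N → ℝ} (hF : FreeEnergy F) {m m' q : ℝ} (hm : m' ≤ m) {p : ℝ × Energy N}
    (hp : 0 ≤ Real.sin p.1 * Real.cos p.1) :
    flowDeriv (directions β w) m' (Sum.elim (fun _ => 1) (fun _ => -q)) F p
      ≤ flowDeriv (directions β w) m (Sum.elim (fun _ => 1) (fun _ => -q)) F p
        + Real.sin p.1 * Real.cos p.1 * ((m - m') * (β ^ 2 * N / 2 * q ^ 2 + δ)) := by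
  have h1 := mul_le_mul_of_nonneg_left (sum_sq_directions_ge hN hw hF q p)
    (mul_nonneg hp (sub_nonneg.2 hm))
  simp only [flowDeriv, Fintype.sum_sum_type, Sum.elim_inl, Sum.elim_inr, mul_add,
    Finset.sum_add_distrib, one_mul, ← Finset.mul_sum, directions] at h1 ⊢
  linarith

/-- The interpolation between the mean field model and the independent spins of a cascade. -/
lemma Cascade.exists_interpolation (hN : 0 < N) {β δ : ℝ} {w : ι → Energy N}
    (hw : IsCoupling β δ w) {q m I : ℝ} {φ : ℝ → ℝ} (h : Cascade β q m I φ) :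
    ∃ F : ℝ × Energy N → ℝ, FreeEnergy F ∧
      (∀ y : Fin N → ℝ, F (0, ∑ i, y i • spinField β i) = ∑ i, (φ (y i) + Real.log 2)) ∧
      (∀ z, F (Real.pi / 2, z) = logSum z) ∧
      ∀ θ ∈ Icc 0 (Real.pi / 2), ∀ z, flowDeriv (directions β w) m
        (Sum.elim (fun _ => 1) (fun _ => -q)) F (θ, z)
          ≤ Real.sin θ * Real.cos θ * cascadeRate N β δ m q I := by
  induction h with
  | base =>
    refine ⟨_, freeEnergy_logSum, fun y => logSum_sum_spinField β y, fun z => rfl,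
      fun θ _ z => (flowDeriv_logSum hN hw (θ, z)).le.trans (le_of_eq ?_)⟩
    simp only [cascadeRate]
    ring
  | @flow q m I φ q' hc h0 h1 ih =>
    obtain ⟨F, hF, f0, f1, fd⟩ := ih
    have hm := hc.facts.1
    obtain ⟨G, hG, g0, g1, gd⟩ := exists_flow_spins hm h1 hc.facts.2.2.2.2.potential w hF f0 f1 fd
      Finset.univ
    refine ⟨G, hG, by simpa using g0, g1, fun θ hθ z => ?_⟩
    have := gd θ hθ z
    simp only [Finset.mem_univ, if_true] at this
    -- I grows by m (q² - q'²), so -I - m q² and with it the rate are unchanged.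
    refine this.trans (le_of_eq ?_)
    simp only [cascadeRate]
    ring
  | @drop q m I φ m' _ _ hm' ih =>
    obtain ⟨F, hF, f0, f1, fd⟩ := ih
    refine ⟨F, hF, f0, f1, fun θ hθ z => ?_⟩
    have hsc : 0 ≤ Real.sin θ * Real.cos θ :=
      mul_nonneg (Real.sin_nonneg_of_nonneg_of_le_pi hθ.1 (by linarith [hθ.2, Real.pi_pos]))
        (Real.cos_nonneg_of_mem_Icc ⟨by linarith [hθ.1, Real.pi_pos], hθ.2⟩)
    have h1 := flowDeriv_drop_le hN hw hF (q := q) hm' (p := (θ, z)) hsc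
    have h2 := fd θ hθ z
    simp only [cascadeRate] at h2 ⊢
    linarith

end Cascades

/-! ### Couplings and averages over the disorder -/

section Disorder

variable {N : ℕ} {ι : Type} [Fintype ι] {Ω : Type*} [MeasurableSpace Ω] {P : Measure Ω}
  [IsProbabilityMeasure P] {g : ι → Ω → ℝ}

lemma measurable_logSum : Measurable (logSum : Energy N → ℝ) :=
  Real.measurable_log.comp (Finset.measurable_sum _ fun σ _ => (measurable_pi_apply σ).exp)

lemma integrable_logSum {Y : Ω → Energy N} (hY : ∀ σ, Integrable (fun o => Y o σ) P) :
    Integrable (fun o => logSum (Y o)) P := by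
  have hYi : Integrable Y P := Integrable.of_eval hY
  obtain ⟨C, hC, h⟩ := (freeEnergy_logSum (N := N)).potential.growth
  refine Integrable.mono' (((integrable_const (1 : ℝ)).add hYi.norm).const_mul C)
    (measurable_logSum.comp_aemeasurable hYi.aemeasurable).aestronglyMeasurable
    (ae_of_all _ fun o => ?_)
  simpa using h (0, Y o)

lemma integrable_gaussianReal_id : Integrable (fun ξ : ℝ => ξ) (gaussianReal 0 1) :=
  (expSmooth_clm (ContinuousLinearMap.id ℝ ℝ)).integrable

lemma integrable_of_hasLaw {X : Ω → ℝ} (h : HasLaw X (gaussianReal 0 1) P) : Integrable X P := by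
  have := integrable_gaussianReal_id
  rw [← h.map_eq] at this
  exact this.comp_aemeasurable h.aemeasurable

/-- The energies `z` perturbed by the couplings in `T`. -/
def perturbed (g : ι → Ω → ℝ) (w : ι → Energy N) (T : Finset ι) (z : Energy N) (o : Ω) :
    Energy N := z + ∑ k ∈ T, g k o • w k

lemma integrable_perturbed (hg : ∀ k, HasLaw (g k) (gaussianReal 0 1) P) (w : ι → Energy N)
    (T : Finset ι) (z : Energy N) (σ : Config N) :
    Integrable (fun o => perturbed g w T z o σ) P := by
  simp only [perturbed, Pi.add_apply, Finset.sum_apply, Pi.smul_apply, smul_eq_mul]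
  exact (integrable_const _).add (integrable_finsetSum _ fun k _ =>
    (integrable_of_hasLaw (hg k)).mul_const _)

/-- The coupling k is independent of the perturbation by those in T, so the joint law is a product
and Fubini's theorem integrates it separately. -/
lemma integral_logSum_perturbed_insert [DecidableEq ι] (hi : iIndepFun g P)
    (hg : ∀ k, HasLaw (g k) (gaussianReal 0 1) P) (w : ι → Energy N) {T : Finset ι} {k : ι}
    (hk : k ∉ T) (z : Energy N) :
    Integrable (fun ξ : ℝ => ∫ o, logSum (perturbed g w T (z + ξ • w k) o) ∂P) (gaussianReal 0 1) ∧
    ∫ o, logSum (perturbed g w (insert k T) z o) ∂P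
      = ∫ ξ, ∫ o, logSum (perturbed g w T (z + ξ • w k) o) ∂P ∂gaussianReal 0 1 := by
  set Y : Ω → Energy N := perturbed g w T 0 with hY
  have hYm : AEMeasurable Y P :=
    (Integrable.of_eval (integrable_perturbed hg w T 0)).aemeasurable
  have hXY : IndepFun (g k) Y P := by
    have h1 := hi.indepFun_finset₀ {k} T (by simpa using hk) fun i => (hg i).aemeasurable
    have h2 : Measurable (fun x : ({k} : Finset ι) → ℝ => x ⟨k, by simp⟩) :=
      measurable_pi_apply _
    have h3 : Measurable (fun y : T → ℝ => ∑ i : T, y i • w i) := by fun_prop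
    have h4 := h1.comp h2 h3
    have e : Y = (fun y : T → ℝ => ∑ i : T, y i • w i) ∘ fun o (i : T) => g i o := by
      ext o
      simp only [hY, perturbed, zero_add, Function.comp_apply]
      rw [Finset.sum_coe_sort T fun i => g i o • w i]
    rw [e]
    exact h4
  have hmap := (indepFun_iff_map_prod_eq_prod_map_map (hg k).aemeasurable hYm).1 hXY
  rw [(hg k).map_eq] at hmap
  set H : ℝ × Energy N → ℝ := fun p => logSum (z + p.1 • w k + p.2) with hH
  have hHm : Measurable H := measurable_logSum.comp (by fun_prop)
  have hpm : AEMeasurable (fun o => (g k o, Y o)) P := (hg k).aemeasurable.prodMk hYm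
  have e1 : (fun o => logSum (perturbed g w (insert k T) z o)) = fun o => H (g k o, Y o) := by
    ext o
    simp only [hH, hY, perturbed, zero_add, Finset.sum_insert hk, add_assoc]
  have e2 : (fun ξ : ℝ => ∫ o, logSum (perturbed g w T (z + ξ • w k) o) ∂P)
      = fun ξ => ∫ y, H (ξ, y) ∂(P.map Y) := by
    ext ξ
    rw [integral_map hYm (f := fun y => H (ξ, y))
      (hHm.comp measurable_prodMk_left).aestronglyMeasurable]
    simp only [hH, hY, perturbed, zero_add]
  have : IsProbabilityMeasure (P.map Y) := Measure.isProbabilityMeasure_map hYm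
  have h3 : Integrable H ((gaussianReal 0 1).prod (P.map Y)) := by
    rw [← hmap, integrable_map_measure hHm.aestronglyMeasurable hpm]
    have := integrable_logSum (integrable_perturbed hg w (insert k T) z)
    rwa [e1] at this
  rw [e1, e2]
  refine ⟨h3.integral_prod_left, ?_⟩
  rw [← integral_prod _ h3, ← hmap, integral_map hpm hHm.aestronglyMeasurable]

/-- The effect of the randomization of a set of couplings. -/
lemma exists_flow_couplings [DecidableEq ι] (hi : iIndepFun g P) (hg : ∀ k, HasLaw (g k) (gaussianReal 0 1) P)
    {β m : ℝ} (hm : 0 < m) (w : ι → Energy N) {K : ℝ → ℝ} {F : ℝ × Energy N → ℝ}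
    (hF : FreeEnergy F) (h1 : ∀ z, F (Real.pi / 2, z) = logSum z)
    (hd : ∀ θ ∈ Icc 0 (Real.pi / 2), ∀ z, flowDeriv (directions β w) m
      (Sum.elim (fun _ => 1) (fun _ => 0)) F (θ, z) ≤ K θ) (T : Finset ι) :
    ∃ G : ℝ × Energy N → ℝ, FreeEnergy G ∧ (∀ z, G (0, z) = F (0, z)) ∧
      (∀ z, ∫ o, logSum (perturbed g w T z o) ∂P ≤ G (Real.pi / 2, z)) ∧
      ∀ θ ∈ Icc 0 (Real.pi / 2), ∀ z, flowDeriv (directions β w) m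
        (Sum.elim (fun k => if k ∈ T then 0 else 1) (fun _ => 0)) G (θ, z)
          ≤ K θ := by
  induction T using Finset.induction_on with
  | empty => exact ⟨F, hF, fun z => rfl, by simp [perturbed, h1], by
      simpa only [Finset.notMem_empty, if_false] using hd⟩
  | insert j T hj ih =>
    obtain ⟨G, hG, g0, g1, gd⟩ := ih
    set a : ℝ → ℝ := fun θ => 1 * Real.sin θ + 0 * Real.cos θ with ha
    have hamp := amplitude_sin_cos (N := N) 1 0
    refine ⟨coleHopf m (fun p : ℝ × Energy N => a p.1) (0, w j) G,
      hG.coleHopf (a := a) hamp hm _, fun z => ?_, fun z => ?_, fun θ hθ => ?_⟩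
    · rw [coleHopf_of_zero hm (by simp [ha]), g0]
    -- At θ = π/2 the amplitude is 1, the true size of the coupling. Jensen's inequality replaces
    -- the average by the transformation, so the last m may stay positive.
    · refine le_trans ?_ (hG.potential.gaussAvg_le_coleHopf hm _ _ _)
      obtain ⟨hint, heq⟩ := integral_logSum_perturbed_insert hi hg w hj z
      rw [heq, gaussAvg]
      have h2 := (hG.potential.smooth.displaced_line (fun p : ℝ × Energy N => a p.1) (0, w j)
        (Real.pi / 2, z)).integrable
      refine integral_mono hint h2 fun ξ => ?_
      have e : ((Real.pi / 2, z) : ℝ × Energy N) + (ξ * a (Real.pi / 2, z).1) • (0, w j)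
          = (Real.pi / 2, z + ξ • w j) := by
        rw [step_point]
        simp [ha]
      exact (g1 _).trans (le_of_eq (by rw [e]))
    · refine flowDeriv_coleHopf_le (a' := fun θ => 1 * Real.cos θ - 0 * Real.sin θ)
        (d := 1) hG hamp (hasDerivAt_sin_cos 1 0) (fun θ => by ring) hm (directions β w) _
        (Sum.inl j) (fun z => ?_)
      convert gd θ hθ z using 2
      ext k
      rcases k with k | i
      · by_cases hk : k = j
        · subst hk
          simp [hj]
        · rw [Function.update_of_ne (by simpa using hk)]
          simp [hk]
      · rw [Function.update_of_ne (by simp)]; rfl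

/-- With all weights zero only ∂_θ F is left, and sin² θ / 2 is a primitive of sin θ cos θ; this is
the factor 1/2. -/
lemma le_of_flowDeriv_le {β m A : ℝ} {w : ι → Energy N} {F : ℝ × Energy N → ℝ}
    (hF : FreeEnergy F) (hd : ∀ θ ∈ Icc 0 (Real.pi / 2), ∀ z, flowDeriv (directions β w) m
      (fun _ => 0) F (θ, z) ≤ Real.sin θ * Real.cos θ * A) (z : Energy N) :
    F (Real.pi / 2, z) ≤ F (0, z) + A / 2 := by
  have hder : ∀ θ, HasDerivAt (fun θ => F (θ, z) - A / 2 * Real.sin θ ^ 2)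
      (dirDeriv (1, 0) F (θ, z) - A / 2 * (2 * Real.sin θ ^ 1 * Real.cos θ)) θ := by
    intro θ
    refine HasDerivAt.sub ?_ (((Real.hasDerivAt_sin θ).pow 2).const_mul (A / 2))
    have h1 : HasDerivAt (fun θ : ℝ => (θ, z)) ((1 : ℝ), (0 : Energy N)) θ :=
      (hasDerivAt_id θ).prodMk (hasDerivAt_const θ z)
    exact (hF.potential.smooth.differentiable (θ, z)).hasFDerivAt.comp_hasDerivAt θ h1
  have hanti : AntitoneOn (fun θ => F (θ, z) - A / 2 * Real.sin θ ^ 2) (Icc 0 (Real.pi / 2)) := by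
    refine antitoneOn_of_deriv_nonpos (convex_Icc _ _)
      (fun θ _ => (hder θ).continuousAt.continuousWithinAt)
      (fun θ _ => (hder θ).differentiableAt.differentiableWithinAt) fun θ hθ => ?_
    rw [(hder θ).deriv]
    have h2 := hd θ (interior_subset hθ) z
    simp only [flowDeriv, zero_mul, Finset.sum_const_zero, mul_zero, add_zero] at h2
    linarith
  have h3 := hanti (left_mem_Icc.2 (by positivity)) (right_mem_Icc.2 (by positivity))
    (by positivity)
  simp only [Real.sin_pi_div_two, Real.sin_zero] at h3
  linarith

/-- The broken replica symmetry bound for a cascade. -/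
theorem Cascade.integral_logSum_le (hN : 0 < N) (hi : iIndepFun g P)
    (hg : ∀ k, HasLaw (g k) (gaussianReal 0 1) P) {β δ : ℝ} {w : ι → Energy N}
    (hw : IsCoupling β δ w) {m I : ℝ} {φ : ℝ → ℝ} (hc : Cascade β 0 m I φ) (h : ℝ) :
    (N : ℝ)⁻¹ * ∫ o, logSum (∑ i, h • spinField β i + ∑ k, g k o • w k) ∂P
      ≤ Real.log 2 + φ h - β ^ 2 / 4 * I := by
  classical
  obtain ⟨F, hF, f0, f1, fd⟩ := hc.exists_interpolation hN hw
  have hm := hc.facts.1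
  obtain ⟨G, hG, g0, g1, gd⟩ := exists_flow_couplings (β := β) hi hg hm w hF f1
    (by simpa only [neg_zero] using fd) Finset.univ
  have e : (Sum.elim (fun k : ι => if k ∈ (Finset.univ : Finset ι) then (0 : ℝ) else 1) (fun _ : Fin N => (0 : ℝ))) = fun _ => 0 := by
    ext k
    rcases k with k | k <;> simp
  rw [e] at gd
  have h1 := (g1 (∑ i, h • spinField β i)).trans (le_of_flowDeriv_le hG gd _)
  rw [g0, f0 fun _ => h] at h1
  have hN' : (0 : ℝ) < N := by exact_mod_cast hN
  rw [inv_mul_le_iff₀ hN']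
  refine h1.trans ?_
  -- Integration leaves the term -δ m / 2, which only helps and is dropped.
  have h2 : 0 ≤ δ * m := mul_nonneg hw.nonneg hm.le
  simp only [Finset.sum_const, Finset.card_univ, Fintype.card_fin, nsmul_eq_mul, cascadeRate]
  nlinarith

end Disorder

/-! ### The two forms of the model -/

section Bounds

variable {N : ℕ} {ι : Type} [Fintype ι] {Ω : Type*} [MeasurableSpace Ω] {P : Measure Ω}
  [IsProbabilityMeasure P] {g : ι → Ω → ℝ}

lemma sum_lt_of_symmetric {n : ℕ} {f : Fin n → Fin n → ℝ} (hf : ∀ i j, f i j = f j i) :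
    ∑ i, ∑ j, f i j = 2 * ∑ p : Couple n, f p.1.1 p.1.2 + ∑ i, f i i := by
  have h1 : ∀ i j, f i j = (if i < j then f i j else 0) + (if j < i then f i j else 0)
      + (if i = j then f i i else 0) := by
    intro i j
    rcases lt_trichotomy i j with h | h | h
    · simp [h, h.not_gt, h.ne]
    · subst h; simp
    · simp [h, h.not_gt, h.ne']
  have h2 : ∑ p : Couple n, f p.1.1 p.1.2 = ∑ i, ∑ j, if i < j then f i j else 0 := by
    rw [← Fintype.sum_prod_type' (f := fun i j => if i < j then f i j else 0),
      ← Finset.sum_filter]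
    exact (Finset.sum_subtype _ (by simp) fun p : Fin n × Fin n => f p.1 p.2).symm
  have h3 : (∑ i, ∑ j, if j < i then f i j else 0) = ∑ i, ∑ j, if i < j then f i j else 0 := by
    rw [Finset.sum_comm]
    simp_rw [hf]
  conv_lhs => enter [2, i, 2, j]; rw [h1 i j]
  simp only [Finset.sum_add_distrib, Finset.sum_ite_eq, Finset.mem_univ, if_true]
  rw [h3, h2]
  ring

/-- The energies of the couplings of the mean field model. -/
def pairEnergy (β : ℝ) (p : Couple N) : Energy N :=
  fun σ => β / √(N : ℝ) * (spin σ p.1.1 * spin σ p.1.2)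

/-- The squared overlap sums over all ordered pairs of sites; the N diagonal pairs, absent from the
couplings, account for δ = β² / 2. -/
lemma isCoupling_pairEnergy (hN : 0 < N) (β : ℝ) :
    IsCoupling β (β ^ 2 / 2) (pairEnergy (N := N) β) := by
  refine ⟨by positivity, fun σ τ => ?_⟩
  have hN' : (N : ℝ) ≠ 0 := by positivity
  have h1 := sum_lt_of_symmetric (n := N)
    (f := fun i j => (spin σ i * spin τ i) * (spin σ j * spin τ j)) fun i j => mul_comm _ _
  rw [← Finset.sum_mul_sum] at h1
  have h2 : ∀ i, (spin σ i * spin τ i) * (spin σ i * spin τ i) = 1 := fun i => by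
    rw [mul_mul_mul_comm, spin_mul_self, spin_mul_self, one_mul]
  simp only [h2, Finset.sum_const, Finset.card_univ, Fintype.card_fin, nsmul_eq_mul, mul_one] at h1
  have h3 : ∑ p : Couple N, pairEnergy β p σ * pairEnergy β p τ = β ^ 2 / N *
      ∑ p : Couple N, (spin σ p.1.1 * spin τ p.1.1) * (spin σ p.1.2 * spin τ p.1.2) := by
    rw [Finset.mul_sum]
    refine Finset.sum_congr rfl fun p _ => ?_
    have : β ^ 2 / (N : ℝ) = β / √(N : ℝ) * (β / √(N : ℝ)) := by
      rw [div_mul_div_comm, Real.mul_self_sqrt (Nat.cast_nonneg N), pow_two]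
    rw [this]
    simp only [pairEnergy]
    ring
  have h4 : ∑ p : Couple N, (spin σ p.1.1 * spin τ p.1.1) * (spin σ p.1.2 * spin τ p.1.2)
      = ((∑ i, spin σ i * spin τ i) ^ 2 - N) / 2 := by linarith
  rw [h3, overlap, h4]
  field_simp

/-- The energies of a realization of the overlap field by independent variables, one for each
ordered pair of sites. -/
def productEnergy (β : ℝ) (p : Fin N × Fin N) : Energy N :=
  fun σ => β * √((N : ℝ) / 2) * ((N : ℝ)⁻¹ * (spin σ p.1 * spin σ p.2))

lemma sum_product_spin (σ τ : Config N) :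
    ∑ p : Fin N × Fin N, ((N : ℝ)⁻¹ * (spin σ p.1 * spin σ p.2)) *
      ((N : ℝ)⁻¹ * (spin τ p.1 * spin τ p.2)) = overlap σ τ ^ 2 := by
  rw [overlap, mul_pow, pow_two (∑ i, _), Finset.sum_mul_sum, Fintype.sum_prod_type,
    Finset.mul_sum]
  refine Finset.sum_congr rfl fun i _ => ?_
  rw [Finset.mul_sum]
  refine Finset.sum_congr rfl fun j _ => ?_
  ring

lemma isCoupling_productEnergy (β : ℝ) : IsCoupling β 0 (productEnergy (N := N) β) := by
  refine ⟨le_rfl, fun σ τ => ?_⟩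
  have h : √((N : ℝ) / 2) * √((N : ℝ) / 2) = (N : ℝ) / 2 := Real.mul_self_sqrt (by positivity)
  rw [← sum_product_spin, sub_zero, Finset.mul_sum]
  refine Finset.sum_congr rfl fun p _ => ?_
  rw [mul_div_assoc, ← h]
  simp only [productEnergy]
  ring

lemma log_partitionFunction (β h : ℝ) (J : Couple N → ℝ) :
    Real.log (partitionFunction β h J)
      = logSum (∑ i, h • spinField β i + ∑ p, J p • pairEnergy β p) := by
  rw [partitionFunction, logSum]
  congr 1
  refine Finset.sum_congr rfl fun σ _ => ?_
  congr 1
  simp only [hamiltonian, Pi.add_apply, Finset.sum_apply, Pi.smul_apply, smul_eq_mul, spinField,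
    pairEnergy]
  rw [mul_sub, Finset.mul_sum, Finset.mul_sum, Finset.mul_sum, Finset.mul_sum, sub_eq_add_neg,
    add_comm, ← Finset.sum_neg_distrib]
  congr 1
  · exact Finset.sum_congr rfl fun i _ => by ring
  · exact Finset.sum_congr rfl fun i _ => by ring

lemma log_fieldPartitionFunction (β h : ℝ) (k : Config N → ℝ) :
    Real.log (fieldPartitionFunction β h k)
      = logSum (∑ i, h • spinField β i + (β * √((N : ℝ) / 2)) • k) := by
  rw [fieldPartitionFunction, logSum]
  congr 1
  refine Finset.sum_congr rfl fun σ _ => ?_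
  rw [← Real.exp_add]
  congr 1
  simp only [Pi.add_apply, Finset.sum_apply, Pi.smul_apply, smul_eq_mul, spinField]
  rw [Finset.mul_sum, add_comm]
  congr 1
  exact Finset.sum_congr rfl fun i _ => by ring

lemma integral_logSum_le_trial (hN : 0 < N) (hi : iIndepFun g P)
    (hg : ∀ k, HasLaw (g k) (gaussianReal 0 1) P) {β δ : ℝ} {w : ι → Energy N}
    (hw : IsCoupling β δ w) (h : ℝ) {x : ℝ → ℝ} (hx : x ∈ OrderParameter) :
    (N : ℝ)⁻¹ * ∫ o, logSum (∑ i, h • spinField β i + ∑ k, g k o • w k) ∂P ≤ trial β h x :=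
  le_trial_of_forall_cascade hx fun _ _ _ hc => hc.integral_logSum_le hN hi hg hw h

lemma integral_gaussian_mul [DecidableEq ι] (hi : iIndepFun g P)
    (hg : ∀ k, HasLaw (g k) (gaussianReal 0 1) P) (k l : ι) :
    ∫ o, g k o * g l o ∂P = if k = l then 1 else 0 := by
  have h0 : ∀ k, ∫ o, g k o ∂P = 0 := fun k => by
    rw [(hg k).integral_eq, integral_id_gaussianReal]
  split_ifs with h
  · subst h
    have h1 := (hg k).variance_eq
    rw [variance_id_gaussianReal, variance_of_integral_eq_zero (hg k).aemeasurable (h0 k)] at h1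
    simpa [pow_two] using h1
  · rw [(hi.indepFun h).integral_fun_mul_eq_mul_integral (hg k).aemeasurable.aestronglyMeasurable
      (hg l).aemeasurable.aestronglyMeasurable, h0, zero_mul]

section Law

variable {κ Ω' : Type*} [Fintype κ] [DecidableEq κ] [MeasurableSpace Ω'] {P' : Measure Ω'}

/-- The mean and variance of every linear functional determine a Gaussian law through its
characteristic function, and here they are read off from the covariance. -/
lemma integral_dual_sq {X : Ω → κ → ℝ} (hX : HasGaussianLaw X P) (h0 : ∀ σ, ∫ o, X o σ ∂P = 0)
    (L : StrongDual ℝ (κ → ℝ)) : ∫ o, L (X o) ∂P = 0 ∧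
      ∫ o, L (X o) ^ 2 ∂P = ∑ σ, ∑ τ, L (Pi.single σ 1) * L (Pi.single τ 1) *
        ∫ o, X o σ * X o τ ∂P := by
  have hL : ∀ x, L x = ∑ σ, L (Pi.single σ 1) * x σ := by
    intro x
    conv_lhs => rw [pi_eq_sum_univ' x, map_sum]
    refine Finset.sum_congr rfl fun σ _ => ?_
    rw [map_smul, smul_eq_mul, mul_comm]
  have h2 : ∀ σ, MemLp (fun o => X o σ) 2 P := fun σ =>
    HasGaussianLaw.memLp_two (hX.eval (X := fun σ o => X o σ) σ)
  have h1 : ∀ σ, Integrable (fun o => X o σ) P := fun σ => (h2 σ).integrable (by norm_num)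
  have h3 : ∀ σ τ, Integrable (fun o => X o σ * X o τ) P := fun σ τ => (h2 σ).integrable_mul (h2 τ)
  constructor
  · simp_rw [fun o => hL (X o)]
    rw [integral_finsetSum _ fun σ _ => (h1 σ).const_mul _]
    simp [integral_const_mul, h0]
  · have h4 : ∀ o, L (X o) ^ 2 = ∑ σ, ∑ τ, L (Pi.single σ 1) * L (Pi.single τ 1) *
        (X o σ * X o τ) := by
      intro o
      rw [hL (X o), pow_two, Finset.sum_mul_sum]
      refine Finset.sum_congr rfl fun σ _ => Finset.sum_congr rfl fun τ _ => ?_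
      ring
    simp_rw [h4]
    rw [integral_finsetSum _ fun σ _ => integrable_finsetSum _ fun τ _ => (h3 σ τ).const_mul _]
    refine Finset.sum_congr rfl fun σ _ => ?_
    rw [integral_finsetSum _ fun τ _ => (h3 σ τ).const_mul _]
    simp only [integral_const_mul]

/-- Centered Gaussian vectors with the same covariance have the same law. -/
lemma map_eq_of_covariance_eq [IsProbabilityMeasure P'] {X : Ω → κ → ℝ} {Y : Ω' → κ → ℝ}
    (hX : HasGaussianLaw X P) (hY : HasGaussianLaw Y P') (hX0 : ∀ σ, ∫ o, X o σ ∂P = 0)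
    (hY0 : ∀ σ, ∫ o, Y o σ ∂P' = 0)
    (h : ∀ σ τ, ∫ o, X o σ * X o τ ∂P = ∫ o, Y o σ * Y o τ ∂P') : P.map X = P'.map Y := by
  have := Measure.isProbabilityMeasure_map (μ := P) hX.aemeasurable
  have := Measure.isProbabilityMeasure_map (μ := P') hY.aemeasurable
  refine Measure.ext_of_charFunDual (funext fun L => ?_)
  obtain ⟨x1, x2⟩ := integral_dual_sq hX hX0 L
  obtain ⟨y1, y2⟩ := integral_dual_sq hY hY0 L
  have hx := variance_of_integral_eq_zero (L.continuous.measurable.comp_aemeasurable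
    hX.aemeasurable) x1
  have hy := variance_of_integral_eq_zero (L.continuous.measurable.comp_aemeasurable
    hY.aemeasurable) y1
  rw [hX.charFunDual_map_eq, hY.charFunDual_map_eq, hx, hy]
  simp only [Function.comp_apply, x1, y1, x2, y2, h]

end Law

lemma hasLaw_eval_pi_gaussianReal (p : ι) : HasLaw (fun y : ι → ℝ => y p) (gaussianReal 0 1)
    (Measure.pi fun _ => gaussianReal 0 1) :=
  (measurePreserving_eval (fun _ : ι => gaussianReal 0 1) p).hasLaw

lemma iIndepFun_eval_pi_gaussianReal : iIndepFun (fun (p : ι) (y : ι → ℝ) => y p)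
    (Measure.pi fun _ => gaussianReal 0 1) :=
  iIndepFun_pi (X := fun _ x => x) fun _ => aemeasurable_id

/-- The overlap field has the law of a sum of independent variables over the pairs of sites. -/
lemma IsOverlapField.map_eq {K : Config N → Ω → ℝ} (hK : IsOverlapField K P) :
    P.map (fun o σ => K σ o) = (Measure.pi fun _ : Fin N × Fin N => gaussianReal 0 1).map
      fun g σ => ∑ p, g p * ((N : ℝ)⁻¹ * (spin σ p.1 * spin σ p.2)) := by
  classical
  set μ := Measure.pi fun _ : Fin N × Fin N => gaussianReal 0 1 with hμ
  have hi : iIndepFun (fun (p : Fin N × Fin N) (g : Fin N × Fin N → ℝ) => g p) μ :=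
    iIndepFun_eval_pi_gaussianReal
  have hg : ∀ p, HasLaw (fun g : Fin N × Fin N → ℝ => g p) (gaussianReal 0 1) μ :=
    hasLaw_eval_pi_gaussianReal
  have hG := hi.hasGaussianLaw fun p => (hg p).hasGaussianLaw
  have h2 : ∀ p, MemLp (fun g : Fin N × Fin N → ℝ => g p) 2 μ := fun p =>
    (hg p).hasGaussianLaw.memLp_two
  have h1 : ∀ p, Integrable (fun g : Fin N × Fin N → ℝ => g p) μ := fun p =>
    (h2 p).integrable (by norm_num)
  have h0 : ∀ p, ∫ g, g p ∂μ = 0 := fun p => by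
    rw [(hg p).integral_eq, integral_id_gaussianReal]
  refine map_eq_of_covariance_eq ?_ ?_ hK.centered (fun σ => ?_) fun σ τ => ?_
  · exact (hK.gaussian.hasGaussianLaw Finset.univ).map_fun (ContinuousLinearMap.pi fun σ =>
      ContinuousLinearMap.proj (R := ℝ) (φ := fun _ : (Finset.univ : Finset (Config N)) => ℝ)
        ⟨σ, Finset.mem_univ σ⟩)
  · have h3 := hG.map_fun (ContinuousLinearMap.pi fun σ : Config N =>
      ∑ p, ((N : ℝ)⁻¹ * (spin σ p.1 * spin σ p.2)) • ContinuousLinearMap.proj (R := ℝ)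
        (φ := fun _ : Fin N × Fin N => ℝ) p)
    refine h3.congr (ae_of_all _ fun y => funext fun σ => ?_)
    simp [mul_comm]
  · rw [integral_finsetSum _ fun p _ => (h1 p).mul_const _]
    simp [integral_mul_const, h0]
  · rw [hK.covariance, ← sum_product_spin]
    have h4 : ∀ g : Fin N × Fin N → ℝ,
        (∑ p, g p * ((N : ℝ)⁻¹ * (spin σ p.1 * spin σ p.2))) *
          (∑ p, g p * ((N : ℝ)⁻¹ * (spin τ p.1 * spin τ p.2)))
        = ∑ p, ∑ r, g p * g r * (((N : ℝ)⁻¹ * (spin σ p.1 * spin σ p.2)) *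
          ((N : ℝ)⁻¹ * (spin τ r.1 * spin τ r.2))) := by
      intro g
      rw [Finset.sum_mul_sum]
      refine Finset.sum_congr rfl fun p _ => Finset.sum_congr rfl fun r _ => ?_
      ring
    simp_rw [h4]
    have h5 : ∀ p r, Integrable (fun g : Fin N × Fin N → ℝ => g p * g r) μ := fun p r =>
      (h2 p).integrable_mul (h2 r)
    rw [integral_finsetSum _ fun p _ => integrable_finsetSum _ fun r _ => (h5 p r).mul_const _]
    refine Finset.sum_congr rfl fun p _ => ?_
    rw [integral_finsetSum _ fun r _ => (h5 p r).mul_const _]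
    simp only [integral_mul_const, integral_gaussian_mul hi hg, ite_mul, one_mul, zero_mul,
      Finset.sum_ite_eq, Finset.mem_univ, if_true]

theorem IsQuenchedDisorder.bound (hN : 0 < N) {J : Couple N → Ω → ℝ}
    (hJ : IsQuenchedDisorder J P) (β h : ℝ) :
    Integrable (fun o => Real.log (partitionFunction β h fun p => J p o)) P ∧
      ∀ x ∈ OrderParameter, (N : ℝ)⁻¹ * ∫ o, Real.log (partitionFunction β h fun p => J p o) ∂P
        ≤ trial β h x := by
  simp only [log_partitionFunction]
  exact ⟨integrable_logSum (integrable_perturbed hJ.law (pairEnergy β) Finset.univ _),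
    fun x hx => integral_logSum_le_trial hN hJ.indep hJ.law (isCoupling_pairEnergy hN β) h hx⟩

theorem IsOverlapField.bound (hN : 0 < N) {K : Config N → Ω → ℝ}
    (hK : IsOverlapField K P) (β h : ℝ) :
    Integrable (fun o => Real.log (fieldPartitionFunction β h fun σ => K σ o)) P ∧
      ∀ x ∈ OrderParameter, (N : ℝ)⁻¹ * ∫ o, Real.log (fieldPartitionFunction β h fun σ => K σ o) ∂P
        ≤ trial β h x := by
  have hKi : ∀ σ, Integrable (K σ) P := fun σ => (hK.gaussian.hasGaussianLaw_eval σ).integrable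
  have hKm : AEMeasurable (fun o σ => K σ o) P :=
    aemeasurable_pi_lambda _ fun σ => (hKi σ).aemeasurable
  simp only [log_fieldPartitionFunction]
  refine ⟨integrable_logSum fun σ => ?_, fun x hx => ?_⟩
  · simp only [Pi.add_apply, Pi.smul_apply, smul_eq_mul]
    exact (integrable_const _).add ((hKi σ).const_mul _)
  · set H : (Config N → ℝ) → ℝ :=
      fun k => logSum (∑ i, h • spinField β i + (β * √((N : ℝ) / 2)) • k) with hH
    have hHm : Measurable H := measurable_logSum.comp (by fun_prop)
    have e1 : ∫ o, H (fun σ => K σ o) ∂P = ∫ k, H k ∂(P.map fun o σ => K σ o) :=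
      (integral_map hKm hHm.aestronglyMeasurable).symm
    change (N : ℝ)⁻¹ * ∫ o, H (fun σ => K σ o) ∂P ≤ _
    have hYm : Measurable (fun (y : Fin N × Fin N → ℝ) (σ : Config N) =>
        ∑ p, y p * ((N : ℝ)⁻¹ * (spin σ p.1 * spin σ p.2))) := by fun_prop
    -- Only the law of the field matters, so the integral is moved to the product space, where the
    -- couplings are independent and reproduce the covariance with δ = 0.
    rw [e1, hK.map_eq, integral_map hYm.aemeasurable hHm.aestronglyMeasurable]
    refine le_trans (le_of_eq ?_) (integral_logSum_le_trial hN
      iIndepFun_eval_pi_gaussianReal hasLaw_eval_pi_gaussianReal (isCoupling_productEnergy β) h hx)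
    congr 2
    ext g
    simp only [hH]
    congr 2
    ext σ
    simp only [Pi.smul_apply, smul_eq_mul, Finset.sum_apply, productEnergy, Finset.mul_sum]
    exact Finset.sum_congr rfl fun p _ => by ring

lemma orderParameter_zero : (fun _ => 0 : ℝ → ℝ) ∈ OrderParameter :=
  ⟨fun _ _ _ _ _ => le_rfl, fun _ _ => ⟨le_rfl, zero_le_one⟩⟩

/-- The bound itself for N = 1, a single spin with no couplings, is a lower bound that does not
depend on x. -/
lemma bddBelow_trial (β h : ℝ) : BddBelow (range fun x : OrderParameter => trial β h x) := by
  have hJ : IsQuenchedDisorder (fun (p : Couple 1) (J : Couple 1 → ℝ) => J p)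
      (Measure.pi fun _ => gaussianReal 0 1) :=
    ⟨iIndepFun_eval_pi_gaussianReal, hasLaw_eval_pi_gaussianReal⟩
  exact ⟨_, forall_mem_range.2 fun x => (hJ.bound one_pos β h).2 x x.2⟩

end Bounds

end SpinGlass

end

theorem mainTheorem2 (β h : ℝ) :
    -- the equation is well posed, so that the trial function is defined for each order parameter
    (∀ x ∈ SpinGlass.OrderParameter,
      SpinGlass.IsParisiSolution β x (SpinGlass.parisiFunction β x) ∧
      ∀ g, SpinGlass.IsParisiSolution β x g →
        ∀ q ∈ Icc (0 : ℝ) 1, ∀ y, g q y = SpinGlass.parisiFunction β x q y) ∧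
    -- the infimum of the trial function is finite
    BddBelow (range fun x : SpinGlass.OrderParameter => SpinGlass.trial β h x) ∧
    -- the bounds, for each size and each realization of the disorder
    ∀ (N : ℕ), 0 < N → ∀ {Ω : Type*} [MeasurableSpace Ω] (P : Measure Ω) [IsProbabilityMeasure P],
      (∀ J : SpinGlass.Couple N → Ω → ℝ, SpinGlass.IsQuenchedDisorder J P →
        Integrable (fun ω => Real.log (SpinGlass.partitionFunction β h fun p => J p ω)) P ∧
        (∀ x ∈ SpinGlass.OrderParameter,
          (N : ℝ)⁻¹ * ∫ ω, Real.log (SpinGlass.partitionFunction β h fun p => J p ω) ∂P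
            ≤ SpinGlass.trial β h x) ∧
        (N : ℝ)⁻¹ * ∫ ω, Real.log (SpinGlass.partitionFunction β h fun p => J p ω) ∂P
          ≤ ⨅ x : SpinGlass.OrderParameter, SpinGlass.trial β h x) ∧
      (∀ K : SpinGlass.Config N → Ω → ℝ, SpinGlass.IsOverlapField K P →
        Integrable (fun ω => Real.log (SpinGlass.fieldPartitionFunction β h fun σ => K σ ω)) P ∧
        (∀ x ∈ SpinGlass.OrderParameter,
          (N : ℝ)⁻¹ * ∫ ω, Real.log (SpinGlass.fieldPartitionFunction β h fun σ => K σ ω) ∂P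
            ≤ SpinGlass.trial β h x) ∧
        (N : ℝ)⁻¹ * ∫ ω, Real.log (SpinGlass.fieldPartitionFunction β h fun σ => K σ ω) ∂P
          ≤ ⨅ x : SpinGlass.OrderParameter, SpinGlass.trial β h x) := by
  have : Nonempty SpinGlass.OrderParameter := ⟨⟨_, SpinGlass.orderParameter_zero⟩⟩
  refine ⟨fun x hx => ?_, SpinGlass.bddBelow_trial β h, fun N hN Ω _ P _ =>
    ⟨fun J hJ => ?_, fun K hK => ?_⟩⟩
  · have hp := SpinGlass.isParisiSolution_parisiFunction β hx
    exact ⟨hp, fun g hg q hq y => hg.unique hp hx hq y⟩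
  · obtain ⟨hi, hb⟩ := hJ.bound hN β h
    exact ⟨hi, hb, le_ciInf fun x => hb x x.2⟩
  · obtain ⟨hi, hb⟩ := hK.bound hN β h
    exact ⟨hi, hb, le_ciInf fun x => hb x x.2⟩
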